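/- Let $d,b\ge 1$ be integers, $M>0$, $x_0\in[0,1]^d$. Observe $Y_i=f(X_i)+\sigma_i\xi_i$, $i=1,\dots,n$, where the $X_i$ are i.i.d. uniform on $[0,1]^d$, the $\xi_i$ are i.i.d., independent of the $X_i$, with a density $g$ that is symmetric and nonincreasing on $[0,\infty)$, and $(\sigma_i)_{i\ge1}$ is a sequence with $\sigma_i\ge\sigma_{\min}>0$, $\sigma_{\min}$ known. Write $\mathbb E_f$ for the expectation and $g_i=g(\cdot/\sigma_i)/\sigma_i$. For $\gamma>0$ let $\rho_\gamma(z)=z^2/2$ if $|z|\le\gamma$ and $\rho_\gamma(z)=\gamma(|z|-\gamma/2)$ otherwise (Huber function), and $c_\gamma=2\int_0^{\gamma\sigma_{\min}}g(z)\,dz$. Fix $\gamma_0>0$ with $c_{\gamma_0}>0$ and assume that $\inf_i\int\rho_{\gamma_0}''(z)g_i(z)\,dz\ge c_{\gamma_0}$. Let $K\ge0$ be a bounded measurable function vanishing outside $[-1/2,1/2]^d$ with $\int K=1$, $K_\infty=\|K\|_\infty$, and assume that for some $h_0>0$ one has $x_0+h_0z\in[0,1]^d$ whenever $K(z)\ne0$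 (automatic if $x_0$ is an interior point of the cube). Let $N_b$ be the number of $p\in\mathbb N^d$ with $|p|=p_1+\dots+p_d\le b$, $U(z)=(z^p)_{|p|\le b}$, and $\lambda$ the smallest eigenvalue of $\int_{[-1/2,1/2]^d}U(x)U(x)^\top K(x)\,dx$. For $h\in(0,1]$ let $V(h)=\prod_j[x_{0,j}-h/2,x_{0,j}+h/2]\cap[0,1]^d$, $f_t(x)=\sum_{|p|\le b}t_p\big(\tfrac{x-x_0}{h}\big)^p\mathbf 1_{V(h)}(x)$, and let $\hat\theta(h)$ be a (measurable) minimizer over $\{t\in\mathbb R^{N_b}:\|t\|_1\le M\}$ of $$t\mapsto\frac1{nh^d}\sum_{i=1}^n\rho_{\gamma_0}\big(Y_i-f_t(X_i)\big)K\Big(\frac{X_i-x_0}{h}\Big).$$ Put $h_{\min}=(\ln n)^{2/d}n^{-1/d}$, $h_{\max}=n^{-1/(2b+d)}$, $h_k=2^{-k}h_{\max}$, let $\mathbf k_n$ be the largest $k$ with $h_k\ge h_{\min}$, $\hat f^{(k)}=\hat\theta_{0,\dots,0}(h_k)$, $S_n(l)=\big[(1+l\ln2)/(nh_l^d)\big]^{1/2}$,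 and for $r\ge1$ $$C=\frac{2N_b}{\lambda\int_0^{\gamma_0\sigma_{\min}}g(z)\,dz}\Big(1+2K_\infty(1\vee\gamma_0)\sqrt{rd}\Big),$$ $$\hat k=\inf\big\{k\le\mathbf k_n:\ |\hat f^{(k)}-\hat f^{(l)}|\le C\,S_n(l),\ l=k+1,\dots,\mathbf k_n\big\},\qquad \hat f^*_{\gamma_0}(x_0)=\hat f^{(\hat k)}.$$ For $\beta,L>0$ let $m$ be the largest integer strictly smaller than $\beta$ and let $\mathbb H_d(\beta,L,M)$ be the set of $f:[0,1]^d\to\mathbb R$ having all partial derivatives up to order $m$ with $|\partial^pf(x)-\partial^pf(y)|\le L\|x-y\|_1^{\beta-m}$ for $|p|=m$, $x,y\in[0,1]^d$, and $\sum_{|p|\le m}\sup_{[0,1]^d}|\partial^pf|\le M$. Let $$\phi_n(\beta)=\Big(\frac{\varrho_n(\beta)}{n}\Big)^{\beta/(2\beta+d)},\qquad \varrho_n(\beta)=1+\frac{2(b-\beta)}{(2\beta+d)(2b+d)}\ln n .$$ Then, for all $\beta\in(0,b]$, $L>0$ and $r\ge1$ (with $\hat f^*_{\gamma_0}$ built from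 the constant $C$ for this $r$), $$\limsup_{n\to\infty}\ \phi_n^{-r}(\beta)\sup_{f\in\mathbb H_d(\beta,L,M)}\mathbb E_f\big|\hat f^*_{\gamma_0}(x_0)-f(x_0)\big|^r<\infty .$$ -/

import Mathlib

open Set Filter Topology MeasureTheory

namespace HuberLepski

noncomputable section

/-! ### Local polynomials -/

/-- The unit cube `[0,1]^d`. -/
def cube (d : ℕ) : Set (Fin d → ℝ) := Icc 0 1

/-- Multi-indices `p ∈ ℕ^d` with `|p| = p_1 + ... + p_d ≤ b`. -/
def multiIdx (d b : ℕ) : Finset (Fin d → ℕ) :=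
  (Fintype.piFinset fun _ : Fin d => Finset.range (b + 1)).filter fun p => ∑ j, p j ≤ b

/-- The number `N_b` of such multi-indices. -/
def numIdx (d b : ℕ) : ℕ := (multiIdx d b).card

lemma zero_mem_multiIdx (d b : ℕ) : (0 : Fin d → ℕ) ∈ multiIdx d b := by
  simp [multiIdx]

/-- Coefficient vectors `t = (t_p)_{|p| ≤ b}`. -/
abbrev Coef (d b : ℕ) : Type := ↥(multiIdx d b) → ℝ

/-- The monomial `z^p = z_1^{p_1} ... z_d^{p_d}`. -/
def monom {d : ℕ} (p : Fin d → ℕ) (z : Fin d → ℝ) : ℝ := ∏ j, z j ^ p j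

/-- The neighbourhood `V_{x₀}(h)`: the cube of side `h` centred at `x₀`, cut by `[0,1]^d`. -/
def nbhd {d : ℕ} (x₀ : Fin d → ℝ) (h : ℝ) : Set (Fin d → ℝ) :=
  (Set.univ.pi fun j => Icc (x₀ j - h / 2) (x₀ j + h / 2)) ∩ cube d

/-- The local polynomial `f_t(x) = ∑_p t_p ((x - x₀)/h)^p` for `x ∈ V_{x₀}(h)`, zero elsewhere. -/
def locPoly {d b : ℕ} (x₀ : Fin d → ℝ) (h : ℝ) (t : Coef d b) : (Fin d → ℝ) → ℝ :=
  (nbhd x₀ h).indicator fun x =>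
    ∑ p : ↥(multiIdx d b), t p * monom p.1 (fun j => (x j - x₀ j) / h)

/-- The parameter set `Θ(M)`, the `ℓ₁`-ball of radius `M`. -/
def paramSet (d b : ℕ) (M : ℝ) : Set (Coef d b) := {t | ∑ p, |t p| ≤ M}

/-! ### Kernel -/

/-- A kernel: a bounded nonnegative function vanishing outside `[-1/2,1/2]^d`, with integral one. -/
structure IsKernel {d : ℕ} (K : (Fin d → ℝ) → ℝ) : Prop where
  measurable : Measurable K
  nonneg : ∀ z, 0 ≤ K z
  support : ∀ z, K z ≠ 0 → ∀ j, z j ∈ Icc (-(1 / 2) : ℝ) (1 / 2)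
  bounded : BddAbove (Set.range K)
  integral_eq_one : ∫ z, K z = 1

/-- The sup-norm `K_∞` of a (bounded) kernel. -/
def kerSup {d : ℕ} (K : (Fin d → ℝ) → ℝ) : ℝ := ⨆ z, |K z|

/-- The matrix `∫_{[-1/2,1/2]^d} U(x) U(x)ᵀ K(x) dx`, where `U(x) = (x^p)_{|p| ≤ b}`. -/
def gram (d b : ℕ) (K : (Fin d → ℝ) → ℝ) : Matrix ↥(multiIdx d b) ↥(multiIdx d b) ℝ :=
  Matrix.of fun p q =>
    ∫ x in Set.univ.pi fun _ : Fin d => Icc (-(1 / 2) : ℝ) (1 / 2),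
      monom p.1 x * monom q.1 x * K x

lemma gram_isHermitian (d b : ℕ) (K : (Fin d → ℝ) → ℝ) : (gram d b K).IsHermitian := by
  ext p q
  simp [gram, mul_comm (monom p.1 _)]

/-- The smallest eigenvalue `λ` of that matrix. -/
def minEig (d b : ℕ) (K : (Fin d → ℝ) → ℝ) : ℝ :=
  ⨅ p, (gram_isHermitian d b K).eigenvalues p

/-! ### Observations -/

/-- Symmetric probability densities on `ℝ` that are monotone (necessarily nonincreasing)
on `[0, ∞)`. -/
structure IsSymmDensity (g : ℝ → ℝ) : Prop where
  measurable : Measurable g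
  nonneg : ∀ z, 0 ≤ g z
  integral_eq_one : ∫ z, g z = 1
  symm : ∀ z, g (-z) = g z
  antitone : AntitoneOn g (Ici 0)

/-- The densities `g_i = g(· / σ_i) / σ_i` of the scaled noise variables `σ_i ξ_i`. -/
def scaledDensity (g : ℝ → ℝ) (σ : ℕ → ℝ) : ℕ → ℝ → ℝ := fun i z => g (z / σ i) / σ i

/-- `c(ρ, (g_i)_i) = inf_i ∫ ρ''(z) g_i(z) dz`. -/
def curvature (ρ : ℝ → ℝ) (g : ℕ → ℝ → ℝ) : ℝ := ⨅ i, ∫ z, deriv (deriv ρ) z * g i z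

/-- The class of sequences of symmetric monotone densities with `c(ρ, (g_i)_i) ≥ c`. -/
def densityClass (ρ : ℝ → ℝ) (c : ℝ) : Set (ℕ → ℝ → ℝ) :=
  {g | (∀ i, IsSymmDensity (g i)) ∧ c ≤ curvature ρ g}

/-- A sample `(X_i, Y_i)_{i < n}`. -/
abbrev Sample (d n : ℕ) : Type := Fin n → (Fin d → ℝ) × ℝ

/-- The law of one observation `(X, f(X) + s ξ)`, where `X` is uniform on `[0,1]^d` and `ξ` is
independent of `X` with density `g`. -/
def obsLawOne {d : ℕ} (g : ℝ → ℝ) (s : ℝ) (f : (Fin d → ℝ) → ℝ) : Measure ((Fin d → ℝ) × ℝ) :=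
  (((volume : Measure (Fin d → ℝ)).restrict (cube d)).prod
    ((volume : Measure ℝ).withDensity fun z => ENNReal.ofReal (g z))).map
      fun w => (w.1, f w.1 + s * w.2)

/-- The law `ℙ_f` of the `n` independent observations `Y_i = f(X_i) + σ_i ξ_i`. -/
def obsLaw {d : ℕ} (g : ℝ → ℝ) (σ : ℕ → ℝ) (f : (Fin d → ℝ) → ℝ) (n : ℕ) :
    Measure (Sample d n) :=
  Measure.pi fun i : Fin n => obsLawOne g (σ i) f

/-! ### Hölder class and maximal risk -/

/-- The largest integer strictly smaller than `β` (for `β > 0`). -/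
def strictFloor (β : ℝ) : ℕ := ⌈β⌉₊ - 1

/-- The isotropic Hölder class. `D p` is the partial derivative `∂^p f` on `[0,1]^d`
(one-sided on the faces). -/
def holderClass (d : ℕ) (β L M : ℝ) : Set ((Fin d → ℝ) → ℝ) :=
  {f | ∃ D : (Fin d → ℕ) → (Fin d → ℝ) → ℝ,
    (∀ x ∈ cube d, D 0 x = f x) ∧
    (∀ p : Fin d → ℕ, ∑ j, p j < strictFloor β → ∀ j, ∀ x ∈ cube d,
      HasDerivWithinAt (fun s => D p (Function.update x j s)) (D (p + Pi.single j 1) x)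
        (Icc 0 1) (x j)) ∧
    (∀ p : Fin d → ℕ, ∑ j, p j = strictFloor β → ∀ x ∈ cube d, ∀ y ∈ cube d,
      |D p x - D p y| ≤ L * (∑ j, |x j - y j|) ^ (β - (strictFloor β : ℝ))) ∧
    ∑ p ∈ multiIdx d (strictFloor β), ⨆ x ∈ cube d, ‖D p x‖ₑ ≤ ENNReal.ofReal M}

/-- The maximal risk `sup_f 𝔼_f |f̃_n(x₀) - f(x₀)|^r` over a class `H` of functions. -/
def maxRisk {d : ℕ} (g : ℝ → ℝ) (σ : ℕ → ℝ) (x₀ : Fin d → ℝ) (r : ℝ) (n : ℕ)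
    (est : Sample d n → ℝ) (H : Set ((Fin d → ℝ) → ℝ)) : ENNReal :=
  ⨆ f ∈ H, ∫⁻ Z, ENNReal.ofReal (|est Z - f x₀| ^ r) ∂(obsLaw g σ f n)

/-! ### The local M-estimator -/

/-- The Huber function. -/
def huber (γ z : ℝ) : ℝ := if |z| ≤ γ then z ^ 2 / 2 else γ * (|z| - γ / 2)

/-- The local criterion
`(n h^d)⁻¹ ∑_i ρ(Y_i - f_t(X_i)) K((X_i - x₀)/h)`. -/
def criterion {d b n : ℕ} (ρ : ℝ → ℝ) (K : (Fin d → ℝ) → ℝ) (x₀ : Fin d → ℝ) (h : ℝ)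
    (Z : Sample d n) (t : Coef d b) : ℝ :=
  1 / ((n : ℝ) * h ^ d) *
    ∑ i, ρ ((Z i).2 - locPoly x₀ h t (Z i).1) * K (fun j => ((Z i).1 j - x₀ j) / h)

/-- `θ` is a (measurable) version of the minimizer of the criterion over `Θ(M)`, for every sample
size `n` and bandwidth `h ∈ (0,1]`. -/
def IsMinimizer {d b : ℕ} (ρ : ℝ → ℝ) (K : (Fin d → ℝ) → ℝ) (x₀ : Fin d → ℝ) (M : ℝ)
    (θ : (n : ℕ) → ℝ → Sample d n → Coef d b) : Prop :=
  ∀ (n : ℕ), ∀ h ∈ Ioc (0 : ℝ) 1, Measurable (θ n h) ∧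
    ∀ Z : Sample d n, θ n h Z ∈ paramSet d b M ∧
      ∀ t ∈ paramSet d b M, criterion ρ K x₀ h Z (θ n h Z) ≤ criterion ρ K x₀ h Z t

/-! ### Bandwidth selection -/

def hMin (d n : ℕ) : ℝ := Real.log n ^ (2 / (d : ℝ)) * (n : ℝ) ^ (-(1 / (d : ℝ)))

def hMax (d b n : ℕ) : ℝ := (n : ℝ) ^ (-(1 / (2 * (b : ℝ) + d)))

/-- The bandwidths `h_k = 2^{-k} h_max`. -/
def bandwidth (d b n k : ℕ) : ℝ := hMax d b n / 2 ^ k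

/-- The largest `k` with `h_k ≥ h_min` (it exists for all large `n`). -/
def lastIdx (d b n : ℕ) : ℕ := sSup {k : ℕ | hMin d n ≤ bandwidth d b n k}

/-- `S_n(l) = ((1 + l ln 2) / (n h_l^d))^{1/2}`. -/
def noiseLevel (d b n l : ℕ) : ℝ :=
  Real.sqrt ((1 + l * Real.log 2) / (n * bandwidth d b n l ^ d))

/-- The estimator `f̂^{(k)}(x₀)`: the constant coefficient at bandwidth `h_k`. -/
def lpa {d b n : ℕ} (θ : (n : ℕ) → ℝ → Sample d n → Coef d b) (k : ℕ) (Z : Sample d n) : ℝ :=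
  θ n (bandwidth d b n k) Z ⟨0, zero_mem_multiIdx d b⟩

/-- Lepski's index `k̂` with threshold constant `C`. -/
def selIdx {d b n : ℕ} (C : ℝ) (θ : (n : ℕ) → ℝ → Sample d n → Coef d b) (Z : Sample d n) : ℕ :=
  sInf {k : ℕ | k ≤ lastIdx d b n ∧ ∀ l, k + 1 ≤ l → l ≤ lastIdx d b n →
    |lpa θ k Z - lpa θ l Z| ≤ C * noiseLevel d b n l}

/-- The selected estimator `f̂^*(x₀) = f̂^{(k̂)}(x₀)`. -/
def lepskiEst {d b : ℕ} (C : ℝ) (θ : (n : ℕ) → ℝ → Sample d n → Coef d b) (n : ℕ)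
    (Z : Sample d n) : ℝ :=
  lpa θ (selIdx C θ Z) Z

/-- `c_γ = 2 ∫_0^{γ σ_min} g(z) dz`. -/
def huberConst (g : ℝ → ℝ) (σmin γ : ℝ) : ℝ := 2 * ∫ z in (0 : ℝ)..(γ * σmin), g z

/-- The threshold constant
`C = 2 N_b / (λ ∫_0^{γ σ_min} g) * (1 + 2 K_∞ (1 ∨ γ) (r d)^{1/2})`. -/
def threshold (d b : ℕ) (K : (Fin d → ℝ) → ℝ) (g : ℝ → ℝ) (σmin γ r : ℝ) : ℝ :=
  2 * (numIdx d b : ℝ) / (minEig d b K * ∫ z in (0 : ℝ)..(γ * σmin), g z) *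
    (1 + 2 * kerSup K * max 1 γ * Real.sqrt (r * d))

/-! ### Adaptive rate -/

/-- The price to pay for adaptation `ϱ_n(β)`. -/
def price (d b n : ℕ) (β : ℝ) : ℝ :=
  1 + 2 * ((b : ℝ) - β) / ((2 * β + d) * (2 * (b : ℝ) + d)) * Real.log n

/-- `φ_n(β) = (ϱ_n(β) / n)^{β / (2β + d)}`. -/
def adaptiveRate (d b n : ℕ) (β : ℝ) : ℝ := (price d b n β / n) ^ (β / (2 * β + d))

end

end HuberLepski

open HuberLepski

namespace HuberLepski

noncomputable section

/-! ### The Huber function -/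

/-! One bandwidth. The Huber loss is convex with bounded, 1-Lipschitz derivative `clip`, so no
moment of the noise is needed. Around a fixed coefficient vector `t` the criterion is bounded below
by a linear term (the score at `t`) plus a quadratic term that counts only residuals safely inside
`[-γ, γ]` (`rawCrit_quadratic_le`). For `t` take the Taylor coefficients of `f` at `x₀`: they lie in
the parameter set, their constant term is `f x₀`, and they miss `f` by at most `L (d h / 2) ^ β`
(`exists_locPoly_approx`). Per unit of `n h ^ d`, symmetry of the noise bounds the mean score by
this bias (`abs_integral_clip_mul_le`), while the curvature condition and the monotonicity of the
density bound the mean curvature below by a multiple of `c λ` (`le_integral_curvature`), where `λ >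
0` because a nonzero polynomial vanishes only on a null set (`minEig_pos`). A Bernstein inequality
keeps both sums near their means. Convexity then traps the minimizer near `t`
(`abs_sub_le_of_score_hess`), so deviations are needed only at the single point `t`, not uniformly
over the parameter set. The result is `measure_local_error_le`.

Selection. The constant `C` is calibrated so that, once the bias is at most half the noise level
`S(l)`, the error exceeds `C S(l) / 2` with probability at most a constant times `exp (-(9/16) r d
(1 + l ln 2))` (`eventually_tail_le`). If all estimators from index `J` on are accurate in this
sense, Lepski's rule stops no later than `J` and errs by at most `(3/2) C S(J)`
(`abs_lepskiEst_sub_le`). The risk is split according to the last inaccurate index `j`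
(`lintegral_lepskiEst_le`): the error is then of order `S(j + 1)`, and `S(j) ^ r` grows like `exp
((r d / 2) j ln 2)` up to a power of the weight. Since `9/16 > 1/2`, these contributions sum to
`O(S(0) ^ r)` (`sum_noiseLevel_rpow_mul_exp_le`). At the last index only the trivial bound `2 M` is
left, but failure there has probability at most a constant times `S(0) ^ r`
(`eventually_exp_wt_lastIdx_le`).

Rate. Take `J` to be the first index at which the bias is at most half the noise level. One step
earlier the bias still dominates; solving this relation in logarithms shows that the weight is there
of order `ϱ_n(β)` and the noise level of order `φ_n(β)` (`noiseLevel_le_of_le_bias`). -/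

/-- The derivative of the Huber function: the truncation to `[-γ, γ]`. -/
def clip (γ a : ℝ) : ℝ := max (-γ) (min γ a)

lemma abs_clip_le {γ : ℝ} (hγ : 0 ≤ γ) (a : ℝ) : |clip γ a| ≤ γ := by
  rw [abs_le]
  exact ⟨le_max_left _ _, max_le (by linarith) (min_le_left _ _)⟩

lemma clip_neg {γ : ℝ} (hγ : 0 ≤ γ) (a : ℝ) : clip γ (-a) = -clip γ a := by
  unfold clip
  rcases le_total γ a with h | h <;> rcases le_total (-γ) a with h' | h' <;>
    rcases le_total γ (-a) with h2 | h2 <;> simp [*] <;> grind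

lemma abs_clip_sub_clip_le (γ a b : ℝ) : |clip γ a - clip γ b| ≤ |a - b| := by
  unfold clip
  grind

@[fun_prop]
lemma measurable_clip (γ : ℝ) : Measurable (clip γ) := by
  unfold clip; fun_prop

/-- A single formula covers both branches, so that the tangent inequality becomes a polynomial
inequality in two truncated values. -/
lemma huber_eq_clip {γ : ℝ} (hγ : 0 ≤ γ) (a : ℝ) :
    huber γ a = clip γ a * a - clip γ a ^ 2 / 2 := by
  unfold huber
  split_ifs with h
  · have : clip γ a = a := by
      rw [abs_le] at h
      simp [clip, h.1, h.2]
    rw [this]; ring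
  · rcases le_total 0 a with ha | ha
    · rw [abs_of_nonneg ha] at h ⊢
      have : clip γ a = γ := by
        simp only [clip, min_eq_left (not_le.1 h).le]; exact max_eq_right (by linarith)
      rw [this]; ring
    · rw [abs_of_nonpos ha] at h ⊢
      have : clip γ a = -γ := by
        have : a ≤ -γ := by linarith
        simp only [clip, min_eq_right (by linarith : a ≤ γ)]; exact max_eq_left this
      rw [this]; ring

lemma clip_of_abs_le {γ a : ℝ} (h : |a| ≤ γ) : clip γ a = a := by
  rw [abs_le] at h
  simp [clip, h.1, h.2]

/-- The tangent inequality for the Huber function. -/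
lemma huber_tangent_le {γ : ℝ} (hγ : 0 ≤ γ) (a b : ℝ) :
    huber γ a + clip γ a * (b - a) ≤ huber γ b := by
  rw [huber_eq_clip hγ, huber_eq_clip hγ]
  -- This product is twice the gap in the tangent inequality. For `|b| ≤ γ` it is a square;
  -- otherwise `clip γ b` is an endpoint and both factors have the same sign.
  have key : 0 ≤ (clip γ b - clip γ a) * (2 * b - clip γ a - clip γ b) := by
    have ha := abs_le.1 (abs_clip_le hγ a)
    by_cases h : |b| ≤ γ
    · rw [clip_of_abs_le h]; nlinarith [sq_nonneg (b - clip γ a)]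
    · rw [not_le, lt_abs] at h
      rcases h with h | h
      · have : clip γ b = γ := by
          simp only [clip, min_eq_left h.le]; exact max_eq_right (by linarith)
        rw [this]; exact mul_nonneg (by linarith) (by linarith)
      · have : clip γ b = -γ := by
          simp only [clip, min_eq_right (by linarith : b ≤ γ)]; exact max_eq_left (by linarith)
        rw [this]; exact mul_nonneg_of_nonpos_of_nonpos (by linarith) (by linarith)
  nlinarith

/-- The tangent inequality taken at `b`, combined with the 1-Lipschitz property of `clip`. The
constant `1` instead of the sharp `1/2` suffices for differentiability. -/
lemma huber_sub_tangent_le {γ : ℝ} (hγ : 0 ≤ γ) (a b : ℝ) :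
    huber γ b ≤ huber γ a + clip γ a * (b - a) + (b - a) ^ 2 := by
  have h1 := huber_tangent_le hγ b a
  have h2 : (clip γ b - clip γ a) * (b - a) ≤ (b - a) ^ 2 := by
    calc (clip γ b - clip γ a) * (b - a) ≤ |(clip γ b - clip γ a) * (b - a)| := le_abs_self _
      _ = |clip γ b - clip γ a| * |b - a| := abs_mul _ _
      _ ≤ |b - a| * |b - a| := mul_le_mul_of_nonneg_right (abs_clip_sub_clip_le _ _ _) (abs_nonneg _)
      _ = _ := by rw [← sq, sq_abs]
  nlinarith

/-- Strong convexity of the Huber function around small residuals. -/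
lemma huber_quadratic_le {γ ε a s : ℝ} (hγ : 0 ≤ γ) (hs : |s| ≤ ε) :
    huber γ a - clip γ a * s + (if |a| ≤ γ - ε then s ^ 2 / 2 else 0) ≤ huber γ (a - s) := by
  split_ifs with h
  -- The margin `ε` keeps both residuals in the quadratic zone, where the expansion is exact;
  -- elsewhere only the tangent line is used.
  · have h1 : |a| ≤ γ := by linarith [abs_nonneg s]
    have h2 : |a - s| ≤ γ := (abs_sub _ _).trans (by linarith)
    rw [huber, huber, if_pos h1, if_pos h2, clip_of_abs_le h1]
    exact le_of_eq (by ring)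
  · have := huber_tangent_le hγ a (a - s)
    simpa [sub_eq_add_neg] using this

/-- Convexity: in the weighted average of the tangent inequalities at the intermediate point the
slopes cancel. -/
lemma huber_segment_le {γ : ℝ} (hγ : 0 ≤ γ) {τ : ℝ} (h0 : 0 ≤ τ) (h1 : τ ≤ 1) (a s : ℝ) :
    huber γ (a - τ * s) ≤ (1 - τ) * huber γ a + τ * huber γ (a - s) := by
  have e1 := huber_tangent_le hγ (a - τ * s) a
  have e2 := huber_tangent_le hγ (a - τ * s) (a - s)
  nlinarith [mul_le_mul_of_nonneg_left e1 (sub_nonneg.2 h1), mul_le_mul_of_nonneg_left e2 h0]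

lemma hasDerivAt_huber {γ : ℝ} (hγ : 0 ≤ γ) (a : ℝ) : HasDerivAt (huber γ) (clip γ a) a := by
  rw [hasDerivAt_iff_isLittleO]
  have h1 : (fun x => huber γ x - huber γ a - (x - a) • clip γ a) =O[𝓝 a]
      fun x => (x - a) ^ 2 := by
    refine Asymptotics.IsBigO.of_bound 1 (Eventually.of_forall fun x => ?_)
    have e1 := huber_tangent_le hγ a x
    have e2 := huber_sub_tangent_le hγ a x
    rw [Real.norm_eq_abs, Real.norm_eq_abs, abs_of_nonneg (sq_nonneg (x - a)), smul_eq_mul, abs_le]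
    constructor <;> nlinarith
  refine h1.trans_isLittleO ?_
  have := Asymptotics.isLittleO_pow_sub_sub a (m := 2) (by norm_num)
  simpa using this

/-- The kinks `±γ` form a null set, so excluding them does not affect the curvature integrals. -/
lemma deriv_deriv_huber {γ : ℝ} (hγ : 0 < γ) {z : ℝ} (hz : |z| ≠ γ) :
    deriv (deriv (huber γ)) z = (Ioo (-γ) γ).indicator 1 z := by
  have h : deriv (huber γ) = clip γ := funext fun a => (hasDerivAt_huber hγ.le a).deriv
  rw [h]
  rcases lt_or_gt_of_ne hz with h1 | h1
  · have hmem : z ∈ Ioo (-γ) γ := abs_lt.1 h1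
    rw [indicator_of_mem hmem]
    have : clip γ =ᶠ[𝓝 z] id := by
      filter_upwards [isOpen_Ioo.mem_nhds hmem] with x hx
      exact clip_of_abs_le (abs_le.2 ⟨hx.1.le, hx.2.le⟩)
    rw [this.deriv_eq]; simp
  · have hmem : z ∉ Ioo (-γ) γ := fun hm => absurd (abs_lt.2 hm) (not_lt.2 h1.le)
    rw [indicator_of_notMem hmem]
    rcases lt_abs.1 h1 with h2 | h2
    · have : clip γ =ᶠ[𝓝 z] fun _ => γ := by
        filter_upwards [isOpen_Ioi.mem_nhds h2] with x hx
        have hx' : γ < x := hx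
        simp only [clip, min_eq_left hx'.le]; exact max_eq_right (by linarith)
      rw [this.deriv_eq]; simp
    · have : clip γ =ᶠ[𝓝 z] fun _ => -γ := by
        filter_upwards [isOpen_Iio.mem_nhds (by linarith : z < -γ)] with x hx
        have hx' : x < -γ := hx
        simp only [clip, min_eq_right (by linarith : x ≤ γ)]; exact max_eq_left hx'.le
      rw [this.deriv_eq]; simp

end

noncomputable section

/-! ### Taylor expansion in terms of coordinatewise derivatives -/

lemma mem_multiIdx {d b : ℕ} {p : Fin d → ℕ} : p ∈ multiIdx d b ↔ ∑ j, p j ≤ b := by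
  simp only [multiIdx, Finset.mem_filter, Fintype.mem_piFinset, Finset.mem_range, and_iff_right_iff_imp]
  intro h j
  have := Finset.single_le_sum (f := p) (fun i _ => Nat.zero_le _) (Finset.mem_univ j)
  omega

lemma sum_add_single {d : ℕ} (p : Fin d → ℕ) (j : Fin d) :
    ∑ i, (p + Pi.single j 1 : Fin d → ℕ) i = ∑ i, p i + 1 := by
  simp [Finset.sum_add_distrib]

/-- The monomial `z^p / p!`. -/
def divMonom {d : ℕ} (p : Fin d → ℕ) (z : Fin d → ℝ) : ℝ := ∏ j, (z j ^ p j / (p j).factorial)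

/-- The Taylor polynomial of order `m` built from a family of derivatives. -/
def taylorPoly {d : ℕ} (D : (Fin d → ℕ) → (Fin d → ℝ) → ℝ) (m : ℕ) (x₀ x : Fin d → ℝ) : ℝ :=
  ∑ p ∈ multiIdx d m, D p x₀ * divMonom p (x - x₀)

lemma divMonom_update {d : ℕ} (p : Fin d → ℕ) (x x₀ : Fin d → ℝ) (j : Fin d) (s : ℝ) :
    divMonom p (Function.update x j s - x₀) =
      (s - x₀ j) ^ p j / (p j).factorial *
        ∏ i ∈ Finset.univ.erase j, ((x i - x₀ i) ^ p i / (p i).factorial) := by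
  unfold divMonom
  rw [← Finset.mul_prod_erase _ _ (Finset.mem_univ j)]
  congr 1
  · simp
  · refine Finset.prod_congr rfl fun i hi => ?_
    simp [Function.update_of_ne (Finset.ne_of_mem_erase hi)]

lemma hasDerivAt_pow_div_factorial (a s : ℝ) (k : ℕ) :
    HasDerivAt (fun s => (s - a) ^ (k + 1) / (k + 1).factorial) ((s - a) ^ k / k.factorial) s := by
  have h := (((hasDerivAt_id s).sub_const a).pow (k + 1)).div_const ((k + 1).factorial : ℝ)
  convert! h using 1
  have : (k.factorial : ℝ) ≠ 0 := by positivity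
  simp [Nat.factorial_succ]
  field_simp

lemma hasDerivAt_divMonom_add_single {d : ℕ} (q : Fin d → ℕ) (x x₀ : Fin d → ℝ) (j : Fin d) :
    HasDerivAt (fun s => divMonom (q + Pi.single j 1) (Function.update x j s - x₀))
      (divMonom q (x - x₀)) (x j) := by
  simp_rw [divMonom_update]
  have h2 : divMonom q (x - x₀) = (x j - x₀ j) ^ q j / (q j).factorial *
      ∏ i ∈ Finset.univ.erase j,
        ((x i - x₀ i) ^ (q + Pi.single j 1 : Fin d → ℕ) i / ((q + Pi.single j 1 : Fin d → ℕ) i).factorial) := by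
    have := divMonom_update q x x₀ j (x j)
    rw [Function.update_eq_self] at this
    rw [this]
    congr 1
    refine Finset.prod_congr rfl fun i hi => ?_
    simp [Pi.single_eq_of_ne (Finset.ne_of_mem_erase hi)]
  rw [h2]
  have := (hasDerivAt_pow_div_factorial (x₀ j) (x j) (q j)).mul_const
    (∏ i ∈ Finset.univ.erase j,
        ((x i - x₀ i) ^ (q + Pi.single j 1 : Fin d → ℕ) i / ((q + Pi.single j 1 : Fin d → ℕ) i).factorial))
  simpa using this

lemma hasDerivAt_divMonom_zero {d : ℕ} (q : Fin d → ℕ) (x x₀ : Fin d → ℝ) (j : Fin d)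
    (hq : q j = 0) :
    HasDerivAt (fun s => divMonom q (Function.update x j s - x₀)) 0 (x j) := by
  simp_rw [divMonom_update, hq]
  simpa using hasDerivAt_const (x j) _

/-- With monomials divided by factorials, differentiation is a pure index shift. This drives the
induction on the order in `abs_sub_taylorPoly_le`. -/
lemma hasDerivAt_taylorPoly {d : ℕ} (D : (Fin d → ℕ) → (Fin d → ℝ) → ℝ) (m : ℕ)
    (x₀ x : Fin d → ℝ) (j : Fin d) :
    HasDerivAt (fun s => taylorPoly D (m + 1) x₀ (Function.update x j s))
      (taylorPoly (fun p => D (p + Pi.single j 1)) m x₀ x) (x j) := by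
  have hinj : Function.Injective fun q : Fin d → ℕ => q + Pi.single j 1 :=
    fun a b h => add_right_cancel h
  have hsub : (multiIdx d m).map ⟨_, hinj⟩ ⊆ multiIdx d (m + 1) := by
    intro p hp
    obtain ⟨q, hq, rfl⟩ := Finset.mem_map.1 hp
    simp only [Function.Embedding.coeFn_mk]
    rw [mem_multiIdx, sum_add_single]
    have := mem_multiIdx.1 hq
    omega
  -- Indices that are not shifts do not involve coordinate `j`, so their monomials are constant
  -- along it.
  have hout : ∀ p ∈ multiIdx d (m + 1), p ∉ (multiIdx d m).map ⟨_, hinj⟩ → p j = 0 := by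
    intro p hp hn
    by_contra h
    apply hn
    have hp' : (p - Pi.single j 1) + Pi.single j 1 = p := by
      funext i
      by_cases hi : i = j
      · subst hi; simp; omega
      · simp [Pi.single_eq_of_ne hi]
    refine Finset.mem_map.2 ⟨p - Pi.single j 1, ?_, hp'⟩
    have h1 := mem_multiIdx.1 hp
    have h2 := sum_add_single (p - Pi.single j 1) j
    rw [hp'] at h2
    rw [mem_multiIdx]
    omega
  have hd : ∀ p ∈ multiIdx d (m + 1), HasDerivAt
      (fun s => D p x₀ * divMonom p (Function.update x j s - x₀))
      (if p ∈ (multiIdx d m).map ⟨_, hinj⟩ then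
        D p x₀ * divMonom (p - Pi.single j 1) (x - x₀) else 0) (x j) := by
    intro p hp
    split_ifs with h
    · obtain ⟨q, hq, rfl⟩ := Finset.mem_map.1 h
      simp only [Function.Embedding.coeFn_mk, add_tsub_cancel_right]
      exact (hasDerivAt_divMonom_add_single q x x₀ j).const_mul _
    · simpa using (hasDerivAt_divMonom_zero p x x₀ j (hout p hp h)).const_mul (D p x₀)
  unfold taylorPoly
  have := HasDerivAt.fun_sum hd
  convert! this using 1
  rw [← Finset.sum_filter, Finset.filter_mem_eq_inter, Finset.inter_eq_right.2 hsub,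
    Finset.sum_map]
  simp

lemma taylorPoly_self {d : ℕ} (D : (Fin d → ℕ) → (Fin d → ℝ) → ℝ) (m : ℕ) (x₀ : Fin d → ℝ) :
    taylorPoly D m x₀ x₀ = D 0 x₀ := by
  unfold taylorPoly
  rw [Finset.sum_eq_single 0]
  · simp [divMonom]
  · intro p _ hp
    obtain ⟨j, hj⟩ : ∃ j, p j ≠ 0 := by
      by_contra! h; exact hp (funext h)
    have : divMonom p (x₀ - x₀) = 0 :=
      Finset.prod_eq_zero (Finset.mem_univ j) (by simp [hj])
    rw [this, mul_zero]
  · intro h; exact absurd (zero_mem_multiIdx d m) h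

/-- A growth estimate along paths that change one coordinate at a time. -/
lemma abs_le_of_coordinate_deriv {d : ℕ} {R : (Fin d → ℝ) → ℝ}
    {R' : Fin d → (Fin d → ℝ) → ℝ} {x₀ x : Fin d → ℝ} {B : ℝ} (hx₀ : x₀ ∈ cube d)
    (hx : x ∈ cube d) (h0 : R x₀ = 0)
    (hR : ∀ j, ∀ y ∈ cube d, HasDerivWithinAt (fun s => R (Function.update y j s)) (R' j y)
      (Icc 0 1) (y j))
    (hB : ∀ j, ∀ y ∈ cube d, ∑ i, |y i - x₀ i| ≤ ∑ i, |x i - x₀ i| → |R' j y| ≤ B) :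
    |R x| ≤ B * ∑ i, |x i - x₀ i| := by
  -- Walk from `x₀` to `x` by switching the coordinates in `S` one after another; each leg needs
  -- only one partial derivative.
  have key : ∀ S : Finset (Fin d),
      |R (fun i => if i ∈ S then x i else x₀ i)| ≤ B * ∑ i ∈ S, |x i - x₀ i| := by
    intro S
    induction S using Finset.induction_on with
    | empty => simpa using h0
    | insert k S hk ih =>
      set y : Fin d → ℝ := fun i => if i ∈ S then x i else x₀ i with hy
      have hcube : ∀ s ∈ uIcc (x₀ k) (x k), Function.update y k s ∈ cube d := by
        intro s hs
        have hs' : s ∈ Icc (0 : ℝ) 1 :=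
          ordConnected_Icc.uIcc_subset ⟨hx₀.1 k, hx₀.2 k⟩ ⟨hx.1 k, hx.2 k⟩ hs
        constructor <;> intro i <;> by_cases hi : i = k
        · subst hi; simpa using hs'.1
        · by_cases hiS : i ∈ S <;> simp [hi, hy, hiS] <;>
            first | exact hx.1 i | exact hx₀.1 i
        · subst hi; simpa using hs'.2
        · by_cases hiS : i ∈ S <;> simp [hi, hy, hiS] <;>
            first | exact hx.2 i | exact hx₀.2 i
      have hdist : ∀ s ∈ uIcc (x₀ k) (x k),
          ∑ i, |Function.update y k s i - x₀ i| ≤ ∑ i, |x i - x₀ i| := by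
        intro s hs
        refine Finset.sum_le_sum fun i _ => ?_
        by_cases hi : i = k
        · subst hi
          simp only [Function.update_self]
          exact abs_sub_left_of_mem_uIcc hs
        · by_cases hiS : i ∈ S <;> simp [hi, hy, hiS]
      have hstep := Convex.norm_image_sub_le_of_norm_hasDerivWithin_le
        (f := fun s => R (Function.update y k s)) (f' := fun s => R' k (Function.update y k s))
        (C := B) (s := uIcc (x₀ k) (x k)) (x := x₀ k) (y := x k)
        (fun s hs => by
          have h := hR k _ (hcube s hs)
          simp only [Function.update_idem, Function.update_self] at h
          exact h.mono (ordConnected_Icc.uIcc_subset ⟨hx₀.1 k, hx₀.2 k⟩ ⟨hx.1 k, hx.2 k⟩))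
        (fun s hs => hB k _ (hcube s hs) (hdist s hs)) (convex_uIcc _ _) left_mem_uIcc
        right_mem_uIcc
      have e1 : Function.update y k (x k) = fun i => if i ∈ insert k S then x i else x₀ i := by
        funext i
        by_cases hi : i = k
        · subst hi; simp
        · simp [hi, hy]
      have e2 : Function.update y k (x₀ k) = y := by
        have : y k = x₀ k := by simp [hy, hk]
        rw [← this, Function.update_eq_self]
      simp only [e1, e2, Real.norm_eq_abs] at hstep
      rw [Finset.sum_insert hk, mul_add]
      calc |R (fun i => if i ∈ insert k S then x i else x₀ i)|
          = |(R (fun i => if i ∈ insert k S then x i else x₀ i) - R y) + R y| := by ring_nf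
        _ ≤ _ := (abs_add_le _ _).trans (add_le_add hstep ih)
  simpa using key Finset.univ

/-- The Taylor remainder of a function with Hölder derivatives of order `m`. -/
theorem abs_sub_taylorPoly_le {d : ℕ} {L α : ℝ} (hL : 0 ≤ L) (hα : 0 < α) {x₀ : Fin d → ℝ}
    (hx₀ : x₀ ∈ cube d) (m : ℕ) :
    ∀ D : (Fin d → ℕ) → (Fin d → ℝ) → ℝ,
    (∀ p : Fin d → ℕ, ∑ j, p j < m → ∀ j, ∀ x ∈ cube d,
      HasDerivWithinAt (fun s => D p (Function.update x j s)) (D (p + Pi.single j 1) x)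
        (Icc 0 1) (x j)) →
    (∀ p : Fin d → ℕ, ∑ j, p j = m → ∀ x ∈ cube d, ∀ y ∈ cube d,
      |D p x - D p y| ≤ L * (∑ j, |x j - y j|) ^ α) →
    ∀ x ∈ cube d, |D 0 x - taylorPoly D m x₀ x| ≤ L * (∑ j, |x j - x₀ j|) ^ (m + α) := by
  induction m with
  | zero =>
    intro D _ hH x hx
    have : taylorPoly D 0 x₀ x = D 0 x₀ := by
      have h0 : multiIdx d 0 = {0} := by
        ext p
        rw [mem_multiIdx, Finset.mem_singleton]
        simp [funext_iff]
      simp [taylorPoly, h0, divMonom]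
    rw [this]
    simpa using hH 0 (by simp) x hx x₀ hx₀
  | succ m ih =>
    intro D hD hH x hx
    set N := ∑ j, |x j - x₀ j| with hN
    have hN0 : 0 ≤ N := Finset.sum_nonneg fun _ _ => abs_nonneg _
    -- The `j`-th derivative of the remainder is the order-`m` remainder of the shifted family. The
    -- path stays within `ℓ₁` distance `N` of `x₀`, so the induction hypothesis bounds it by `L * N
    -- ^ (m + α)` throughout, and integrating along the path gains a factor `N`.
    have hmain := abs_le_of_coordinate_deriv (R := fun x => D 0 x - taylorPoly D (m + 1) x₀ x)
      (R' := fun j x => D (Pi.single j 1) x - taylorPoly (fun p => D (p + Pi.single j 1)) m x₀ x)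
      (B := L * N ^ (m + α)) hx₀ hx (by simp [taylorPoly_self]) ?_ ?_
    · refine hmain.trans (le_of_eq ?_)
      rw [mul_assoc, ← hN, ← Real.rpow_add_one' hN0 (by positivity)]
      congr 2
      push_cast; ring
    · intro j y hy
      have h1 := hD 0 (by simp) j y hy
      rw [zero_add] at h1
      exact h1.sub (hasDerivAt_taylorPoly D m x₀ y j).hasDerivWithinAt
    · intro j y hy hle
      have h := ih (fun p => D (p + Pi.single j 1))
        (fun p hp i z hz => by
          have := hD (p + Pi.single j 1) (by rw [sum_add_single]; omega) i z hz
          rwa [add_right_comm] at this)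
        (fun p hp => hH (p + Pi.single j 1) (by rw [sum_add_single]; omega)) y hy
      simp only [zero_add] at h
      refine h.trans ?_
      gcongr

lemma divMonom_eq {d : ℕ} (p : Fin d → ℕ) (z : Fin d → ℝ) :
    divMonom p z = monom p z / ∏ j, ((p j).factorial : ℝ) := by
  simp [divMonom, monom, Finset.prod_div_distrib]

lemma monom_div {d : ℕ} (p : Fin d → ℕ) (z : Fin d → ℝ) (h : ℝ) :
    monom p (fun j => z j / h) = monom p z / h ^ ∑ j, p j := by
  simp [monom, div_pow, Finset.prod_div_distrib, Finset.prod_pow_eq_pow_sum]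

/-- Local polynomial approximation of Hölder functions, with coefficients in the parameter set. -/
theorem exists_locPoly_approx {d b : ℕ} {β L M : ℝ} (hβ : 0 < β) (hβb : β ≤ b) (hL : 0 < L)
    (hM : 0 ≤ M) {x₀ : Fin d → ℝ} (hx₀ : x₀ ∈ cube d) {f : (Fin d → ℝ) → ℝ}
    (hf : f ∈ holderClass d β L M) {h : ℝ} (hh : 0 < h) (hh1 : h ≤ 1) :
    ∃ t : Coef d b, t ∈ paramSet d b M ∧ t ⟨0, zero_mem_multiIdx d b⟩ = f x₀ ∧
      ∀ x ∈ nbhd x₀ h, |f x - locPoly x₀ h t x| ≤ L * (d * h / 2) ^ β := by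
  obtain ⟨D, hD0, hD, hH, hS⟩ := hf
  set m := strictFloor β with hm
  have hmβ : (m : ℝ) < β := by
    have h1 : 1 ≤ ⌈β⌉₊ := Nat.one_le_ceil_iff.2 hβ
    have h2 : m < ⌈β⌉₊ := by rw [hm, strictFloor]; omega
    exact Nat.lt_ceil.1 h2
  have hmb : m ≤ b := by
    have : (m : ℝ) < b := hmβ.trans_le hβb
    exact_mod_cast this.le
  have hsub : multiIdx d m ⊆ multiIdx d b := fun p hp =>
    mem_multiIdx.2 ((mem_multiIdx.1 hp).trans hmb)
  have hsum : ∑ p ∈ multiIdx d m, |D p x₀| ≤ M := by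
    have h1 : ∑ p ∈ multiIdx d m, ENNReal.ofReal |D p x₀| ≤ ENNReal.ofReal M := by
      refine le_trans (Finset.sum_le_sum fun p _ => ?_) hS
      rw [← Real.enorm_eq_ofReal_abs]
      exact le_iSup₂ (f := fun x (_ : x ∈ cube d) => ‖D p x‖ₑ) x₀ hx₀
    rw [← ENNReal.ofReal_sum_of_nonneg fun _ _ => abs_nonneg _] at h1
    exact (ENNReal.ofReal_le_ofReal_iff hM).1 h1
  -- Taylor coefficients, with `h ^ |p|` undoing the rescaling of the monomials, padded by zero up
  -- to degree `b`. As `h ≤ 1 ≤ p!`, they are dominated by the derivatives at `x₀`, so the bound `M`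
  -- carries over to their `ℓ₁` norm.
  let c : (Fin d → ℕ) → ℝ := fun p =>
    if p ∈ multiIdx d m then D p x₀ * h ^ (∑ j, p j) / ∏ j, ((p j).factorial : ℝ) else 0
  refine ⟨fun p => c p.1, ?_, ?_, ?_⟩
  · have hc : ∀ p, |c p| ≤ if p ∈ multiIdx d m then |D p x₀| else 0 := by
      intro p
      simp only [c]
      split_ifs
      · have hf1 : (1 : ℝ) ≤ ∏ j, ((p j).factorial : ℝ) := by
          exact_mod_cast Nat.one_le_iff_ne_zero.2
            (Finset.prod_ne_zero_iff.2 fun j _ => Nat.factorial_ne_zero _)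
        rw [abs_div, abs_mul, abs_of_nonneg (by positivity : 0 ≤ h ^ ∑ j, p j),
          abs_of_nonneg (by positivity : 0 ≤ ∏ j, ((p j).factorial : ℝ))]
        rw [div_le_iff₀ (by positivity)]
        exact mul_le_mul_of_nonneg_left ((pow_le_one₀ hh.le hh1).trans hf1) (abs_nonneg _)
      · simp
    rw [paramSet, mem_ofPred_eq, Finset.sum_coe_sort (multiIdx d b) fun p => |c p|]
    refine (Finset.sum_le_sum fun p _ => hc p).trans ?_
    rw [← Finset.sum_filter, Finset.filter_mem_eq_inter, Finset.inter_eq_right.2 hsub]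
    exact hsum
  · simp [c, zero_mem_multiIdx, hD0 x₀ hx₀]
  · intro x hx
    have hxc : x ∈ cube d := hx.2
    have hloc : locPoly x₀ h (fun p : ↥(multiIdx d b) => c p.1) x = taylorPoly D m x₀ x := by
      rw [locPoly, indicator_of_mem hx, taylorPoly,
        Finset.sum_coe_sort (multiIdx d b) fun p => c p * monom p fun j => (x j - x₀ j) / h]
      symm
      rw [Finset.sum_subset_zero_on_sdiff hsub]
      · intro p hp
        simp [c, (Finset.mem_sdiff.1 hp).2]
      · intro p hp
        simp only [c, if_pos hp]
        rw [monom_div p (fun j => x j - x₀ j), divMonom_eq]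
        change D p x₀ * (monom p (fun j => x j - x₀ j) / _) = _
        field_simp
    rw [hloc, ← hD0 x hxc]
    have := abs_sub_taylorPoly_le hL.le (sub_pos.2 hmβ) hx₀ m D hD hH x hxc
    rw [add_sub_cancel] at this
    refine this.trans ?_
    gcongr
    calc ∑ j, |x j - x₀ j| ≤ ∑ _j : Fin d, h / 2 := by
          refine Finset.sum_le_sum fun j _ => ?_
          have := hx.1 j (mem_univ j)
          rw [abs_le]; constructor <;> linarith [this.1, this.2]
      _ = d * h / 2 := by simp; ring

end

noncomputable section

/-! ### A Bernstein inequality for independent observations -/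

/-- For `|w| ≤ 1` one has `exp w ≤ 1 + w + w²`; the linear term integrates to zero, and `1 + u ≤ exp
u`. -/
lemma integral_exp_le {Ω : Type*} [MeasurableSpace Ω] {μ : Measure Ω} [IsProbabilityMeasure μ]
    {W : Ω → ℝ} (hW : AEStronglyMeasurable W μ) (hb : ∀ z, |W z| ≤ 1) (h0 : ∫ z, W z ∂μ = 0) :
    ∫ z, Real.exp (W z) ∂μ ≤ Real.exp (∫ z, W z ^ 2 ∂μ) := by
  have hi : Integrable W μ := Integrable.of_bound hW 1 (Eventually.of_forall hb)
  have hi2 : Integrable (fun z => W z ^ 2) μ := by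
    refine Integrable.of_bound (hW.pow 2) 1 (Eventually.of_forall fun z => ?_)
    rw [Real.norm_eq_abs, abs_pow]; exact pow_le_one₀ (abs_nonneg _) (hb z)
  have hie : Integrable (fun z => Real.exp (W z)) μ := by
    refine Integrable.of_bound (Real.continuous_exp.comp_aestronglyMeasurable hW) (Real.exp 1)
      (Eventually.of_forall fun z => ?_)
    rw [Real.norm_eq_abs, Real.abs_exp]
    exact Real.exp_le_exp.2 ((le_abs_self _).trans (hb z))
  calc ∫ z, Real.exp (W z) ∂μ ≤ ∫ z, (1 + W z + W z ^ 2) ∂μ := by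
        refine integral_mono hie (((integrable_const 1).add hi).add hi2) fun z => ?_
        have := (abs_le.1 (Real.abs_exp_sub_one_sub_id_le (hb z))).2
        simp only; linarith
    _ = 1 + ∫ z, W z ^ 2 ∂μ := by
        have e1 : ∫ z, (1 + W z) ∂μ = 1 := by
          rw [integral_add (integrable_const 1) hi, h0]; simp
        have hi1 : Integrable (fun z => 1 + W z) μ := (integrable_const 1).add hi
        rw [integral_add hi1 hi2, e1]
    _ ≤ _ := by linarith [Real.add_one_le_exp (∫ z, W z ^ 2 ∂μ)]

/-- Chernoff's method with parameter `s = x / (2 n v)`, the minimizer of `s² n v - s x`. The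
condition on `x * B` is what makes `|s W| ≤ 1`, as `integral_exp_le` requires. -/
lemma measure_sum_ge_le {Ω : Type*} [MeasurableSpace Ω] {n : ℕ} {μ : Fin n → Measure Ω}
    [∀ i, IsProbabilityMeasure (μ i)] {W : Fin n → Ω → ℝ} (hW : ∀ i, Measurable (W i))
    {B v x : ℝ} (hB : ∀ i z, |W i z| ≤ B) (h0 : ∀ i, ∫ z, W i z ∂(μ i) = 0)
    (hv : ∀ i, ∫ z, W i z ^ 2 ∂(μ i) ≤ v) (hx : 0 ≤ x) (hpos : 0 < n * v)
    (hxB : x * B ≤ 2 * (n * v)) :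
    Measure.pi μ {Z | x ≤ ∑ i, W i (Z i)} ≤ ENNReal.ofReal (Real.exp (-(x ^ 2 / (4 * (n * v))))) := by
  set s : ℝ := x / (2 * (n * v)) with hs
  have hs0 : 0 ≤ s := by positivity
  have hbd : ∀ i z, |s * W i z| ≤ 1 := fun i z => by
    rw [abs_mul, abs_of_nonneg hs0]
    calc s * |W i z| ≤ s * B := by gcongr; exact hB i z
      _ = x * B / (2 * (n * v)) := by rw [hs]; ring
      _ ≤ 1 := by rw [div_le_one (by positivity)]; exact hxB
  have hprod : ∫ Z, Real.exp (s * ∑ i, W i (Z i)) ∂(Measure.pi μ)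
      ≤ Real.exp (s ^ 2 * (n * v)) := by
    have e : ∀ Z : Fin n → Ω, Real.exp (s * ∑ i, W i (Z i)) = ∏ i, Real.exp (s * W i (Z i)) :=
      fun Z => by rw [Finset.mul_sum, Real.exp_sum]
    simp_rw [e]
    rw [integral_fintype_prod_eq_prod (fun i z => Real.exp (s * W i z))]
    calc ∏ i, ∫ z, Real.exp (s * W i z) ∂(μ i) ≤ ∏ _i : Fin n, Real.exp (s ^ 2 * v) := by
          refine Finset.prod_le_prod (fun i _ => integral_nonneg fun z => (Real.exp_pos _).le)
            fun i _ => ?_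
          refine (integral_exp_le ((hW i).const_mul s).aestronglyMeasurable (hbd i) ?_).trans ?_
          · rw [integral_const_mul, h0, mul_zero]
          · refine Real.exp_le_exp.2 ?_
            simp_rw [mul_pow]
            rw [integral_const_mul]
            gcongr; exact hv i
      _ = _ := by
          rw [Finset.prod_const, Finset.card_univ, Fintype.card_fin, ← Real.exp_nat_mul]
          congr 1; ring
  have hmeas : Measurable (fun Z : Fin n → Ω => Real.exp (s * ∑ i, W i (Z i))) :=
    ((Finset.univ.measurable_fun_sum fun i _ => (hW i).comp (measurable_pi_apply i)).const_mul
      s).exp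
  have hint : Integrable (fun Z : Fin n → Ω => Real.exp (s * ∑ i, W i (Z i))) (Measure.pi μ) := by
    refine Integrable.of_bound hmeas.aestronglyMeasurable (Real.exp n) (Eventually.of_forall fun Z => ?_)
    rw [Real.norm_eq_abs, Real.abs_exp, Finset.mul_sum]
    refine Real.exp_le_exp.2 ?_
    calc ∑ i, s * W i (Z i) ≤ ∑ _i : Fin n, (1 : ℝ) :=
          Finset.sum_le_sum fun i _ => (le_abs_self _).trans (hbd i _)
      _ = n := by simp
  have hmk := mul_meas_ge_le_integral_of_nonneg (μ := Measure.pi μ)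
    (f := fun Z : Fin n → Ω => Real.exp (s * ∑ i, W i (Z i)))
    (Eventually.of_forall fun Z => (Real.exp_pos _).le) hint (Real.exp (s * x))
  have hsub : {Z : Fin n → Ω | x ≤ ∑ i, W i (Z i)} ⊆
      {Z : Fin n → Ω | Real.exp (s * x) ≤ Real.exp (s * ∑ i, W i (Z i))} := fun Z hZ =>
    Real.exp_le_exp.2 (mul_le_mul_of_nonneg_left hZ hs0)
  refine (measure_mono hsub).trans ?_
  rw [← ofReal_measureReal]
  refine ENNReal.ofReal_le_ofReal ?_
  have h3 : (Measure.pi μ).real {Z : Fin n → Ω | Real.exp (s * x) ≤ Real.exp (s * ∑ i, W i (Z i))} ≤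
      Real.exp (-(s * x)) * Real.exp (s ^ 2 * (n * v)) := by
    rw [Real.exp_neg, inv_mul_eq_div, le_div_iff₀ (Real.exp_pos _), mul_comm]
    exact hmk.trans hprod
  refine h3.trans (le_of_eq ?_)
  rw [← Real.exp_add]
  congr 1
  rw [hs]; field_simp; ring

/-- A two-sided Bernstein inequality under a product measure, in the Gaussian regime. -/
lemma measure_abs_sum_sub_integral_ge_le {Ω : Type*} [MeasurableSpace Ω] {n : ℕ}
    {μ : Fin n → Measure Ω} [∀ i, IsProbabilityMeasure (μ i)] {W : Ω → ℝ} (hW : Measurable W)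
    {B v x : ℝ} (hB : ∀ z, |W z| ≤ B) (hv : ∀ i, ∫ z, W z ^ 2 ∂(μ i) ≤ v) (hx : 0 ≤ x)
    (hpos : 0 < n * v) (hxB : x * B ≤ n * v) :
    Measure.pi μ {Z | x ≤ |∑ i, W (Z i) - ∑ i, ∫ z, W z ∂(μ i)|} ≤
      ENNReal.ofReal (2 * Real.exp (-(x ^ 2 / (4 * (n * v))))) := by
  have hi : ∀ i, Integrable W (μ i) := fun i =>
    Integrable.of_bound hW.aestronglyMeasurable B (Eventually.of_forall hB)
  have hi2 : ∀ i, Integrable (fun z => W z ^ 2) (μ i) := fun i => by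
    refine Integrable.of_bound (hW.pow_const 2).aestronglyMeasurable (B ^ 2)
      (Eventually.of_forall fun z => ?_)
    rw [Real.norm_eq_abs, abs_pow]; exact pow_le_pow_left₀ (abs_nonneg _) (hB z) 2
  have hm : ∀ i, |∫ z, W z ∂(μ i)| ≤ B := fun i => by
    have := norm_integral_le_of_norm_le_const (μ := μ i) (f := W) (C := B)
      (Eventually.of_forall hB)
    simpa using this
  have hvar : ∀ i, ∫ z, (W z - ∫ z, W z ∂(μ i)) ^ 2 ∂(μ i) ≤ v := fun i => by
    refine le_trans ?_ (hv i)
    rw [← ProbabilityTheory.variance_eq_integral hW.aemeasurable]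
    exact ProbabilityTheory.variance_le_expectation_sq hW.aestronglyMeasurable
  -- Centring at most doubles the sup bound, which the factor `2` in the one-sided condition
  -- absorbs.
  have h1 := measure_sum_ge_le (μ := μ) (W := fun i z => W z - ∫ z, W z ∂(μ i)) (B := 2 * B)
    (v := v) (x := x) (fun i => hW.sub_const _)
    (fun i z => (abs_sub _ _).trans (by linarith [hB z, hm i]))
    (fun i => by rw [integral_sub (hi i) (integrable_const _)]; simp) hvar hx hpos (by linarith)
  have h2 := measure_sum_ge_le (μ := μ) (W := fun i z => -(W z - ∫ z, W z ∂(μ i))) (B := 2 * B)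
    (v := v) (x := x) (fun i => (hW.sub_const _).neg)
    (fun i z => by rw [abs_neg]; exact (abs_sub _ _).trans (by linarith [hB z, hm i]))
    (fun i => by rw [integral_neg, integral_sub (hi i) (integrable_const _)]; simp)
    (fun i => by simp_rw [neg_sq]; exact hvar i) hx hpos (by linarith)
  have hsub : {Z : Fin n → Ω | x ≤ |∑ i, W (Z i) - ∑ i, ∫ z, W z ∂(μ i)|} ⊆
      {Z | x ≤ ∑ i, (W (Z i) - ∫ z, W z ∂(μ i))} ∪
      {Z | x ≤ ∑ i, -(W (Z i) - ∫ z, W z ∂(μ i))} := by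
    intro Z hZ
    simp only [mem_ofPred_eq, mem_union, Finset.sum_neg_distrib, Finset.sum_sub_distrib] at hZ ⊢
    exact le_abs.1 hZ
  refine (measure_mono hsub).trans ((measure_union_le _ _).trans ((add_le_add h1 h2).trans ?_))
  rw [← ENNReal.ofReal_add (Real.exp_pos _).le (Real.exp_pos _).le, two_mul]

end

noncomputable section

/-! ### The Gram matrix of the kernel -/

/-- The zero set of a nonzero polynomial is a Lebesgue null set. -/
theorem volume_eval_eq_zero {d : ℕ} {P : MvPolynomial (Fin d) ℝ} (hP : P ≠ 0) :
    volume {x : Fin d → ℝ | MvPolynomial.eval x P = 0} = 0 := by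
  induction d with
  | zero =>
    have : {x : Fin 0 → ℝ | MvPolynomial.eval x P = 0} = ∅ := by
      rw [MvPolynomial.eq_C_of_isEmpty P] at hP ⊢
      ext x
      simpa using fun h => hP (by rw [h, MvPolynomial.C_0])
    rw [this, measure_empty]
  | succ n ih =>
    have hQ : MvPolynomial.finSuccEquiv ℝ n P ≠ 0 := by simpa using hP
    set Q := MvPolynomial.finSuccEquiv ℝ n P with hQdef
    -- Read `P` as a univariate polynomial in the first variable. By induction its leading
    -- coefficient is nonzero for almost every value of the other variables, and then the fibre has
    -- finitely many zeros; Fubini concludes.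
    have hlead := ih (Polynomial.leadingCoeff_ne_zero.2 hQ)
    let e := MeasurableEquiv.piFinSuccAbove (fun _ : Fin (n + 1) => ℝ) 0
    have he : MeasurePreserving e.symm :=
      (volume_preserving_piFinSuccAbove (fun _ : Fin (n + 1) => ℝ) 0).symm e
    have hmeas : MeasurableSet {x : Fin (n + 1) → ℝ | MvPolynomial.eval x P = 0} :=
      (isClosed_singleton.preimage (MvPolynomial.continuous_eval P)).measurableSet
    rw [← he.measure_preimage hmeas.nullMeasurableSet, Measure.volume_eq_prod,
      ← (Measure.measurePreserving_swap (μ := (volume : Measure (Fin n → ℝ)))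
        (ν := (volume : Measure ℝ))).measure_preimage
        (e.symm.measurable hmeas).nullMeasurableSet]
    rw [Measure.measure_prod_null (measurable_swap (e.symm.measurable hmeas))]
    have hae : ∀ᵐ s : Fin n → ℝ, MvPolynomial.eval s Q.leadingCoeff ≠ 0 := by
      rw [ae_iff]; simpa using hlead
    filter_upwards [hae] with s hs
    have hmap : Polynomial.map (MvPolynomial.eval s) Q ≠ 0 := fun h => hs (by
      have := congrArg (fun p => Polynomial.coeff p Q.natDegree) h
      simpa [Polynomial.coeff_map] using this)
    refine Set.Finite.measure_zero (((Polynomial.map (MvPolynomial.eval s) Q).roots.toFinset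
      |>.finite_toSet).subset fun y hy => ?_) _
    have hy' : MvPolynomial.eval (Fin.insertNth 0 y s : Fin (n + 1) → ℝ) P = 0 := hy
    rw [Fin.insertNth_zero', MvPolynomial.eval_eq_eval_mv_eval'] at hy'
    simpa [hmap] using hy'

/-- The polynomial with coefficients `v`. -/
def polyVal {d b : ℕ} (v : Coef d b) (z : Fin d → ℝ) : ℝ := ∑ p, v p * monom p.1 z

lemma volume_polyVal_eq_zero {d b : ℕ} {v : Coef d b} (hv : v ≠ 0) :
    volume {z : Fin d → ℝ | polyVal v z = 0} = 0 := by
  let e : ↥(multiIdx d b) → (Fin d →₀ ℕ) := fun p => Finsupp.equivFunOnFinite.symm p.1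
  have he : Function.Injective e := fun p q h =>
    Subtype.ext (Finsupp.equivFunOnFinite.symm.injective h)
  let P : MvPolynomial (Fin d) ℝ := ∑ p, MvPolynomial.monomial (e p) (v p)
  have hP : P ≠ 0 := by
    obtain ⟨q, hq⟩ := Function.ne_iff.1 hv
    intro h
    have h2 := congrArg (MvPolynomial.coeff (e q)) h
    simp only [P, MvPolynomial.coeff_sum, MvPolynomial.coeff_monomial, he.eq_iff] at h2
    simp at h2
    exact hq h2
  have heval : ∀ z, MvPolynomial.eval z P = polyVal v z := by
    intro z
    simp only [P, map_sum, MvPolynomial.eval_monomial, polyVal, monom]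
    refine Finset.sum_congr rfl fun p _ => ?_
    congr 1
    rw [Finsupp.prod_fintype _ _ (by simp)]
    rfl
  simpa [heval] using volume_eval_eq_zero hP

@[fun_prop]
lemma measurable_monom {d : ℕ} (p : Fin d → ℕ) : Measurable (monom p) := by
  unfold monom; fun_prop

@[fun_prop]
lemma measurable_polyVal {d b : ℕ} (v : Coef d b) : Measurable (polyVal v) := by
  unfold polyVal; fun_prop

lemma abs_monom_le_one {d : ℕ} (p : Fin d → ℕ) {z : Fin d → ℝ}
    (hz : ∀ j, z j ∈ Icc (-(1 / 2) : ℝ) (1 / 2)) : |monom p z| ≤ 1 := by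
  rw [monom, Finset.abs_prod]
  refine Finset.prod_le_one (fun _ _ => abs_nonneg _) fun j _ => ?_
  rw [abs_pow]
  refine pow_le_one₀ (abs_nonneg _) (abs_le.2 ⟨?_, ?_⟩) <;> linarith [(hz j).1, (hz j).2]

namespace IsKernel

variable {d : ℕ} {K : (Fin d → ℝ) → ℝ}

lemma integrable (hK : IsKernel K) : Integrable K := by
  by_contra h
  have := hK.integral_eq_one
  rw [integral_undef h] at this
  exact zero_ne_one this

lemma le_kerSup (hK : IsKernel K) (z : Fin d → ℝ) : K z ≤ kerSup K := by
  obtain ⟨B, hB⟩ := hK.bounded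
  refine (le_abs_self _).trans (le_ciSup (f := fun z => |K z|) ⟨B, ?_⟩ z)
  rintro _ ⟨y, rfl⟩
  simp only [abs_of_nonneg (hK.nonneg y)]
  exact hB ⟨y, rfl⟩

lemma volume_box : volume (Set.univ.pi fun _ : Fin d => Icc (-(1 / 2) : ℝ) (1 / 2)) = 1 := by
  rw [volume_pi_pi]
  simp [Real.volume_Icc]
  norm_num

lemma eq_zero_of_notMem_box (hK : IsKernel K) {z : Fin d → ℝ}
    (hz : z ∉ Set.univ.pi fun _ : Fin d => Icc (-(1 / 2) : ℝ) (1 / 2)) : K z = 0 := by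
  by_contra h
  exact hz fun j _ => hK.support z h j

/-- The supporting box has volume one. The bound later allows `K_∞` to be replaced by `K_∞²` in the
tail exponent. -/
lemma one_le_kerSup (hK : IsKernel K) : 1 ≤ kerSup K := by
  rw [← hK.integral_eq_one, ← setIntegral_eq_integral_of_forall_compl_eq_zero
    fun z hz => hK.eq_zero_of_notMem_box hz]
  calc ∫ z in Set.univ.pi fun _ : Fin d => Icc (-(1 / 2) : ℝ) (1 / 2), K z
      ≤ ∫ _z in Set.univ.pi fun _ : Fin d => Icc (-(1 / 2) : ℝ) (1 / 2), kerSup K := by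
        refine integral_mono hK.integrable.integrableOn ?_ fun z => hK.le_kerSup z
        exact integrableOn_const (by rw [volume_box]; exact ENNReal.one_ne_top)
    _ = kerSup K := by rw [setIntegral_const, Measure.real, volume_box]; simp

lemma abs_monom_mul_le (hK : IsKernel K) (p : Fin d → ℕ) (z : Fin d → ℝ) :
    |monom p z * K z| ≤ K z := by
  by_cases h : K z = 0
  · simp [h]
  · rw [abs_mul, abs_of_nonneg (hK.nonneg z)]
    exact mul_le_of_le_one_left (hK.nonneg z) (abs_monom_le_one p (hK.support z h))

lemma abs_monom_mul_monom_mul_le (hK : IsKernel K) (p q : Fin d → ℕ) (z : Fin d → ℝ) :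
    |monom p z * monom q z * K z| ≤ K z := by
  by_cases h : K z = 0
  · simp [h]
  · rw [abs_mul, abs_of_nonneg (hK.nonneg z), abs_mul]
    exact mul_le_of_le_one_left (hK.nonneg z) (mul_le_one₀
      (abs_monom_le_one p (hK.support z h)) (abs_nonneg _) (abs_monom_le_one q (hK.support z h)))

lemma integrable_monom_mul_monom_mul (hK : IsKernel K) (p q : Fin d → ℕ) :
    Integrable fun z => monom p z * monom q z * K z := by
  have hm := hK.measurable
  exact hK.integrable.mono' (by fun_prop : Measurable _).aestronglyMeasurable
    (Eventually.of_forall (hK.abs_monom_mul_monom_mul_le p q))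

lemma polyVal_sq_mul {b : ℕ} (v : Coef d b) (z : Fin d → ℝ) (c : ℝ) :
    polyVal v z ^ 2 * c = ∑ p, ∑ q, v p * v q * (monom p.1 z * monom q.1 z * c) := by
  rw [polyVal, sq, Finset.sum_mul_sum, Finset.sum_mul]
  refine Finset.sum_congr rfl fun p _ => ?_
  rw [Finset.sum_mul]
  exact Finset.sum_congr rfl fun q _ => by ring

lemma integrable_polyVal_sq_mul (hK : IsKernel K) {b : ℕ} (v : Coef d b) :
    Integrable fun z => polyVal v z ^ 2 * K z := by
  simp_rw [polyVal_sq_mul]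
  exact integrable_finsetSum _ fun p _ => integrable_finsetSum _ fun q _ =>
    (hK.integrable_monom_mul_monom_mul p.1 q.1).const_mul _

lemma gram_apply (hK : IsKernel K) {b : ℕ} (p q : ↥(multiIdx d b)) :
    gram d b K p q = ∫ z, monom p.1 z * monom q.1 z * K z := by
  rw [gram, Matrix.of_apply]
  exact setIntegral_eq_integral_of_forall_compl_eq_zero fun z hz => by
    rw [hK.eq_zero_of_notMem_box hz, mul_zero]

lemma dotProduct_gram_mulVec (hK : IsKernel K) {b : ℕ} (v : Coef d b) :
    dotProduct v ((gram d b K).mulVec v) = ∫ z, polyVal v z ^ 2 * K z := by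
  simp_rw [polyVal_sq_mul]
  rw [integral_finsetSum _ fun p _ => integrable_finsetSum _ fun q _ =>
    (hK.integrable_monom_mul_monom_mul p.1 q.1).const_mul _]
  rw [dotProduct]
  refine Finset.sum_congr rfl fun p _ => ?_
  rw [integral_finsetSum _ fun q _ => (hK.integrable_monom_mul_monom_mul p.1 q.1).const_mul _,
    Matrix.mulVec, dotProduct, Finset.mul_sum]
  refine Finset.sum_congr rfl fun q _ => ?_
  rw [integral_const_mul, hK.gram_apply]
  ring

/-- The polynomial vanishes only on a null set, so a zero integral would force `K = 0` almost
everywhere, against `∫ K = 1`. -/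
lemma integral_polyVal_sq_mul_pos (hK : IsKernel K) {b : ℕ} {v : Coef d b} (hv : v ≠ 0) :
    0 < ∫ z, polyVal v z ^ 2 * K z := by
  have h0 : 0 ≤ fun z => polyVal v z ^ 2 * K z := fun z => mul_nonneg (sq_nonneg _) (hK.nonneg z)
  refine (integral_nonneg h0).lt_of_ne fun h => ?_
  have h1 := (integral_eq_zero_iff_of_nonneg h0 (hK.integrable_polyVal_sq_mul v)).1 h.symm
  have h2 : ∀ᵐ z, polyVal v z ≠ 0 := by
    rw [ae_iff]; simpa using volume_polyVal_eq_zero hv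
  have h3 : K =ᵐ[volume] 0 := by
    filter_upwards [h1, h2] with z hz hz'
    have : polyVal v z ^ 2 * K z = 0 := hz
    simpa [hz'] using this
  have := hK.integral_eq_one
  rw [integral_congr_ae h3] at this
  simp at this

end IsKernel

/-- The Rayleigh bound for a real symmetric matrix. -/
lemma iInf_eigenvalues_mul_le {ι : Type*} [Fintype ι] [DecidableEq ι] {A : Matrix ι ι ℝ}
    (hA : A.IsHermitian) (v : ι → ℝ) :
    (⨅ i, hA.eigenvalues i) * ∑ i, v i ^ 2 ≤ dotProduct v (A.mulVec v) := by
  set l := ⨅ i, hA.eigenvalues i with hl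
  have hle : ∀ i, l ≤ hA.eigenvalues i := fun i => ciInf_le (Set.finite_range _).bddBelow i
  have hdiag : (Matrix.diagonal (fun i => hA.eigenvalues i - l)).PosSemidef :=
    Matrix.posSemidef_diagonal_iff.2 fun i => sub_nonneg.2 (hle i)
  -- By the spectral theorem this is a unitary conjugate of the diagonal matrix of the nonnegative
  -- numbers `eigenvalues i - l`.
  have hpsd : (A - l • (1 : Matrix ι ι ℝ)).PosSemidef := by
    have h1 := (Matrix.PosSemidef.mul_mul_conjTranspose_same hdiag
      (hA.eigenvectorUnitary : Matrix ι ι ℝ))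
    have h2 : (hA.eigenvectorUnitary : Matrix ι ι ℝ) *
        Matrix.diagonal (fun i => hA.eigenvalues i - l) *
        (hA.eigenvectorUnitary : Matrix ι ι ℝ).conjTranspose = A - l • (1 : Matrix ι ι ℝ) := by
      have h3 := hA.spectral_theorem
      rw [Unitary.conjStarAlgAut_apply] at h3
      have h4 : Matrix.diagonal (fun i => hA.eigenvalues i - l) =
          Matrix.diagonal (RCLike.ofReal ∘ hA.eigenvalues) - l • (1 : Matrix ι ι ℝ) := by
        rw [Matrix.smul_one_eq_diagonal, Matrix.diagonal_sub]
        rfl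
      rw [h4, mul_sub, sub_mul, mul_smul_comm, mul_one, smul_mul_assoc,
        ← Matrix.star_eq_conjTranspose]
      conv_rhs => rw [h3]
      congr 2
      exact Unitary.coe_mul_star_self _
    rwa [h2] at h1
  have := hpsd.dotProduct_mulVec_nonneg v
  rw [Matrix.sub_mulVec, dotProduct_sub, Matrix.smul_mulVec, Matrix.one_mulVec,
    dotProduct_smul] at this
  simp only [star_trivial, smul_eq_mul, dotProduct] at this
  simp only [dotProduct, sq]
  linarith

lemma minEig_mul_le {d b : ℕ} {K : (Fin d → ℝ) → ℝ} (hK : IsKernel K) (v : Coef d b) :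
    minEig d b K * ∑ p, v p ^ 2 ≤ ∫ z, polyVal v z ^ 2 * K z := by
  rw [← hK.dotProduct_gram_mulVec]
  exact iInf_eigenvalues_mul_le (gram_isHermitian d b K) v

lemma minEig_pos {d b : ℕ} {K : (Fin d → ℝ) → ℝ} (hK : IsKernel K) : 0 < minEig d b K := by
  have hpd : (gram d b K).PosDef :=
    Matrix.PosDef.of_dotProduct_mulVec_pos (gram_isHermitian d b K) fun v hv => by
      rw [star_trivial, hK.dotProduct_gram_mulVec]
      exact hK.integral_polyVal_sq_mul_pos hv
  have : Nonempty ↥(multiIdx d b) := ⟨⟨0, zero_mem_multiIdx d b⟩⟩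
  obtain ⟨i, hi⟩ := exists_eq_ciInf_of_finite (f := (gram_isHermitian d b K).eigenvalues)
  rw [minEig, ← hi]
  exact (gram_isHermitian d b K).posDef_iff_eigenvalues_pos.1 hpd i

end

noncomputable section

/-! ### The noise -/

/-- The law of the noise variable with density `g`. -/
def noiseLaw (g : ℝ → ℝ) : Measure ℝ := volume.withDensity fun z => ENNReal.ofReal (g z)

namespace IsSymmDensity

variable {g : ℝ → ℝ}

lemma integrable (hg : IsSymmDensity g) : Integrable g := by
  by_contra h
  have := hg.integral_eq_one
  rw [integral_undef h] at this
  exact zero_ne_one this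

lemma isProbabilityMeasure (hg : IsSymmDensity g) : IsProbabilityMeasure (noiseLaw g) := by
  refine ⟨?_⟩
  rw [noiseLaw, withDensity_apply _ MeasurableSet.univ, Measure.restrict_univ,
    ← ofReal_integral_eq_lintegral_ofReal hg.integrable (Eventually.of_forall hg.nonneg),
    hg.integral_eq_one, ENNReal.ofReal_one]

lemma integral_noiseLaw (hg : IsSymmDensity g) (φ : ℝ → ℝ) :
    ∫ u, φ u ∂(noiseLaw g) = ∫ u, g u * φ u := by
  rw [noiseLaw, integral_withDensity_eq_integral_toReal_smul
    (hg.measurable.ennreal_ofReal) (Eventually.of_forall fun _ => ENNReal.ofReal_lt_top)]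
  simp [ENNReal.toReal_ofReal (hg.nonneg _)]

lemma integral_odd (hg : IsSymmDensity g) {φ : ℝ → ℝ} (hφ : ∀ u, φ (-u) = -φ u) :
    ∫ u, φ u ∂(noiseLaw g) = 0 := by
  rw [hg.integral_noiseLaw]
  have h := integral_neg_eq_self (fun u => g u * φ u) volume
  simp_rw [hφ, hg.symm, mul_neg, integral_neg] at h
  linarith

lemma measureReal_Icc (hg : IsSymmDensity g) {a : ℝ} (ha : 0 ≤ a) :
    (noiseLaw g).real (Icc (-a) a) = 2 * ∫ u in (0 : ℝ)..a, g u := by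
  have := hg.isProbabilityMeasure
  have h1 : (noiseLaw g).real (Icc (-a) a) = ∫ u in (-a)..a, g u := by
    rw [Measure.real, noiseLaw, withDensity_apply _ measurableSet_Icc,
      ← ofReal_integral_eq_lintegral_ofReal hg.integrable.integrableOn
        (Eventually.of_forall hg.nonneg),
      ENNReal.toReal_ofReal (integral_nonneg hg.nonneg), integral_Icc_eq_integral_Ioc,
      intervalIntegral.integral_of_le (by linarith)]
  have h2 : ∫ u in (-a)..0, g u = ∫ u in (0 : ℝ)..a, g u := by
    have := intervalIntegral.integral_comp_neg (a := 0) (b := a) g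
    simp_rw [hg.symm, neg_zero] at this
    exact this.symm
  rw [h1, ← intervalIntegral.integral_add_adjacent_intervals (b := 0)
    hg.integrable.intervalIntegrable hg.integrable.intervalIntegrable, h2, two_mul]

/-- For a nonincreasing density, the mass of `[0, κ a]` is at least `κ` times that of `[0, a]`. -/
lemma mul_integral_le (hg : IsSymmDensity g) {κ a : ℝ} (hκ : 0 < κ) (hκ1 : κ ≤ 1) (ha : 0 ≤ a) :
    κ * ∫ u in (0 : ℝ)..a, g u ≤ ∫ u in (0 : ℝ)..(κ * a), g u := by
  have h := intervalIntegral.mul_integral_comp_mul_left (a := 0) (b := a) (f := g) κ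
  rw [mul_zero] at h
  rw [← h]
  refine mul_le_mul_of_nonneg_left ?_ hκ.le
  refine intervalIntegral.integral_mono_on ha hg.integrable.intervalIntegrable
    (hg.integrable.comp_mul_left' hκ.ne').intervalIntegrable fun u hu => ?_
  exact hg.antitone (mem_Ici.2 (mul_nonneg hκ.le hu.1)) (mem_Ici.2 hu.1)
    (mul_le_of_le_one_left hu.1 hκ1)

end IsSymmDensity

/-- The curvature condition in terms of the mass of the noise on the quadratic zone. -/
lemma le_mass_of_mem_densityClass {g : ℝ → ℝ} (hg : IsSymmDensity g) {σ : ℕ → ℝ}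
    (hσ : ∀ i, 0 < σ i) {γ c : ℝ} (hγ : 0 < γ)
    (hG : scaledDensity g σ ∈ densityClass (huber γ) c) (i : ℕ) :
    c ≤ 2 * ∫ u in (0 : ℝ)..(γ / σ i), g u := by
  have hval : ∀ i, ∫ z, deriv (deriv (huber γ)) z * scaledDensity g σ i z =
      2 * ∫ u in (0 : ℝ)..(γ / σ i), g u := by
    intro i
    have hae : ∀ᵐ z : ℝ, |z| ≠ γ := by
      have : ({γ, -γ} : Set ℝ).Finite := by simp
      filter_upwards [(this.countable.ae_notMem volume)] with z hz h
      rcases (abs_eq hγ.le).1 h with h | h <;> simp [h] at hz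
    have h1 : ∫ z, deriv (deriv (huber γ)) z * scaledDensity g σ i z =
        ∫ z, (Ioo (-γ) γ).indicator (fun z => g (z / σ i) / σ i) z := by
      refine integral_congr_ae ?_
      filter_upwards [hae] with z hz
      rw [deriv_deriv_huber hγ hz]
      by_cases hm : z ∈ Ioo (-γ) γ <;> simp [hm, scaledDensity]
    rw [h1, integral_indicator measurableSet_Ioo, ← integral_Ioc_eq_integral_Ioo,
      ← intervalIntegral.integral_of_le (by linarith), intervalIntegral.integral_div,
      intervalIntegral.integral_comp_div _ (hσ i).ne', smul_eq_mul,
      mul_div_cancel_left₀ _ (hσ i).ne', neg_div,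
      ← hg.measureReal_Icc (div_pos hγ (hσ i)).le]
    have := hg.isProbabilityMeasure
    rw [Measure.real, noiseLaw, withDensity_apply _ measurableSet_Icc,
      ← ofReal_integral_eq_lintegral_ofReal hg.integrable.integrableOn
        (Eventually.of_forall hg.nonneg),
      ENNReal.toReal_ofReal (integral_nonneg hg.nonneg), integral_Icc_eq_integral_Ioc,
      intervalIntegral.integral_of_le (by linarith [div_pos hγ (hσ i)])]
  rw [← hval]
  -- A real infimum is known to lie below its terms only if the family is bounded below; here the
  -- terms are masses, hence nonnegative.
  refine hG.2.trans (ciInf_le ⟨0, ?_⟩ i)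
  rintro _ ⟨j, rfl⟩
  simp only [hval]
  exact mul_nonneg zero_le_two (intervalIntegral.integral_nonneg (div_pos hγ (hσ j)).le
    fun u _ => hg.nonneg u)

/-- Lower bound on the probability that a residual with small bias is in the quadratic zone. -/
lemma le_measureReal_abs_add_le {g : ℝ → ℝ} (hg : IsSymmDensity g) {s γ c a : ℝ} (hs : 0 < s)
    (hγ : 0 < γ) (hc : c ≤ 2 * ∫ u in (0 : ℝ)..(γ / s), g u) (ha : |a| ≤ γ / 16) :
    7 / 8 * c ≤ (noiseLaw g).real {u | |a + s * u| ≤ γ - γ / 16} := by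
  have := hg.isProbabilityMeasure
  -- Noise of size at most `7γ/8` and bias at most `γ/16` add up to at most `15γ/16`. Monotonicity
  -- of `g` ensures that shrinking the interval by `7/8` keeps at least `7/8` of its mass.
  have h1 := hg.mul_integral_le (κ := 7 / 8) (a := γ / s) (by norm_num) (by norm_num)
    (by positivity)
  calc 7 / 8 * c ≤ 2 * ∫ u in (0 : ℝ)..(7 / 8 * (γ / s)), g u := by linarith
    _ = (noiseLaw g).real (Icc (-(7 / 8 * (γ / s))) (7 / 8 * (γ / s))) :=
        (hg.measureReal_Icc (by positivity)).symm
    _ ≤ _ := by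
        refine measureReal_mono fun u hu => ?_
        have hu' : |u| ≤ 7 / 8 * (γ / s) := abs_le.2 hu
        have h2 : |s * u| ≤ 7 / 8 * γ := by
          rw [abs_mul, abs_of_pos hs]
          calc s * |u| ≤ s * (7 / 8 * (γ / s)) := by gcongr
            _ = _ := by field_simp
        have h3 := abs_add_le a (s * u)
        rw [mem_ofPred_eq]
        linarith

/-! ### The law of one observation -/

lemma measurableSet_cube (d : ℕ) : MeasurableSet (cube d) := measurableSet_Icc

lemma volume_cube (d : ℕ) : volume (cube d) = 1 := by
  rw [cube, Real.volume_Icc_pi]; simp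

lemma measurableSet_nbhd {d : ℕ} (x₀ : Fin d → ℝ) (h : ℝ) : MeasurableSet (nbhd x₀ h) :=
  (MeasurableSet.univ_pi fun _ => measurableSet_Icc).inter (measurableSet_cube d)

@[fun_prop]
lemma measurable_locPoly {d b : ℕ} (x₀ : Fin d → ℝ) (h : ℝ) (t : Coef d b) :
    Measurable (locPoly x₀ h t) := by
  refine Measurable.indicator ?_ (measurableSet_nbhd x₀ h)
  exact Finset.univ.measurable_fun_sum fun p _ => by
    have := measurable_monom p.1
    fun_prop

/-- The map from design and noise to the observation. -/
def obsMap {d : ℕ} (s : ℝ) (f : (Fin d → ℝ) → ℝ) (w : (Fin d → ℝ) × ℝ) : (Fin d → ℝ) × ℝ :=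
  (w.1, f w.1 + s * w.2)

/-- The joint law of design and noise. -/
def designNoise (d : ℕ) (g : ℝ → ℝ) : Measure ((Fin d → ℝ) × ℝ) :=
  ((volume : Measure (Fin d → ℝ)).restrict (cube d)).prod (noiseLaw g)

lemma isProbabilityMeasure_restrict_cube (d : ℕ) :
    IsProbabilityMeasure ((volume : Measure (Fin d → ℝ)).restrict (cube d)) :=
  ⟨by rw [Measure.restrict_apply_univ, volume_cube]⟩

lemma isProbabilityMeasure_designNoise (d : ℕ) {g : ℝ → ℝ} (hg : IsSymmDensity g) :
    IsProbabilityMeasure (designNoise d g) := by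
  have := hg.isProbabilityMeasure
  have := isProbabilityMeasure_restrict_cube d
  unfold designNoise
  infer_instance

lemma obsLawOne_eq {d : ℕ} (g : ℝ → ℝ) (s : ℝ) (f : (Fin d → ℝ) → ℝ) :
    obsLawOne g s f = (designNoise d g).map (obsMap s f) := rfl

lemma isProbabilityMeasure_obsLawOne {d : ℕ} {g : ℝ → ℝ} (hg : IsSymmDensity g) {s : ℝ}
    {f : (Fin d → ℝ) → ℝ} (hf : AEMeasurable (obsMap s f) (designNoise d g)) :
    IsProbabilityMeasure (obsLawOne g s f) := by
  have := isProbabilityMeasure_designNoise d hg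
  rw [obsLawOne_eq]
  exact Measure.isProbabilityMeasure_map hf

lemma integrable_comp_obsMap {d : ℕ} {g : ℝ → ℝ} (hg : IsSymmDensity g) {s : ℝ}
    {f : (Fin d → ℝ) → ℝ} (hf : AEMeasurable (obsMap s f) (designNoise d g))
    {Φ : (Fin d → ℝ) × ℝ → ℝ} (hΦ : Measurable Φ) {B : ℝ} (hB : ∀ z, |Φ z| ≤ B) :
    Integrable (fun w => Φ (obsMap s f w)) (designNoise d g) := by
  have := isProbabilityMeasure_designNoise d hg
  exact Integrable.of_bound (hΦ.comp_aemeasurable hf).aestronglyMeasurable B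
    (Eventually.of_forall fun w => hB _)

lemma integral_obsLawOne {d : ℕ} {g : ℝ → ℝ} (hg : IsSymmDensity g) {s : ℝ}
    {f : (Fin d → ℝ) → ℝ} (hf : AEMeasurable (obsMap s f) (designNoise d g))
    {Φ : (Fin d → ℝ) × ℝ → ℝ} (hΦ : Measurable Φ) {B : ℝ} (hB : ∀ z, |Φ z| ≤ B) :
    ∫ z, Φ z ∂(obsLawOne g s f) =
      ∫ x in cube d, ∫ u, Φ (x, f x + s * u) ∂(noiseLaw g) := by
  have := hg.isProbabilityMeasure
  rw [obsLawOne_eq, integral_map hf hΦ.aestronglyMeasurable]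
  exact integral_prod (μ := (volume : Measure (Fin d → ℝ)).restrict (cube d)) (ν := noiseLaw g)
    (fun w => Φ (obsMap s f w)) (integrable_comp_obsMap hg hf hΦ hB)

/-! ### Rescaling -/

/-- The rescaled design point `(x - x₀) / h`. -/
def resc {d : ℕ} (x₀ : Fin d → ℝ) (h : ℝ) (x : Fin d → ℝ) : Fin d → ℝ :=
  fun j => (x j - x₀ j) / h

@[fun_prop]
lemma measurable_resc {d : ℕ} (x₀ : Fin d → ℝ) (h : ℝ) : Measurable (resc x₀ h) := by
  unfold resc; fun_prop

lemma add_smul_resc {d : ℕ} (x₀ : Fin d → ℝ) {h : ℝ} (hh : 0 < h) (x : Fin d → ℝ) :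
    x₀ + h • resc x₀ h x = x := by
  funext j
  simp only [resc, Pi.add_apply, Pi.smul_apply, smul_eq_mul]
  field_simp; ring

lemma integral_comp_resc {d : ℕ} (x₀ : Fin d → ℝ) {h : ℝ} (hh : 0 < h) (φ : (Fin d → ℝ) → ℝ) :
    ∫ x, φ (resc x₀ h x) = h ^ d * ∫ z, φ z := by
  have e : ∀ x, resc x₀ h x = h⁻¹ • (x - x₀) := fun x => by
    funext j; simp [resc, div_eq_inv_mul]
  simp_rw [e]
  rw [integral_sub_right_eq_self (fun x => φ (h⁻¹ • x)) x₀,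
    Measure.integral_comp_inv_smul_of_nonneg _ _ hh.le]
  simp

variable {d : ℕ} {K : (Fin d → ℝ) → ℝ} {x₀ : Fin d → ℝ} {h : ℝ}

/-- The integrand lives where `K` does not vanish, and this region rescales into the cube, so the
boundary of the cube cuts nothing off. -/
lemma setIntegral_cube_comp_resc (hh : 0 < h) (hKh : ∀ z, K z ≠ 0 → x₀ + h • z ∈ cube d)
    {φ : (Fin d → ℝ) → ℝ} (hφ : ∀ z, K z = 0 → φ z = 0) :
    ∫ x in cube d, φ (resc x₀ h x) = h ^ d * ∫ z, φ z := by
  rw [setIntegral_eq_integral_of_forall_compl_eq_zero, integral_comp_resc x₀ hh]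
  intro x hx
  refine hφ _ (by_contra fun hn => hx ?_)
  have := hKh _ hn
  rwa [add_smul_resc x₀ hh] at this

lemma mem_nbhd_of_ne_zero (hK : IsKernel K) (hh : 0 < h)
    (hKh : ∀ z, K z ≠ 0 → x₀ + h • z ∈ cube d) {x : Fin d → ℝ} (hx : K (resc x₀ h x) ≠ 0) :
    x ∈ nbhd x₀ h := by
  refine ⟨fun j _ => ?_, by simpa [add_smul_resc x₀ hh] using hKh _ hx⟩
  have h1 := hK.support _ hx j
  simp only [resc] at h1
  rw [mem_Icc, le_div_iff₀ hh, div_le_iff₀ hh] at h1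
  constructor <;> linarith [h1.1, h1.2]

/-! ### Moments of the local scores -/

lemma abs_kernel_le (hK : IsKernel K) (z : Fin d → ℝ) : |K z| ≤ kerSup K := by
  rw [abs_of_nonneg (hK.nonneg z)]; exact hK.le_kerSup z

lemma integrable_comp_resc (hh : 0 < h) {φ : (Fin d → ℝ) → ℝ} (hφ : Integrable φ) :
    Integrable fun x => φ (resc x₀ h x) := by
  have e : ∀ x, resc x₀ h x = h⁻¹ • (x - x₀) := fun x => by
    funext j; simp [resc, div_eq_inv_mul]
  simp_rw [e]
  exact (hφ.comp_smul (inv_ne_zero hh.ne')).comp_sub_right x₀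

/-- Second moment of a score dominated by the kernel. -/
lemma integral_sq_obsLawOne_le (hK : IsKernel K) (hh : 0 < h)
    (hKh : ∀ z, K z ≠ 0 → x₀ + h • z ∈ cube d) {g : ℝ → ℝ} (hg : IsSymmDensity g) {s : ℝ}
    {f : (Fin d → ℝ) → ℝ} (hf : AEMeasurable (obsMap s f) (designNoise d g))
    {Φ : (Fin d → ℝ) × ℝ → ℝ} (hΦ : Measurable Φ) {B : ℝ}
    (hB : ∀ z, |Φ z| ≤ B * K (resc x₀ h z.1)) :
    ∫ z, Φ z ^ 2 ∂(obsLawOne g s f) ≤ B ^ 2 * kerSup K * h ^ d := by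
  have := hg.isProbabilityMeasure
  have hKn := hK.nonneg
  have hKs : 0 ≤ kerSup K := zero_le_one.trans hK.one_le_kerSup
  have hm := hK.measurable
  -- One factor `K` is bounded by its supremum and the other is integrated, which keeps the second
  -- moment of order `h ^ d`.
  have hsq : ∀ z, Φ z ^ 2 ≤ B ^ 2 * kerSup K * K (resc x₀ h z.1) := fun z => by
    rw [← sq_abs]
    calc |Φ z| ^ 2 ≤ (B * K (resc x₀ h z.1)) ^ 2 := by gcongr; exact hB z
      _ = B ^ 2 * (K (resc x₀ h z.1) * K (resc x₀ h z.1)) := by ring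
      _ ≤ B ^ 2 * (kerSup K * K (resc x₀ h z.1)) := by
          gcongr
          · exact hKn _
          · exact hK.le_kerSup _
      _ = _ := by ring
  have hP := isProbabilityMeasure_obsLawOne hg hf
  have hi2 : Integrable (fun z : (Fin d → ℝ) × ℝ => B ^ 2 * kerSup K * K (resc x₀ h z.1))
      (obsLawOne g s f) :=
    Integrable.of_bound (by fun_prop : Measurable _).aestronglyMeasurable
      (B ^ 2 * kerSup K * kerSup K) (Eventually.of_forall fun z => by
        rw [Real.norm_eq_abs, abs_mul, abs_of_nonneg (by positivity : 0 ≤ B ^ 2 * kerSup K)]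
        gcongr; exact abs_kernel_le hK _)
  have hi1 : Integrable (fun z => Φ z ^ 2) (obsLawOne g s f) :=
    hi2.mono' (hΦ.pow_const 2).aestronglyMeasurable (Eventually.of_forall fun z => by
      rw [Real.norm_eq_abs, abs_of_nonneg (sq_nonneg _)]; exact hsq z)
  refine (integral_mono hi1 hi2 hsq).trans (le_of_eq ?_)
  rw [integral_const_mul, integral_obsLawOne hg hf (Φ := fun z => K (resc x₀ h z.1))
    (by fun_prop) fun z => abs_kernel_le hK _]
  simp only [integral_const, probReal_univ, one_smul]
  rw [setIntegral_cube_comp_resc hh hKh fun z hz => hz, hK.integral_eq_one, mul_one]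

/-- The mean of the score is controlled by the approximation bias. -/
lemma abs_integral_clip_mul_le (hK : IsKernel K) (hh : 0 < h)
    (hKh : ∀ z, K z ≠ 0 → x₀ + h • z ∈ cube d) {g : ℝ → ℝ} (hg : IsSymmDensity g) {s : ℝ}
    {f : (Fin d → ℝ) → ℝ} (hf : AEMeasurable (obsMap s f) (designNoise d g))
    {ℓ : (Fin d → ℝ) → ℝ} (hℓ : Measurable ℓ) {δ : ℝ} (hδ : ∀ x ∈ nbhd x₀ h, |f x - ℓ x| ≤ δ)
    {γ : ℝ} (hγ : 0 ≤ γ) (p : Fin d → ℕ) :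
    |∫ z, clip γ (z.2 - ℓ z.1) * (monom p (resc x₀ h z.1) * K (resc x₀ h z.1))
      ∂(obsLawOne g s f)| ≤ h ^ d * δ := by
  have := hg.isProbabilityMeasure
  have hm := hK.measurable
  rw [integral_obsLawOne hg hf (B := γ * kerSup K)]
  · have hinner : ∀ x, |∫ u, clip γ (f x + s * u - ℓ x) *
        (monom p (resc x₀ h x) * K (resc x₀ h x)) ∂(noiseLaw g)| ≤ K (resc x₀ h x) * δ := by
      intro x
      rw [integral_mul_const, abs_mul]
      by_cases hx : K (resc x₀ h x) = 0
      · simp [hx]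
      have hδx := hδ x (mem_nbhd_of_ne_zero hK hh hKh hx)
      -- Truncated pure noise is centred by symmetry; `clip` being 1-Lipschitz, a bias of size `δ`
      -- moves the mean by at most `δ`.
      have h0 : ∫ u, clip γ (s * u) ∂(noiseLaw g) = 0 :=
        hg.integral_odd fun u => by rw [mul_neg, clip_neg hγ]
      have hbd : ∀ a : ℝ, Integrable (fun u => clip γ (a + s * u)) (noiseLaw g) := fun a =>
        Integrable.of_bound (by fun_prop : Measurable _).aestronglyMeasurable γ
          (Eventually.of_forall fun u => abs_clip_le hγ _)
      have h1 : |∫ u, clip γ (f x + s * u - ℓ x) ∂(noiseLaw g)| ≤ δ := by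
        have e : ∫ u, clip γ (f x + s * u - ℓ x) ∂(noiseLaw g) =
            ∫ u, (clip γ ((f x - ℓ x) + s * u) - clip γ (0 + s * u)) ∂(noiseLaw g) := by
          rw [integral_sub (hbd _) (hbd _)]
          simp only [zero_add, h0, sub_zero]
          congr 1; funext u; congr 1; ring
        rw [e]
        have := norm_integral_le_of_norm_le_const (μ := noiseLaw g) (C := δ)
          (f := fun u => clip γ ((f x - ℓ x) + s * u) - clip γ (0 + s * u))
          (Eventually.of_forall fun u => by
            refine (abs_clip_sub_clip_le _ _ _).trans ?_
            simpa using hδx)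
        simpa using this
      rw [mul_comm (K _)]
      exact mul_le_mul h1 (hK.abs_monom_mul_le p _) (abs_nonneg _)
        ((abs_nonneg _).trans hδx)
    have hi : Integrable (fun x => K (resc x₀ h x) * δ) (volume.restrict (cube d)) :=
      ((integrable_comp_resc hh hK.integrable).mul_const δ).integrableOn
    refine (norm_integral_le_of_norm_le (f := fun x => ∫ u, clip γ (f x + s * u - ℓ x) *
      (monom p (resc x₀ h x) * K (resc x₀ h x)) ∂(noiseLaw g)) hi
      (Eventually.of_forall hinner)).trans (le_of_eq ?_)
    rw [integral_mul_const, setIntegral_cube_comp_resc hh hKh fun z hz => hz,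
      hK.integral_eq_one, mul_one]
  · fun_prop
  · intro z
    rw [abs_mul]
    exact mul_le_mul (abs_clip_le hγ _) ((hK.abs_monom_mul_le p _).trans (hK.le_kerSup _))
      (abs_nonneg _) hγ

/-- The mean curvature dominates the Gram matrix of the kernel. -/
lemma le_integral_curvature {b : ℕ} (hK : IsKernel K) (hh : 0 < h)
    (hKh : ∀ z, K z ≠ 0 → x₀ + h • z ∈ cube d) {g : ℝ → ℝ} (hg : IsSymmDensity g) {s : ℝ}
    (hs : 0 < s) {f : (Fin d → ℝ) → ℝ} (hf : AEMeasurable (obsMap s f) (designNoise d g))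
    {ℓ : (Fin d → ℝ) → ℝ} (hℓ : Measurable ℓ) {γ c : ℝ} (hγ : 0 < γ) (hc0 : 0 ≤ c)
    (hδ : ∀ x ∈ nbhd x₀ h, |f x - ℓ x| ≤ γ / 16)
    (hc : c ≤ 2 * ∫ u in (0 : ℝ)..(γ / s), g u) (v : Coef d b) :
    7 / 8 * c * (minEig d b K * ∑ p, v p ^ 2) * h ^ d ≤
      ∫ z, {z : (Fin d → ℝ) × ℝ | |z.2 - ℓ z.1| ≤ γ - γ / 16}.indicator 1 z *
        (polyVal v (resc x₀ h z.1) ^ 2 * K (resc x₀ h z.1)) ∂(obsLawOne g s f) := by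
  have := hg.isProbabilityMeasure
  have hm := hK.measurable
  have hms : MeasurableSet {z : (Fin d → ℝ) × ℝ | |z.2 - ℓ z.1| ≤ γ - γ / 16} :=
    measurableSet_le (by fun_prop) measurable_const
  set Φ : (Fin d → ℝ) × ℝ → ℝ := fun z =>
    {z : (Fin d → ℝ) × ℝ | |z.2 - ℓ z.1| ≤ γ - γ / 16}.indicator 1 z *
        (polyVal v (resc x₀ h z.1) ^ 2 * K (resc x₀ h z.1)) with hΦ
  have hΦm : Measurable Φ := by
    have : Measurable ({z : (Fin d → ℝ) × ℝ | |z.2 - ℓ z.1| ≤ γ - γ / 16}.indicator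
      (1 : (Fin d → ℝ) × ℝ → ℝ)) := measurable_one.indicator hms
    fun_prop
  have hq : ∀ z : Fin d → ℝ, |polyVal v z ^ 2 * K z| ≤ (∑ p, |v p|) ^ 2 * kerSup K := by
    intro z
    by_cases hz : K z = 0
    · have := zero_le_one.trans hK.one_le_kerSup
      simp only [hz, mul_zero, abs_zero]; positivity
    · rw [abs_mul, abs_pow]
      have h1 : |polyVal v z| ≤ ∑ p, |v p| := by
        refine (Finset.abs_sum_le_sum_abs _ _).trans (Finset.sum_le_sum fun p _ => ?_)
        rw [abs_mul]
        exact mul_le_of_le_one_right (abs_nonneg _) (abs_monom_le_one _ (hK.support z hz))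
      have h2 := abs_kernel_le hK z
      gcongr
  have hΦb : ∀ z, |Φ z| ≤ (∑ p, |v p|) ^ 2 * kerSup K := by
    intro z
    simp only [hΦ]
    rw [abs_mul]
    refine (mul_le_of_le_one_left (abs_nonneg _) ?_).trans (hq _)
    by_cases hz : z ∈ {z : (Fin d → ℝ) × ℝ | |z.2 - ℓ z.1| ≤ γ - γ / 16}
    · rw [indicator_of_mem hz]; simp
    · rw [indicator_of_notMem hz]; simp
  rw [integral_obsLawOne hg hf hΦm hΦb]
  have hint : Integrable (fun x => ∫ u, Φ (x, f x + s * u) ∂(noiseLaw g))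
      (volume.restrict (cube d)) :=
    (integrable_comp_obsMap hg hf hΦm hΦb).integral_prod_left
  -- Given the design point, the residual is in the quadratic zone with probability at least `7c/8`;
  -- integrating the noise out leaves the Gram form of the kernel.
  have hlow : ∀ x, 7 / 8 * c * (polyVal v (resc x₀ h x) ^ 2 * K (resc x₀ h x)) ≤
      ∫ u, Φ (x, f x + s * u) ∂(noiseLaw g) := by
    intro x
    by_cases hx : K (resc x₀ h x) = 0
    · simp [hΦ, hx]
    have hδx := hδ x (mem_nbhd_of_ne_zero hK hh hKh hx)
    simp only [hΦ]
    rw [integral_mul_const]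
    refine mul_le_mul_of_nonneg_right ?_ (mul_nonneg (sq_nonneg _) (hK.nonneg _))
    have hms2 : MeasurableSet {u : ℝ | |f x - ℓ x + s * u| ≤ γ - γ / 16} :=
      measurableSet_le (by fun_prop) measurable_const
    have e : (fun u => {z : (Fin d → ℝ) × ℝ | |z.2 - ℓ z.1| ≤ γ - γ / 16}.indicator
        (1 : (Fin d → ℝ) × ℝ → ℝ) (x, f x + s * u)) =
        {u : ℝ | |f x - ℓ x + s * u| ≤ γ - γ / 16}.indicator 1 := by
      funext u
      have e2 : f x + s * u - ℓ x = f x - ℓ x + s * u := by ring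
      simp only [indicator_apply, mem_ofPred_eq, e2, Pi.one_apply]
    rw [e, integral_indicator_one hms2]
    exact le_measureReal_abs_add_le hg hs hγ hc hδx
  have hi0 : Integrable (fun x => 7 / 8 * c * (polyVal v (resc x₀ h x) ^ 2 * K (resc x₀ h x)))
      (volume.restrict (cube d)) :=
    ((integrable_comp_resc hh (hK.integrable_polyVal_sq_mul v)).const_mul _).integrableOn
  refine le_trans ?_ (integral_mono hi0 hint hlow)
  rw [integral_const_mul, setIntegral_cube_comp_resc (φ := fun z => polyVal v z ^ 2 * K z) hh hKh
    fun z hz => by rw [hz, mul_zero]]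
  have h1 := minEig_mul_le hK v
  calc 7 / 8 * c * (minEig d b K * ∑ p, v p ^ 2) * h ^ d
      = 7 / 8 * c * (h ^ d * (minEig d b K * ∑ p, v p ^ 2)) := by ring
    _ ≤ _ := by gcongr

end

noncomputable section

/-! ### Localisation of the M-estimator -/

variable {d b n : ℕ} {K : (Fin d → ℝ) → ℝ} {x₀ : Fin d → ℝ} {h γ : ℝ}

lemma locPoly_of_mem {t : Coef d b} {x : Fin d → ℝ} (hx : x ∈ nbhd x₀ h) :
    locPoly x₀ h t x = polyVal t (resc x₀ h x) := by
  rw [locPoly, indicator_of_mem hx]; rfl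

lemma polyVal_add (t v : Coef d b) (z : Fin d → ℝ) :
    polyVal (t + v) z = polyVal t z + polyVal v z := by
  simp [polyVal, add_mul, Finset.sum_add_distrib]

lemma polyVal_smul (τ : ℝ) (v : Coef d b) (z : Fin d → ℝ) :
    polyVal (τ • v) z = τ * polyVal v z := by
  simp [polyVal, Finset.mul_sum, mul_assoc]

lemma abs_polyVal_le (v : Coef d b) {z : Fin d → ℝ}
    (hz : ∀ j, z j ∈ Icc (-(1 / 2) : ℝ) (1 / 2)) : |polyVal v z| ≤ ∑ p, |v p| := by
  refine (Finset.abs_sum_le_sum_abs _ _).trans (Finset.sum_le_sum fun p _ => ?_)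
  rw [abs_mul]
  exact mul_le_of_le_one_right (abs_nonneg _) (abs_monom_le_one _ hz)

/-- The criterion without its normalisation. -/
def rawCrit (γ : ℝ) (K : (Fin d → ℝ) → ℝ) (x₀ : Fin d → ℝ) (h : ℝ) (Z : Sample d n)
    (t : Coef d b) : ℝ :=
  ∑ i, huber γ ((Z i).2 - locPoly x₀ h t (Z i).1) * K (resc x₀ h (Z i).1)

/-- The contribution of one observation to the score. -/
def score (γ : ℝ) (K : (Fin d → ℝ) → ℝ) (x₀ : Fin d → ℝ) (h : ℝ) (t : Coef d b)
    (p : ↥(multiIdx d b)) (z : (Fin d → ℝ) × ℝ) : ℝ :=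
  clip γ (z.2 - locPoly x₀ h t z.1) * (monom p.1 (resc x₀ h z.1) * K (resc x₀ h z.1))

/-- The observations whose residuals are well inside the quadratic zone. -/
def quadZone (γ : ℝ) (x₀ : Fin d → ℝ) (h : ℝ) (t : Coef d b) : Set ((Fin d → ℝ) × ℝ) :=
  {z | |z.2 - locPoly x₀ h t z.1| ≤ γ - γ / 16}

/-- The contribution of one observation to the curvature. -/
def hess (γ : ℝ) (K : (Fin d → ℝ) → ℝ) (x₀ : Fin d → ℝ) (h : ℝ) (t : Coef d b)
    (p q : ↥(multiIdx d b)) (z : (Fin d → ℝ) × ℝ) : ℝ :=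
  (quadZone γ x₀ h t).indicator 1 z *
    (monom p.1 (resc x₀ h z.1) * monom q.1 (resc x₀ h z.1) * K (resc x₀ h z.1))

lemma measurableSet_quadZone (t : Coef d b) : MeasurableSet (quadZone γ x₀ h t) :=
  measurableSet_le (by fun_prop) measurable_const

lemma measurable_score (hK : IsKernel K) (t : Coef d b) (p : ↥(multiIdx d b)) :
    Measurable (score γ K x₀ h t p) := by
  have := hK.measurable
  unfold score; fun_prop

lemma measurable_hess (hK : IsKernel K) (t : Coef d b) (p q : ↥(multiIdx d b)) :
    Measurable (hess γ K x₀ h t p q) := by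
  have := hK.measurable
  have : Measurable ((quadZone γ x₀ h t).indicator (1 : (Fin d → ℝ) × ℝ → ℝ)) :=
    measurable_one.indicator (measurableSet_quadZone t)
  unfold hess; fun_prop

lemma abs_score_le (hK : IsKernel K) (hγ : 0 ≤ γ) (t : Coef d b) (p : ↥(multiIdx d b))
    (z : (Fin d → ℝ) × ℝ) : |score γ K x₀ h t p z| ≤ γ * K (resc x₀ h z.1) := by
  rw [score, abs_mul]
  exact mul_le_mul (abs_clip_le hγ _) (hK.abs_monom_mul_le p.1 _) (abs_nonneg _) hγ

lemma abs_hess_le (hK : IsKernel K) (t : Coef d b) (p q : ↥(multiIdx d b))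
    (z : (Fin d → ℝ) × ℝ) : |hess γ K x₀ h t p q z| ≤ 1 * K (resc x₀ h z.1) := by
  rw [hess, abs_mul]
  refine mul_le_mul ?_ (hK.abs_monom_mul_monom_mul_le p.1 q.1 _) (abs_nonneg _) zero_le_one
  by_cases hz : z ∈ quadZone γ x₀ h t
  · rw [indicator_of_mem hz]; simp
  · rw [indicator_of_notMem hz]; simp

/-- Quadratic lower bound for the increments of the criterion. -/
lemma rawCrit_quadratic_le (hK : IsKernel K) (hh : 0 < h)
    (hKh : ∀ z, K z ≠ 0 → x₀ + h • z ∈ cube d) (hγ : 0 ≤ γ) (Z : Sample d n) (t w : Coef d b)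
    (hw : ∑ p, |w p| ≤ γ / 16) :
    rawCrit γ K x₀ h Z t - ∑ p, w p * ∑ i, score γ K x₀ h t p (Z i) +
      (1 / 2) * ∑ p, ∑ q, w p * w q * ∑ i, hess γ K x₀ h t p q (Z i) ≤
      rawCrit γ K x₀ h Z (t + w) := by
  have e1 : ∑ p, w p * ∑ i, score γ K x₀ h t p (Z i) =
      ∑ i, clip γ ((Z i).2 - locPoly x₀ h t (Z i).1) * polyVal w (resc x₀ h (Z i).1) *
        K (resc x₀ h (Z i).1) := by
    simp_rw [Finset.mul_sum]
    rw [Finset.sum_comm]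
    refine Finset.sum_congr rfl fun i _ => ?_
    rw [polyVal, Finset.mul_sum, Finset.sum_mul]
    exact Finset.sum_congr rfl fun p _ => by rw [score]; ring
  have e2 : ∑ p, ∑ q, w p * w q * ∑ i, hess γ K x₀ h t p q (Z i) =
      ∑ i, (quadZone γ x₀ h t).indicator 1 (Z i) *
        (polyVal w (resc x₀ h (Z i).1) ^ 2 * K (resc x₀ h (Z i).1)) := by
    simp_rw [IsKernel.polyVal_sq_mul, Finset.mul_sum]
    simp_rw [Finset.sum_comm (s := (Finset.univ : Finset ↥(multiIdx d b)))
      (t := (Finset.univ : Finset (Fin n)))]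
    refine Finset.sum_congr rfl fun i _ => Finset.sum_congr rfl fun p _ =>
      Finset.sum_congr rfl fun q _ => ?_
    rw [hess]; ring
  rw [e1, e2, rawCrit, rawCrit, ← Finset.sum_sub_distrib, Finset.mul_sum,
    ← Finset.sum_add_distrib]
  refine Finset.sum_le_sum fun i _ => ?_
  by_cases hz : K (resc x₀ h (Z i).1) = 0
  · simp [hz]
  have hx := mem_nbhd_of_ne_zero hK hh hKh hz
  have hs : |polyVal w (resc x₀ h (Z i).1)| ≤ γ / 16 :=
    (abs_polyVal_le w (hK.support _ hz)).trans hw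
  have hq := huber_quadratic_le (a := (Z i).2 - locPoly x₀ h t (Z i).1) hγ hs
  have e3 : (Z i).2 - locPoly x₀ h (t + w) (Z i).1 =
      (Z i).2 - locPoly x₀ h t (Z i).1 - polyVal w (resc x₀ h (Z i).1) := by
    rw [locPoly_of_mem hx, locPoly_of_mem hx, polyVal_add]; ring
  rw [e3]
  refine le_trans (le_of_eq ?_) (mul_le_mul_of_nonneg_right hq (hK.nonneg _))
  by_cases hm : |(Z i).2 - locPoly x₀ h t (Z i).1| ≤ γ - γ / 16
  · have hm' : Z i ∈ quadZone γ x₀ h t := hm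
    rw [indicator_of_mem hm', if_pos hm, Pi.one_apply]; ring
  · have hm' : Z i ∉ quadZone γ x₀ h t := hm
    rw [indicator_of_notMem hm', if_neg hm]; ring

/-- Where `K` does not vanish the local polynomial is linear in its coefficients, so the criterion
inherits convexity from the loss. -/
lemma rawCrit_segment_le (hK : IsKernel K) (hh : 0 < h)
    (hKh : ∀ z, K z ≠ 0 → x₀ + h • z ∈ cube d) (hγ : 0 ≤ γ) (Z : Sample d n) (t v : Coef d b)
    {τ : ℝ} (h0 : 0 ≤ τ) (h1 : τ ≤ 1)
    (hmin : rawCrit γ K x₀ h Z (t + v) ≤ rawCrit γ K x₀ h Z t) :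
    rawCrit γ K x₀ h Z (t + τ • v) ≤ rawCrit γ K x₀ h Z t := by
  have key : rawCrit γ K x₀ h Z (t + τ • v) ≤
      (1 - τ) * rawCrit γ K x₀ h Z t + τ * rawCrit γ K x₀ h Z (t + v) := by
    simp only [rawCrit]
    rw [Finset.mul_sum, Finset.mul_sum, ← Finset.sum_add_distrib]
    refine Finset.sum_le_sum fun i _ => ?_
    by_cases hz : K (resc x₀ h (Z i).1) = 0
    · simp [hz]
    have hx := mem_nbhd_of_ne_zero hK hh hKh hz
    have hq := huber_segment_le hγ h0 h1 ((Z i).2 - polyVal t (resc x₀ h (Z i).1))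
      (polyVal v (resc x₀ h (Z i).1))
    rw [locPoly_of_mem hx, locPoly_of_mem hx, locPoly_of_mem hx, polyVal_add, polyVal_add,
      polyVal_smul, ← sub_sub, ← sub_sub]
    refine (mul_le_mul_of_nonneg_right hq (hK.nonneg _)).trans (le_of_eq ?_)
    ring
  nlinarith

/-- Each coordinate is at most the Euclidean norm. This crude comparison is the source of the factor
`N_b` in the localisation condition. -/
lemma sum_abs_le_card_mul {ι : Type*} [Fintype ι] {w : ι → ℝ} {δ : ℝ} (hδ : 0 ≤ δ)
    (hw : ∑ p, w p ^ 2 = δ ^ 2) : ∑ p, |w p| ≤ Fintype.card ι * δ := by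
  have : ∀ p, |w p| ≤ δ := fun p => by
    refine abs_le_of_sq_le_sq ?_ hδ
    rw [← hw]
    exact Finset.single_le_sum (f := fun p => w p ^ 2) (fun _ _ => sq_nonneg _)
      (Finset.mem_univ p)
  calc ∑ p, |w p| ≤ ∑ _p : ι, δ := Finset.sum_le_sum fun p _ => this p
    _ = _ := by simp

lemma card_multiIdx : Fintype.card ↥(multiIdx d b) = numIdx d b := Fintype.card_coe _

/-- Deterministic localisation: if score and curvature are close to their means, the minimizer
is close to the target. -/
lemma abs_sub_le_of_score_hess (hK : IsKernel K) (hh : 0 < h)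
    (hKh : ∀ z, K z ≠ 0 → x₀ + h • z ∈ cube d) (hγ : 0 ≤ γ) (Z : Sample d n) {t θ : Coef d b}
    (hmin : rawCrit γ K x₀ h Z θ ≤ rawCrit γ K x₀ h Z t) {N δ y κ : ℝ} (hN : 0 < N) (hδ : 0 < δ)
    (hδγ : numIdx d b * δ ≤ γ / 16)
    (hs : ∀ p, |∑ i, score γ K x₀ h t p (Z i)| ≤ N * y)
    (hH : ∀ w : Coef d b, N * (κ * ∑ p, w p ^ 2) ≤
      ∑ p, ∑ q, w p * w q * ∑ i, hess γ K x₀ h t p q (Z i))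
    (hy : numIdx d b * y < κ / 2 * δ) (p : ↥(multiIdx d b)) :
    |θ p - t p| ≤ δ := by
  set v : Coef d b := θ - t with hv
  set A := ∑ p, v p ^ 2 with hA
  have hvp : v p ^ 2 ≤ A :=
    Finset.single_le_sum (f := fun p => v p ^ 2) (fun _ _ => sq_nonneg _) (Finset.mem_univ p)
  by_contra hcon
  rw [not_le] at hcon
  have hAδ : δ ^ 2 < A := by
    refine lt_of_lt_of_le ?_ hvp
    rw [← sq_abs (v p)]
    exact pow_lt_pow_left₀ hcon hδ.le two_ne_zero
  have hA0 : 0 < A := (sq_nonneg δ).trans_lt hAδ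
  have hsA : δ < √A := Real.lt_sqrt hδ.le |>.2 hAδ
  -- Pull the minimizer back along its segment onto the sphere of radius `δ` around `t`: by
  -- convexity the criterion is still no larger than at `t`, and the quadratic lower bound is valid
  -- at that distance.
  set τ := δ / √A with hτ
  have hτ0 : 0 ≤ τ := by positivity
  have hτ1 : τ ≤ 1 := by rw [hτ, div_le_one (by positivity)]; exact hsA.le
  have hw2 : ∑ p, (τ • v) p ^ 2 = δ ^ 2 := by
    simp only [Pi.smul_apply, smul_eq_mul, mul_pow]
    rw [← Finset.mul_sum, ← hA, hτ, div_pow, Real.sq_sqrt hA0.le]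
    field_simp
  have hw1 := sum_abs_le_card_mul hδ.le hw2
  rw [card_multiIdx] at hw1
  have hseg := rawCrit_segment_le hK hh hKh hγ Z t v hτ0 hτ1 (by rwa [hv, add_sub_cancel])
  have hquad := rawCrit_quadratic_le hK hh hKh hγ Z t (τ • v) (hw1.trans hδγ)
  have hHw := hH (τ • v)
  rw [hw2] at hHw
  have hy0 : 0 ≤ N * y := (abs_nonneg _).trans (hs p)
  have hlin : ∑ p, (τ • v) p * ∑ i, score γ K x₀ h t p (Z i) ≤ numIdx d b * δ * (N * y) := by
    calc ∑ p, (τ • v) p * ∑ i, score γ K x₀ h t p (Z i)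
        ≤ ∑ p, |(τ • v) p| * (N * y) := by
          refine Finset.sum_le_sum fun q _ => (le_abs_self _).trans ?_
          rw [abs_mul]
          exact mul_le_mul_of_nonneg_left (hs q) (abs_nonneg _)
      _ = (∑ p, |(τ • v) p|) * (N * y) := by rw [Finset.sum_mul]
      _ ≤ _ := by gcongr
  -- On the sphere the curvature gain has to be offset by the linear term, which `hy` excludes.
  have h1 : N * (κ * δ ^ 2) / 2 ≤ numIdx d b * δ * (N * y) := by linarith
  have h2 : N * δ * (numIdx d b * y) < N * δ * (κ / 2 * δ) := by gcongr
  nlinarith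

/-! ### Exponential bound for the local estimator -/

section Tail

variable {g : ℝ → ℝ} {σ : ℕ → ℝ} {f : (Fin d → ℝ) → ℝ}

/-- Bernstein with sup bound `γ K_∞` and second moment `γ² K_∞ h ^ d`; for these values the Gaussian
regime is exactly `x ≤ γ`. -/
lemma measure_score_le (hK : IsKernel K) (hh : 0 < h)
    (hKh : ∀ z, K z ≠ 0 → x₀ + h • z ∈ cube d) (hg : IsSymmDensity g)
    (hf : ∀ i : Fin n, AEMeasurable (obsMap (σ i) f) (designNoise d g)) (hn : 0 < n)
    (hγ : 0 < γ) {x : ℝ} (hx : 0 ≤ x) (hxγ : x ≤ γ) (t : Coef d b) (p : ↥(multiIdx d b)) :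
    obsLaw g σ f n {Z | n * h ^ d * x ≤ |∑ i, score γ K x₀ h t p (Z i) -
      ∑ i : Fin n, ∫ z, score γ K x₀ h t p z ∂(obsLawOne g (σ i) f)|} ≤
      ENNReal.ofReal (2 * Real.exp (-(n * h ^ d * x ^ 2 / (4 * (γ ^ 2 * kerSup K))))) := by
  have : ∀ i : Fin n, IsProbabilityMeasure (obsLawOne g (σ i) f) := fun i =>
    isProbabilityMeasure_obsLawOne hg (hf i)
  have hKs : 0 < kerSup K := zero_lt_one.trans_le hK.one_le_kerSup
  have hn' : (0 : ℝ) < n := by exact_mod_cast hn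
  have := measure_abs_sum_sub_integral_ge_le (μ := fun i : Fin n => obsLawOne g (σ i) f)
    (measurable_score (γ := γ) (x₀ := x₀) (h := h) hK t p) (B := γ * kerSup K)
    (v := γ ^ 2 * kerSup K * h ^ d) (x := n * h ^ d * x)
    (fun z => (abs_score_le hK hγ.le t p z).trans (by gcongr; exact hK.le_kerSup _))
    (fun i => integral_sq_obsLawOne_le hK hh hKh hg (hf i) (measurable_score hK t p)
      (abs_score_le hK hγ.le t p)) (by positivity) (by positivity)
    (by
      calc n * h ^ d * x * (γ * kerSup K) ≤ n * h ^ d * γ * (γ * kerSup K) := by gcongr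
        _ = _ := by ring)
  refine this.trans (le_of_eq ?_)
  congr 4
  field_simp

lemma measure_hess_le (hK : IsKernel K) (hh : 0 < h)
    (hKh : ∀ z, K z ≠ 0 → x₀ + h • z ∈ cube d) (hg : IsSymmDensity g)
    (hf : ∀ i : Fin n, AEMeasurable (obsMap (σ i) f) (designNoise d g)) (hn : 0 < n)
    {η : ℝ} (hη : 0 ≤ η) (hη1 : η ≤ 1) (t : Coef d b) (p q : ↥(multiIdx d b)) :
    obsLaw g σ f n {Z | n * h ^ d * η ≤ |∑ i, hess γ K x₀ h t p q (Z i) -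
      ∑ i : Fin n, ∫ z, hess γ K x₀ h t p q z ∂(obsLawOne g (σ i) f)|} ≤
      ENNReal.ofReal (2 * Real.exp (-(n * h ^ d * η ^ 2 / (4 * kerSup K)))) := by
  have : ∀ i : Fin n, IsProbabilityMeasure (obsLawOne g (σ i) f) := fun i =>
    isProbabilityMeasure_obsLawOne hg (hf i)
  have hKs : 0 < kerSup K := zero_lt_one.trans_le hK.one_le_kerSup
  have hn' : (0 : ℝ) < n := by exact_mod_cast hn
  have := measure_abs_sum_sub_integral_ge_le (μ := fun i : Fin n => obsLawOne g (σ i) f)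
    (measurable_hess (γ := γ) (x₀ := x₀) (h := h) hK t p q) (B := kerSup K)
    (v := 1 ^ 2 * kerSup K * h ^ d) (x := n * h ^ d * η)
    (fun z => (abs_hess_le hK t p q z).trans (by rw [one_mul]; exact hK.le_kerSup _))
    (fun i => integral_sq_obsLawOne_le hK hh hKh hg (hf i) (measurable_hess hK t p q)
      (abs_hess_le hK t p q)) (by positivity) (by positivity)
    (by
      calc n * h ^ d * η * kerSup K ≤ n * h ^ d * 1 * kerSup K := by gcongr
        _ = _ := by ring)
  refine this.trans (le_of_eq ?_)
  congr 4
  field_simp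

lemma le_sum_integral_hess (hK : IsKernel K) (hh : 0 < h)
    (hKh : ∀ z, K z ≠ 0 → x₀ + h • z ∈ cube d) (hg : IsSymmDensity g) (hσ : ∀ i, 0 < σ i)
    (hf : ∀ i : Fin n, AEMeasurable (obsMap (σ i) f) (designNoise d g)) (hγ : 0 < γ) {c : ℝ}
    (hc0 : 0 ≤ c) (hc : ∀ i, c ≤ 2 * ∫ u in (0 : ℝ)..(γ / σ i), g u) {t : Coef d b}
    (hδ : ∀ x ∈ nbhd x₀ h, |f x - locPoly x₀ h t x| ≤ γ / 16) (w : Coef d b) :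
    n * h ^ d * (7 / 8 * c * minEig d b K * ∑ p, w p ^ 2) ≤
      ∑ p, ∑ q, w p * w q *
        ∑ i : Fin n, ∫ z, hess γ K x₀ h t p q z ∂(obsLawOne g (σ i) f) := by
  have hP : ∀ i : Fin n, IsProbabilityMeasure (obsLawOne g (σ i) f) := fun i =>
    isProbabilityMeasure_obsLawOne hg (hf i)
  have hint : ∀ (i : Fin n) p q, Integrable (hess γ K x₀ h t p q) (obsLawOne g (σ i) f) :=
    fun i p q => Integrable.of_bound (measurable_hess hK t p q).aestronglyMeasurable (kerSup K)
      (Eventually.of_forall fun z =>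
        (abs_hess_le hK t p q z).trans (by rw [one_mul]; exact hK.le_kerSup _))
  have e : ∑ p, ∑ q, w p * w q *
        ∑ i : Fin n, ∫ z, hess γ K x₀ h t p q z ∂(obsLawOne g (σ i) f) =
      ∑ i : Fin n, ∫ z, (quadZone γ x₀ h t).indicator 1 z *
        (polyVal w (resc x₀ h z.1) ^ 2 * K (resc x₀ h z.1)) ∂(obsLawOne g (σ i) f) := by
    simp_rw [Finset.mul_sum]
    simp_rw [Finset.sum_comm (s := (Finset.univ : Finset ↥(multiIdx d b)))
      (t := (Finset.univ : Finset (Fin n)))]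
    refine Finset.sum_congr rfl fun i _ => ?_
    simp_rw [← integral_const_mul]
    rw [Finset.sum_congr rfl fun p _ => (integral_finsetSum _ fun q _ =>
      (hint i p q).const_mul (w p * w q)).symm, ← integral_finsetSum _ fun p _ =>
      integrable_finsetSum _ fun q _ => (hint i p q).const_mul (w p * w q)]
    congr 1
    funext z
    rw [IsKernel.polyVal_sq_mul, Finset.mul_sum]
    refine Finset.sum_congr rfl fun p _ => ?_
    rw [Finset.mul_sum]
    exact Finset.sum_congr rfl fun q _ => by rw [hess]; ring
  rw [e]
  calc n * h ^ d * (7 / 8 * c * minEig d b K * ∑ p, w p ^ 2)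
      = ∑ _i : Fin n, 7 / 8 * c * (minEig d b K * ∑ p, w p ^ 2) * h ^ d := by
        rw [Finset.sum_const, Finset.card_univ, Fintype.card_fin, nsmul_eq_mul]; ring
    _ ≤ _ := Finset.sum_le_sum fun i _ => le_integral_curvature hK hh hKh hg (hσ i) (hf i)
        (measurable_locPoly x₀ h t) hγ hc0 hδ (hc i) w

/-- Exponential bound for the error of the local estimator at a fixed bandwidth. -/
theorem measure_local_error_le (hK : IsKernel K) (hh : 0 < h)
    (hKh : ∀ z, K z ≠ 0 → x₀ + h • z ∈ cube d) (hg : IsSymmDensity g) (hσ : ∀ i, 0 < σ i)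
    (hf : ∀ i : Fin n, AEMeasurable (obsMap (σ i) f) (designNoise d g)) (hn : 0 < n)
    (hγ : 0 < γ) {c : ℝ} (hc0 : 0 ≤ c) (hc : ∀ i, c ≤ 2 * ∫ u in (0 : ℝ)..(γ / σ i), g u)
    {t : Coef d b} {B : ℝ} (hB : ∀ x ∈ nbhd x₀ h, |f x - locPoly x₀ h t x| ≤ B)
    (hBγ : B ≤ γ / 16) {θ : Sample d n → Coef d b}
    (hθ : ∀ Z, criterion (huber γ) K x₀ h Z (θ Z) ≤ criterion (huber γ) K x₀ h Z t)
    {x δ η : ℝ} (hx : 0 ≤ x) (hxγ : x ≤ γ) (hδ : 0 < δ) (hδγ : numIdx d b * δ ≤ γ / 16)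
    (hη : 0 ≤ η) (hη1 : η ≤ 1) (hηc : (numIdx d b : ℝ) ^ 2 * η ≤ c * minEig d b K / 8)
    (hbal : numIdx d b * (x + B) < 3 / 8 * (c * minEig d b K) * δ) (p : ↥(multiIdx d b)) :
    obsLaw g σ f n {Z | δ < |θ Z p - t p|} ≤
      numIdx d b *
        ENNReal.ofReal (2 * Real.exp (-(n * h ^ d * x ^ 2 / (4 * (γ ^ 2 * kerSup K))))) +
      (numIdx d b) ^ 2 *
        ENNReal.ofReal (2 * Real.exp (-(n * h ^ d * η ^ 2 / (4 * kerSup K)))) := by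
  have hn' : (0 : ℝ) < n := by exact_mod_cast hn
  have hNpos : (0 : ℝ) < n * h ^ d := by positivity
  set G : ↥(multiIdx d b) → Set (Sample d n) := fun p =>
    {Z | n * h ^ d * x ≤ |∑ i, score γ K x₀ h t p (Z i) -
      ∑ i : Fin n, ∫ z, score γ K x₀ h t p z ∂(obsLawOne g (σ i) f)|} with hG
  set H : ↥(multiIdx d b) × ↥(multiIdx d b) → Set (Sample d n) := fun pq =>
    {Z | n * h ^ d * η ≤ |∑ i, hess γ K x₀ h t pq.1 pq.2 (Z i) -
      ∑ i : Fin n, ∫ z, hess γ K x₀ h t pq.1 pq.2 z ∂(obsLawOne g (σ i) f)|} with hH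
  have hsub : {Z | δ < |θ Z p - t p|} ⊆ (⋃ p, G p) ∪ ⋃ pq, H pq := by
    intro Z hZ
    by_contra hcon
    simp only [mem_union, mem_iUnion, not_or, not_exists, hG, hH, mem_ofPred_eq, not_le] at hcon
    obtain ⟨hcG, hcH⟩ := hcon
    have hmin : rawCrit γ K x₀ h Z (θ Z) ≤ rawCrit γ K x₀ h Z t :=
      le_of_mul_le_mul_left (hθ Z) (by positivity : 0 < 1 / ((n : ℝ) * h ^ d))
    -- Off the deviation events, per unit of `n h ^ d`, the score is at most the deviation `x` plus
    -- the mean `B`, and the curvature loses at most `c λ / 8` of its mean `7 c λ / 8`.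
    refine absurd (abs_sub_le_of_score_hess hK hh hKh hγ.le Z hmin hNpos hδ hδγ (y := x + B)
      (κ := 3 / 4 * (c * minEig d b K)) (fun q => ?_) (fun w => ?_) (by linarith) p) (not_le.2 hZ)
    · have hm : |∑ i : Fin n, ∫ z, score γ K x₀ h t q z ∂(obsLawOne g (σ i) f)| ≤
          n * h ^ d * B := by
        refine (Finset.abs_sum_le_sum_abs _ _).trans ?_
        calc ∑ i : Fin n, |∫ z, score γ K x₀ h t q z ∂(obsLawOne g (σ i) f)|
            ≤ ∑ _i : Fin n, h ^ d * B := Finset.sum_le_sum fun i _ =>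
              abs_integral_clip_mul_le hK hh hKh hg (hf i) (measurable_locPoly x₀ h t) hB hγ.le q.1
          _ = _ := by
            rw [Finset.sum_const, Finset.card_univ, Fintype.card_fin, nsmul_eq_mul]; ring
      have h1 := (hcG q).le
      have h2 := abs_sub_abs_le_abs_sub (∑ i, score γ K x₀ h t q (Z i))
        (∑ i : Fin n, ∫ z, score γ K x₀ h t q z ∂(obsLawOne g (σ i) f))
      linarith
    · have h1 := le_sum_integral_hess hK hh hKh hg hσ hf hγ hc0 hc
        (fun x hx => (hB x hx).trans hBγ) w
      set E : ↥(multiIdx d b) → ↥(multiIdx d b) → ℝ := fun p q =>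
        ∑ i : Fin n, ∫ z, hess γ K x₀ h t p q z ∂(obsLawOne g (σ i) f)
      have hw1 : ∑ p, |w p| ≤ numIdx d b * √(∑ p, w p ^ 2) := by
        have := sum_abs_le_card_mul (w := w) (Real.sqrt_nonneg (∑ p, w p ^ 2))
          (Real.sq_sqrt (Finset.sum_nonneg fun p _ => sq_nonneg (w p))).symm
        rwa [card_multiIdx] at this
      have h2 : ∑ p, ∑ q, w p * w q * E p q - ∑ p, ∑ q, w p * w q *
          ∑ i, hess γ K x₀ h t p q (Z i) ≤ (n * h ^ d * η) * (∑ p, |w p|) ^ 2 := by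
        rw [sq, Finset.sum_mul_sum, Finset.mul_sum, ← Finset.sum_sub_distrib]
        refine Finset.sum_le_sum fun p _ => ?_
        rw [Finset.mul_sum, ← Finset.sum_sub_distrib]
        refine Finset.sum_le_sum fun q _ => (le_abs_self _).trans ?_
        rw [← mul_sub, abs_mul, abs_mul, mul_comm, abs_sub_comm]
        exact mul_le_mul_of_nonneg_right (hcH (p, q)).le (by positivity)
      have h3 : (∑ p, |w p|) ^ 2 ≤ (numIdx d b : ℝ) ^ 2 * ∑ p, w p ^ 2 := by
        calc (∑ p, |w p|) ^ 2 ≤ (numIdx d b * √(∑ p, w p ^ 2)) ^ 2 :=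
              pow_le_pow_left₀ (Finset.sum_nonneg fun _ _ => abs_nonneg _) hw1 2
          _ = _ := by
            rw [mul_pow, Real.sq_sqrt (Finset.sum_nonneg fun p _ => sq_nonneg (w p))]
      have h4 : (n * h ^ d * η) * (∑ p, |w p|) ^ 2 ≤
          n * h ^ d * (c * minEig d b K / 8 * ∑ p, w p ^ 2) := by
        have hS : 0 ≤ ∑ p, w p ^ 2 := Finset.sum_nonneg fun p _ => sq_nonneg (w p)
        calc (n * h ^ d * η) * (∑ p, |w p|) ^ 2
            ≤ (n * h ^ d * η) * ((numIdx d b : ℝ) ^ 2 * ∑ p, w p ^ 2) := by gcongr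
          _ = n * h ^ d * (((numIdx d b : ℝ) ^ 2 * η) * ∑ p, w p ^ 2) := by ring
          _ ≤ _ := by gcongr
      have h5 : n * h ^ d * (7 / 8 * c * minEig d b K * ∑ p, w p ^ 2) -
          n * h ^ d * (c * minEig d b K / 8 * ∑ p, w p ^ 2) =
          n * h ^ d * (3 / 4 * (c * minEig d b K) * ∑ p, w p ^ 2) := by ring
      linarith
  refine (measure_mono hsub).trans ((measure_union_le _ _).trans (add_le_add ?_ ?_))
  · refine (measure_iUnion_fintype_le _ _).trans ?_
    calc ∑ p, obsLaw g σ f n (G p) ≤ ∑ _p : ↥(multiIdx d b), ENNReal.ofReal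
          (2 * Real.exp (-(n * h ^ d * x ^ 2 / (4 * (γ ^ 2 * kerSup K))))) :=
          Finset.sum_le_sum fun p _ => measure_score_le hK hh hKh hg hf hn hγ hx hxγ t p
      _ = _ := by
          rw [Finset.sum_const, Finset.card_univ, card_multiIdx, nsmul_eq_mul]
  · refine (measure_iUnion_fintype_le _ _).trans ?_
    calc ∑ pq, obsLaw g σ f n (H pq) ≤ ∑ _pq : ↥(multiIdx d b) × ↥(multiIdx d b), ENNReal.ofReal
          (2 * Real.exp (-(n * h ^ d * η ^ 2 / (4 * kerSup K)))) :=
          Finset.sum_le_sum fun pq _ => measure_hess_le hK hh hKh hg hf hn hη hη1 t pq.1 pq.2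
      _ = _ := by
          rw [Finset.sum_const, Finset.card_univ, Fintype.card_prod, card_multiIdx, nsmul_eq_mul]
          push_cast; ring

end Tail

/-- If `f` is not measurable enough for the model to make sense, the law is degenerate. -/
lemma obsLaw_eq_zero {g : ℝ → ℝ} (hg : IsSymmDensity g) {σ : ℕ → ℝ} {f : (Fin d → ℝ) → ℝ}
    {i : Fin n} (hi : ¬AEMeasurable (obsMap (σ i) f) (designNoise d g)) :
    obsLaw g σ f n = 0 := by
  have := isProbabilityMeasure_designNoise d hg
  have : ∀ i : Fin n, IsFiniteMeasure (obsLawOne g (σ i) f) := fun i => by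
    rw [obsLawOne_eq]; infer_instance
  have h0 : obsLawOne g (σ i) f = 0 := by
    rw [obsLawOne_eq]; exact Measure.map_of_not_aemeasurable hi
  rw [← Measure.measure_univ_eq_zero, obsLaw, Measure.pi_univ]
  exact Finset.prod_eq_zero (Finset.mem_univ i) (by rw [h0]; simp)

end

noncomputable section

/-! ### Bandwidths and noise levels -/

variable {d b n : ℕ}

/-- The logarithmic weight `1 + l ln 2`. -/
def wt (l : ℕ) : ℝ := 1 + l * Real.log 2

lemma one_le_wt (l : ℕ) : 1 ≤ wt l := by
  have := Real.log_nonneg one_le_two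
  unfold wt; nlinarith [(Nat.cast_nonneg l : (0 : ℝ) ≤ l)]

lemma wt_mono {k l : ℕ} (h : k ≤ l) : wt k ≤ wt l := by
  have := Real.log_nonneg one_le_two
  unfold wt; gcongr

lemma wt_succ (l : ℕ) : wt (l + 1) = wt l + Real.log 2 := by
  unfold wt; push_cast; ring

lemma two_pow_eq_exp_wt (l : ℕ) : (2 : ℝ) ^ l = Real.exp (wt l - 1) := by
  rw [wt, add_sub_cancel_left, Real.exp_nat_mul, Real.exp_log two_pos]

lemma hMax_pos (hn : 0 < n) : 0 < hMax d b n :=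
  Real.rpow_pos_of_pos (by exact_mod_cast hn) _

lemma hMax_le_one (hn : 0 < n) : hMax d b n ≤ 1 :=
  Real.rpow_le_one_of_one_le_of_nonpos (by exact_mod_cast hn) (by rw [neg_nonpos]; positivity)

lemma bandwidth_pos (hn : 0 < n) (l : ℕ) : 0 < bandwidth d b n l :=
  div_pos (hMax_pos hn) (by positivity)

lemma bandwidth_anti (hn : 0 < n) {k l : ℕ} (h : k ≤ l) :
    bandwidth d b n l ≤ bandwidth d b n k := by
  have := hMax_pos (d := d) (b := b) hn
  unfold bandwidth
  gcongr
  exact one_le_two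

lemma bandwidth_le_hMax (hn : 0 < n) (l : ℕ) : bandwidth d b n l ≤ hMax d b n := by
  have := bandwidth_anti (d := d) (b := b) hn (Nat.zero_le l)
  simpa [bandwidth] using this

lemma bandwidth_mem (hn : 0 < n) (l : ℕ) : bandwidth d b n l ∈ Ioc (0 : ℝ) 1 :=
  ⟨bandwidth_pos hn l, (bandwidth_le_hMax hn l).trans (hMax_le_one hn)⟩

lemma noiseLevel_sq (hn : 0 < n) (l : ℕ) :
    noiseLevel d b n l ^ 2 = wt l / (n * bandwidth d b n l ^ d) := by
  have := bandwidth_pos (d := d) (b := b) hn l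
  have := one_le_wt l
  rw [noiseLevel, Real.sq_sqrt]
  · rfl
  · change 0 ≤ wt l / _
    positivity

lemma mul_noiseLevel_sq (hn : 0 < n) (l : ℕ) :
    n * bandwidth d b n l ^ d * noiseLevel d b n l ^ 2 = wt l := by
  have := bandwidth_pos (d := d) (b := b) hn l
  have : (0 : ℝ) < n := by exact_mod_cast hn
  rw [noiseLevel_sq hn, mul_div_cancel₀ _ (by positivity)]

lemma noiseLevel_nonneg (l : ℕ) : 0 ≤ noiseLevel d b n l := Real.sqrt_nonneg _

lemma noiseLevel_pos (hn : 0 < n) (l : ℕ) : 0 < noiseLevel d b n l := by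
  have := bandwidth_pos (d := d) (b := b) hn l
  have h1 := one_le_wt l
  have : (0 : ℝ) < n := by exact_mod_cast hn
  refine Real.sqrt_pos.2 ?_
  change 0 < wt l / _
  positivity

lemma noiseLevel_mono (hn : 0 < n) {k l : ℕ} (h : k ≤ l) :
    noiseLevel d b n k ≤ noiseLevel d b n l := by
  have := bandwidth_pos (d := d) (b := b) hn l
  have h1 := one_le_wt l
  have : (0 : ℝ) < n := by exact_mod_cast hn
  refine Real.sqrt_le_sqrt ?_
  change wt k / _ ≤ wt l / _
  have := wt_mono h
  have := bandwidth_anti (d := d) (b := b) hn h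
  gcongr

/-- Since `2 ^ l = exp (wt l - 1)`, the growth of the noise level and the tail probabilities can be
compared as exponentials in the same weight. -/
lemma noiseLevel_sq_eq (hn : 0 < n) (l : ℕ) :
    noiseLevel d b n l ^ 2 = wt l * Real.exp (d * (wt l - 1)) * noiseLevel d b n 0 ^ 2 := by
  have := hMax_pos (d := d) (b := b) hn
  have : (0 : ℝ) < n := by exact_mod_cast hn
  rw [noiseLevel_sq hn, noiseLevel_sq hn, Real.exp_nat_mul, ← two_pow_eq_exp_wt]
  simp only [bandwidth, div_pow, wt, Nat.cast_zero, zero_mul, add_zero, pow_zero, div_one]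
  field_simp

lemma log_hMax (hn : 0 < n) : Real.log (hMax d b n) = -(Real.log n / (2 * b + d)) := by
  rw [hMax, Real.log_rpow (by exact_mod_cast hn)]; ring

lemma log_hMin (hn : 0 < Real.log n) :
    Real.log (hMin d n) = 2 / d * Real.log (Real.log n) - Real.log n / d := by
  have hn0 : (n : ℝ) ≠ 0 := by rintro h; simp [h] at hn
  have : (0 : ℝ) < n := lt_of_le_of_ne (Nat.cast_nonneg n) hn0.symm
  rw [hMin, Real.log_mul (Real.rpow_pos_of_pos hn _).ne' (Real.rpow_pos_of_pos this _).ne',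
    Real.log_rpow hn, Real.log_rpow this]
  ring

lemma hMin_pos (hn : 0 < Real.log n) : 0 < hMin d n := by
  have hn0 : (n : ℝ) ≠ 0 := by rintro h; simp [h] at hn
  have : (0 : ℝ) < n := lt_of_le_of_ne (Nat.cast_nonneg n) hn0.symm
  exact mul_pos (Real.rpow_pos_of_pos hn _) (Real.rpow_pos_of_pos this _)

lemma log_bandwidth (hn : 0 < n) (l : ℕ) :
    Real.log (bandwidth d b n l) = -(Real.log n / (2 * b + d)) - (wt l - 1) := by
  rw [bandwidth, Real.log_div (hMax_pos hn).ne' (by positivity), log_hMax hn, Real.log_pow, wt]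
  ring

/-- The effective sample size at the smallest admissible bandwidth is `log² n`, against weights of
order at most `log n`; this gap makes all noise levels uniformly small. -/
lemma mul_hMin_pow (hd : 1 ≤ d) (hn : 0 < Real.log n) : n * hMin d n ^ d = Real.log n ^ 2 := by
  have hn0 : (n : ℝ) ≠ 0 := by rintro h; simp [h] at hn
  have hn1 : (0 : ℝ) < n := lt_of_le_of_ne (Nat.cast_nonneg n) hn0.symm
  have hd0 : (d : ℝ) ≠ 0 := by positivity
  rw [hMin, mul_pow, ← Real.rpow_natCast (_ ^ _) d, ← Real.rpow_natCast (_ ^ _) d,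
    ← Real.rpow_mul hn.le, ← Real.rpow_mul hn1.le, div_mul_cancel₀ _ hd0,
    neg_mul, div_mul_cancel₀ _ hd0, Real.rpow_neg_one, Real.rpow_two]
  field_simp

/-- `log log n` is negligible with respect to `log n`. -/
lemma eventually_log_log_le (A B : ℝ) {ε : ℝ} (hε : 0 < ε) :
    ∀ᶠ n : ℕ in atTop, A + B * Real.log (Real.log n) ≤ ε * Real.log n := by
  have ht : Tendsto (fun n : ℕ => Real.log n) atTop atTop :=
    Real.tendsto_log_atTop.comp tendsto_natCast_atTop_atTop
  have h1 : (fun x : ℝ => A + B * Real.log x) =o[atTop] (fun x : ℝ => x) := by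
    refine Asymptotics.IsLittleO.add ?_ ?_
    · exact Asymptotics.isLittleO_const_left.2 (Or.inr tendsto_norm_atTop_atTop)
    · exact Real.isLittleO_log_id_atTop.const_mul_left B
  filter_upwards [ht.eventually (h1.bound hε), ht.eventually_ge_atTop 0] with n hn hn0
  rw [Real.norm_eq_abs, Real.norm_eq_abs, abs_of_nonneg hn0] at hn
  exact (le_abs_self _).trans hn

lemma eventually_le_log (A : ℝ) : ∀ᶠ n : ℕ in atTop, A ≤ Real.log n :=
  (Real.tendsto_log_atTop.comp tendsto_natCast_atTop_atTop).eventually_ge_atTop A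

/-- For large `n`, the last bandwidth is the smallest one above `h_min`. -/
lemma eventually_lastIdx (hd : 1 ≤ d) (hb : 1 ≤ b) : ∀ᶠ n : ℕ in atTop,
    hMin d n ≤ bandwidth d b n (lastIdx d b n) ∧
      bandwidth d b n (lastIdx d b n + 1) < hMin d n := by
  have hd' : (0 : ℝ) < d := by exact_mod_cast hd
  have hb' : (0 : ℝ) < b := by exact_mod_cast hb
  filter_upwards [eventually_log_log_le 0 (2 / d)
    (by positivity : (0 : ℝ) < 2 * b / (d * (2 * b + d))), eventually_le_log 1,
    eventually_gt_atTop 0] with n h1 h2 hn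
  have hl : 0 < Real.log n := by linarith
  have hmin := hMin_pos (d := d) hl
  set S := {k : ℕ | hMin d n ≤ bandwidth d b n k} with hS
  have hmem0 : 0 ∈ S := by
    have : Real.log (hMin d n) ≤ Real.log (hMax d b n) := by
      rw [log_hMin hl, log_hMax hn]
      have e : 2 * (b : ℝ) / (d * (2 * b + d)) * Real.log n =
        Real.log n / d - Real.log n / (2 * b + d) := by field_simp; ring
      rw [e] at h1
      linarith
    rw [hS, mem_ofPred_eq, bandwidth, pow_zero, div_one]
    exact (Real.log_le_log_iff hmin (hMax_pos hn)).1 this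
  -- Boundedness, via `k < 2 ^ k`, makes `sSup` an attained maximum instead of the default value
  -- `0`.
  have hbdd : BddAbove S := by
    refine ⟨⌈hMax d b n / hMin d n⌉₊, fun k hk => ?_⟩
    have hk' : hMin d n ≤ hMax d b n / 2 ^ k := hk
    rw [le_div_iff₀ (by positivity)] at hk'
    have h3 : (k : ℝ) < 2 ^ k := by exact_mod_cast Nat.lt_two_pow_self
    have h4 : (k : ℝ) ≤ hMax d b n / hMin d n := by
      rw [le_div_iff₀ hmin]
      nlinarith
    exact_mod_cast h4.trans (Nat.le_ceil _)
  refine ⟨Nat.sSup_mem ⟨0, hmem0⟩ hbdd, ?_⟩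
  by_contra hcon
  have : lastIdx d b n + 1 ≤ lastIdx d b n := le_csSup hbdd (not_lt.1 hcon)
  omega

lemma log_sq_le_mul_bandwidth_pow (hd : 1 ≤ d) (hn : 0 < n) (hl : 0 < Real.log n)
    (hlast : hMin d n ≤ bandwidth d b n (lastIdx d b n)) {l : ℕ} (h : l ≤ lastIdx d b n) :
    Real.log n ^ 2 ≤ n * bandwidth d b n l ^ d := by
  rw [← mul_hMin_pow hd hl]
  have := hMin_pos (d := d) hl
  have := hlast.trans (bandwidth_anti hn h)
  gcongr

lemma wt_le_two_mul_log (hd : 1 ≤ d) (hn : 0 < n) (hl : 1 ≤ Real.log n)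
    (hlast : hMin d n ≤ bandwidth d b n (lastIdx d b n)) {l : ℕ} (h : l ≤ lastIdx d b n) :
    wt l ≤ 2 * Real.log n := by
  have hl0 : 0 < Real.log n := by linarith
  have hd' : (1 : ℝ) ≤ d := by exact_mod_cast hd
  have h1 := Real.log_le_log (hMin_pos (d := d) hl0) (hlast.trans (bandwidth_anti hn h))
  rw [log_hMin hl0, log_bandwidth hn] at h1
  have h2 : 0 ≤ 2 / (d : ℝ) * Real.log (Real.log n) :=
    mul_nonneg (by positivity) (Real.log_nonneg hl)
  have h3 : 0 ≤ Real.log n / (2 * b + d) := by positivity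
  have h4 : Real.log n / d ≤ Real.log n := div_le_self hl0.le hd'
  linarith

/-- Noise levels are uniformly small, and the effective sample size dominates the weights. -/
lemma eventually_noiseLevel_le (hd : 1 ≤ d) (hb : 1 ≤ b) {s₀ κ : ℝ} (hs₀ : 0 < s₀) (hκ : 0 < κ) :
    ∀ᶠ n : ℕ in atTop, ∀ l ≤ lastIdx d b n, noiseLevel d b n l ≤ s₀ ∧
      wt l ≤ κ * (n * bandwidth d b n l ^ d) := by
  filter_upwards [eventually_lastIdx hd hb, eventually_le_log 1, eventually_le_log (2 / s₀ ^ 2),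
    eventually_le_log (2 / κ), eventually_gt_atTop 0] with n h1 h2 h3 h4 hn l hl
  have hl0 : 0 < Real.log n := by linarith
  have hw := wt_le_two_mul_log hd hn h2 h1.1 hl
  have hs := log_sq_le_mul_bandwidth_pow hd hn hl0 h1.1 hl
  constructor
  · refine abs_le_of_sq_le_sq' ?_ hs₀.le |>.2
    rw [noiseLevel_sq hn]
    rw [div_le_iff₀ (by positivity)] at h3
    calc wt l / (n * bandwidth d b n l ^ d) ≤ 2 * Real.log n / Real.log n ^ 2 := by gcongr
      _ ≤ s₀ ^ 2 := by
        rw [div_le_iff₀ (by positivity)]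
        nlinarith
  · rw [div_le_iff₀ hκ] at h4
    calc wt l ≤ 2 * Real.log n := hw
      _ ≤ κ * Real.log n ^ 2 := by nlinarith
      _ ≤ _ := by gcongr

lemma eventually_hMax_le {h₀ : ℝ} (hd : 1 ≤ d) (h0 : 0 < h₀) :
    ∀ᶠ n : ℕ in atTop, hMax d b n ≤ h₀ := by
  have hd' : (0 : ℝ) < d := by exact_mod_cast hd
  filter_upwards [eventually_le_log (-Real.log h₀ * (2 * b + d)), eventually_gt_atTop 0]
    with n h1 hn
  refine (Real.log_le_log_iff (hMax_pos hn) h0).1 ?_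
  rw [log_hMax hn]
  have : -Real.log h₀ ≤ Real.log n / (2 * b + d) := by rwa [le_div_iff₀ (by positivity)]
  linarith

/-- At the last bandwidth the bias is dominated by the noise level. -/
lemma eventually_bias_le (hd : 1 ≤ d) (hb : 1 ≤ b) {β L : ℝ} (hβ : 0 < β) (hL : 0 < L) :
    ∀ᶠ n : ℕ in atTop, L * (d * bandwidth d b n (lastIdx d b n) / 2) ^ β ≤
      noiseLevel d b n (lastIdx d b n) / 2 := by
  have hd' : (0 : ℝ) < d := by exact_mod_cast hd
  filter_upwards [eventually_lastIdx hd hb, eventually_le_log 1, eventually_gt_atTop 0,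
    eventually_log_log_le (Real.log (L * d ^ β) + (1 + d / 2) * Real.log 2) (β * (2 / d) + 1)
      (by positivity : 0 < β / d)] with n h1 h2 hn h3
  have hl : 0 < Real.log n := by linarith
  have hmin := hMin_pos (d := d) hl
  have hn' : (0 : ℝ) < n := by exact_mod_cast hn
  set h := bandwidth d b n (lastIdx d b n) with hh
  have hpos : 0 < h := bandwidth_pos hn _
  -- Maximality of the last index places `h` within a factor `2` of `h_min`. Up to logarithms the
  -- bias is then at most of order `n ^ (-β/d)`, while the noise level is at least of order `1 / log
  -- n`.
  have h2m : h / 2 ≤ hMin d n := by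
    have : bandwidth d b n (lastIdx d b n + 1) = h / 2 := by
      rw [hh, bandwidth, bandwidth, pow_succ]; field_simp
    rw [← this]; exact h1.2.le
  have hS : 0 < noiseLevel d b n (lastIdx d b n) := noiseLevel_pos hn _
  have hlogh : Real.log (h / 2) ≤ Real.log (hMin d n) := Real.log_le_log (by positivity) h2m
  have hlogS : Real.log (noiseLevel d b n (lastIdx d b n)) ≥
      -(d / 2 * Real.log 2) - Real.log (Real.log n) := by
    have e1 : 2 * Real.log (noiseLevel d b n (lastIdx d b n)) =
        Real.log (noiseLevel d b n (lastIdx d b n) ^ 2) := by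
      rw [Real.log_pow]; norm_num
    have e2 : 1 / (2 ^ d * Real.log n ^ 2) ≤ noiseLevel d b n (lastIdx d b n) ^ 2 := by
      rw [noiseLevel_sq hn]
      have e3 : n * h ^ d ≤ 2 ^ d * Real.log n ^ 2 := by
        rw [← mul_hMin_pow hd hl]
        calc n * h ^ d = 2 ^ d * (n * (h / 2) ^ d) := by rw [div_pow]; field_simp
          _ ≤ _ := by gcongr
      have := one_le_wt (lastIdx d b n)
      gcongr
    have e4 := Real.log_le_log (by positivity) e2
    rw [one_div, Real.log_inv, Real.log_mul (by positivity) (by positivity), Real.log_pow,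
      Real.log_pow, ← e1] at e4
    push_cast at e4
    linarith
  refine (Real.log_le_log_iff (by positivity) (by positivity)).1 ?_
  have e5 : d * h / 2 = d * (h / 2) := by ring
  rw [e5, Real.mul_rpow hd'.le (by positivity), ← mul_assoc,
    Real.log_mul (by positivity) (by positivity), Real.log_rpow (by positivity),
    Real.log_div hS.ne' two_ne_zero]
  rw [log_hMin hl] at hlogh
  have e6 := mul_le_mul_of_nonneg_left hlogh hβ.le
  have e7 : β * (2 / d * Real.log (Real.log n) - Real.log n / d) =
    β * (2 / d) * Real.log (Real.log n) - β / d * Real.log n := by ring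
  rw [e7] at e6
  linarith

/-- The probability of failure at the last bandwidth is negligible. -/
lemma eventually_exp_wt_lastIdx_le (hd : 1 ≤ d) (hb : 1 ≤ b) {r : ℝ} (hr : 1 ≤ r) :
    ∀ᶠ n : ℕ in atTop, Real.exp (-(9 / 16 * (r * d) * wt (lastIdx d b n))) ≤
      noiseLevel d b n 0 ^ r := by
  have hd' : (0 : ℝ) < d := by exact_mod_cast hd
  have hb' : (0 : ℝ) < b := by exact_mod_cast hb
  filter_upwards [eventually_lastIdx hd hb, eventually_le_log 1, eventually_gt_atTop 0,
    eventually_log_log_le 0 9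
      (by positivity : (0 : ℝ) < b / (2 * b + d))] with n h1 h2 hn h3
  have hl : 0 < Real.log n := by linarith
  have hS : 0 < noiseLevel d b n 0 := noiseLevel_pos hn _
  rw [← Real.le_log_iff_exp_le (by positivity), Real.log_rpow hS]
  have hlogS : Real.log (noiseLevel d b n 0) = -(b / (2 * b + d) * Real.log n) := by
    have e1 : 2 * Real.log (noiseLevel d b n 0) = Real.log (noiseLevel d b n 0 ^ 2) := by
      rw [Real.log_pow]; norm_num
    have hn' : (0 : ℝ) < n := by exact_mod_cast hn
    have := bandwidth_pos (d := d) (b := b) hn 0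
    rw [noiseLevel_sq hn, Real.log_div (by have := one_le_wt 0; positivity) (by positivity),
      Real.log_mul (by positivity) (by positivity), Real.log_pow, log_bandwidth hn] at e1
    simp only [wt, Nat.cast_zero, zero_mul, add_zero, Real.log_one, sub_self] at e1
    field_simp at e1 ⊢
    linarith
  have hw := Real.log_le_log (bandwidth_pos hn _) h1.2.le
  rw [log_bandwidth hn, log_hMin hl, wt_succ] at hw
  have hlog2 : Real.log 2 ≤ 1 := by linarith [Real.log_two_lt_d9]
  have hw2 : Real.log n / d - Real.log n / (2 * b + d) - 2 / d * Real.log (Real.log n) ≤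
      wt (lastIdx d b n) := by linarith
  have e : Real.log n / d - Real.log n / (2 * b + d) =
      2 / d * (b / (2 * b + d) * Real.log n) := by field_simp; ring
  rw [e, ← mul_sub] at hw2
  rw [hlogS]
  set X := (b : ℝ) / (2 * b + d) * Real.log n
  set Y := Real.log (Real.log n)
  have h5 : 9 / 16 * (r * d) * (2 / d * (X - Y)) ≤ 9 / 16 * (r * d) * wt (lastIdx d b n) :=
    mul_le_mul_of_nonneg_left hw2 (by positivity)
  have h6 : 9 / 16 * (r * d) * (2 / d * (X - Y)) = r * (9 / 8 * X - 9 / 8 * Y) := by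
    field_simp; ring
  rw [h6] at h5
  -- The tail exponent gives `2 · 9/16 = 9/8`, and the excess `1/8` over the needed `X` pays for the
  -- double logarithm `Y`.
  have h7 : r * X ≤ r * (9 / 8 * X - 9 / 8 * Y) :=
    mul_le_mul_of_nonneg_left (by linarith) (by linarith)
  linarith

/-! ### The adaptive rate -/

lemma one_le_price (hd : 1 ≤ d) {β : ℝ} (hβ : 0 < β) (hβb : β ≤ b) (hl : 0 ≤ Real.log n) :
    1 ≤ price d b n β := by
  have : 0 ≤ 2 * ((b : ℝ) - β) / ((2 * β + d) * (2 * (b : ℝ) + d)) * Real.log n := by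
    have := sub_nonneg.2 hβb
    exact mul_nonneg (by positivity) hl
  unfold price; linarith

lemma adaptiveRate_pos (hd : 1 ≤ d) {β : ℝ} (hβ : 0 < β) (hβb : β ≤ b) (hn : 0 < n)
    (hl : 0 ≤ Real.log n) : 0 < adaptiveRate d b n β := by
  have := one_le_price hd hβ hβb hl
  have hn' : (0 : ℝ) < n := by exact_mod_cast hn
  exact Real.rpow_pos_of_pos (by positivity) _

lemma noiseLevel_zero (hd : 1 ≤ d) (hn : 0 < n) :
    noiseLevel d b n 0 = (n : ℝ) ^ (-(b / (2 * b + d)) : ℝ) := by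
  have hn' : (0 : ℝ) < n := by exact_mod_cast hn
  have hd' : (0 : ℝ) < d := by exact_mod_cast hd
  refine (sq_eq_sq₀ (noiseLevel_nonneg _) (by positivity)).1 ?_
  rw [noiseLevel_sq hn]
  simp only [wt, bandwidth, hMax, Nat.cast_zero, zero_mul, add_zero, pow_zero, div_one]
  rw [← Real.rpow_natCast _ d, ← Real.rpow_mul hn'.le, ← Real.rpow_natCast _ 2,
    ← Real.rpow_mul hn'.le]
  have : (n : ℝ) * (n : ℝ) ^ (-(1 / (2 * (b : ℝ) + d)) * (d : ℝ)) =
      (n : ℝ) ^ (1 + -(1 / (2 * (b : ℝ) + d)) * (d : ℝ)) := by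
    rw [Real.rpow_add hn', Real.rpow_one]
  rw [this, one_div, ← Real.rpow_neg hn'.le]
  congr 1
  push_cast
  field_simp
  ring

/-- The exponent `β / (2β + d)` increases with `β` and the price is at least `1`, so the noise level
at `h_max`, the rate for smoothness `b`, is the smallest one. -/
lemma noiseLevel_zero_le_adaptiveRate (hd : 1 ≤ d) {β : ℝ} (hβ : 0 < β) (hβb : β ≤ b)
    (hn : 0 < n) (hl : 0 ≤ Real.log n) : noiseLevel d b n 0 ≤ adaptiveRate d b n β := by
  have hn' : (0 : ℝ) < n := by exact_mod_cast hn
  have hn1 : (1 : ℝ) ≤ n := by exact_mod_cast hn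
  have hd' : (0 : ℝ) < d := by exact_mod_cast hd
  have hp := one_le_price hd hβ hβb hl
  rw [noiseLevel_zero hd hn]
  calc (n : ℝ) ^ (-(b / (2 * b + d)) : ℝ) ≤ (n : ℝ) ^ (-(β / (2 * β + d))) := by
        refine Real.rpow_le_rpow_of_exponent_le hn1 (neg_le_neg ?_)
        rw [div_le_div_iff₀ (by positivity) (by positivity)]
        nlinarith
    _ = (1 / (n : ℝ)) ^ (β / (2 * β + d)) := by
        rw [one_div, Real.inv_rpow hn'.le, Real.rpow_neg hn'.le]
    _ ≤ _ := by
        unfold adaptiveRate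
        gcongr

/-- A noise level dominated by the bias is of the order of the adaptive rate. -/
lemma noiseLevel_le_of_le_bias (hd : 1 ≤ d) {β : ℝ} (hβ : 0 < β) (hβb : β ≤ b)
    (hn : 0 < n) (hl : 0 ≤ Real.log n) {B : ℝ} (hB : 1 ≤ B) {j : ℕ}
    (hj : noiseLevel d b n j ≤ B * bandwidth d b n j ^ β) :
    noiseLevel d b n j ≤
      ((1 + 2 * Real.log B) * B ^ (d / β)) ^ (β / (2 * β + d)) * adaptiveRate d b n β := by
  have hn' : (0 : ℝ) < n := by exact_mod_cast hn
  have hd' : (1 : ℝ) ≤ d := by exact_mod_cast hd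
  have hp := one_le_price hd hβ hβb hl
  have hlB := Real.log_nonneg hB
  set S := noiseLevel d b n j with hS
  set h := bandwidth d b n j with hh
  have hS0 : 0 < S := noiseLevel_pos hn j
  have hh0 : 0 < h := bandwidth_pos hn j
  have hw1 := one_le_wt j
  have hmul : n * h ^ d * S ^ 2 = wt j := mul_noiseLevel_sq hn j
  have hlogS : Real.log S ≤ Real.log B + β * Real.log h := by
    have := Real.log_le_log hS0 hj
    rwa [Real.log_mul (by positivity) (by positivity), Real.log_rpow hh0] at this
  have hlogw : 0 ≤ Real.log n + d * Real.log h + 2 * Real.log S := by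
    have e : Real.log (n * h ^ d * S ^ 2) = Real.log n + d * Real.log h + 2 * Real.log S := by
      rw [Real.log_mul (by positivity) (by positivity), Real.log_mul (by positivity)
        (by positivity), Real.log_pow, Real.log_pow]
      norm_num
    rw [← e, hmul]
    exact Real.log_nonneg hw1
  have hlogh : Real.log h = -(Real.log n / (2 * b + d)) - (wt j - 1) := log_bandwidth hn j
  -- Inserting the bias bound into `n h ^ d S² = wt j ≥ 1` gives `-log h ≤ (log n + 2 log B) / (2β +
  -- d)`. Subtracting `log n / (2b + d)` and adding `1` produces the price, up to a constant.
  have hwle : wt j ≤ (1 + 2 * Real.log B) * price d b n β := by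
    have e1 : -Real.log h ≤ (Real.log n + 2 * Real.log B) / (2 * β + d) := by
      rw [le_div_iff₀ (by positivity)]
      nlinarith
    have e2 : (Real.log n + 2 * Real.log B) / (2 * β + d) - Real.log n / (2 * b + d) + 1 =
        price d b n β + 2 * Real.log B / (2 * β + d) := by
      unfold price; field_simp; ring
    have e3 : 2 * Real.log B / (2 * β + d) ≤ 2 * Real.log B :=
      div_le_self (by positivity) (by linarith)
    nlinarith
  have hSh : (S / B) ^ (d / β) ≤ h ^ d := by
    have e1 : S / B ≤ h ^ β := by rw [div_le_iff₀ (by positivity), mul_comm]; exact hj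
    calc (S / B) ^ (d / β) ≤ (h ^ β) ^ (d / β) :=
          Real.rpow_le_rpow (by positivity) e1 (by positivity)
      _ = h ^ d := by
          rw [← Real.rpow_mul hh0.le, mul_div_cancel₀ _ hβ.ne', Real.rpow_natCast]
  -- Write the power as `S ^ (d/β) * S²`, trade `S ^ (d/β)` for `h ^ d` through the bias bound, and
  -- use `h ^ d S² = wt j / n`.
  have hkey : S ^ ((2 * β + d) / β) ≤ (1 + 2 * Real.log B) * B ^ (d / β) *
      (price d b n β / n) := by
    have e1 : S ^ ((2 * β + d) / β) = S ^ (d / β) * S ^ 2 := by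
      rw [← Real.rpow_natCast S 2, ← Real.rpow_add hS0]
      congr 1; push_cast; field_simp; ring
    have e2 : S ^ (d / β) = B ^ (d / β) * (S / B) ^ (d / β) := by
      rw [← Real.mul_rpow (by positivity) (by positivity)]
      congr 1; field_simp
    have e3 : h ^ d * S ^ 2 ≤ (1 + 2 * Real.log B) * (price d b n β / n) := by
      rw [← mul_div_assoc, le_div_iff₀ hn']
      linarith
    calc S ^ ((2 * β + d) / β) = B ^ (d / β) * ((S / B) ^ (d / β) * S ^ 2) := by
          rw [e1, e2]; ring
      _ ≤ B ^ (d / β) * (h ^ d * S ^ 2) := by gcongr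
      _ ≤ B ^ (d / β) * ((1 + 2 * Real.log B) * (price d b n β / n)) := by gcongr
      _ = _ := by ring
  have hfin := Real.rpow_le_rpow (by positivity) hkey (by positivity : 0 ≤ β / (2 * β + d))
  rw [← Real.rpow_mul hS0.le, Real.mul_rpow (by positivity) (by positivity)] at hfin
  have e : (2 * β + d) / β * (β / (2 * β + d)) = 1 := by field_simp
  rwa [e, Real.rpow_one] at hfin

/-- The ideal index, from which on the bias is dominated by the noise level. -/
def idealIdx (d b n : ℕ) (β L : ℝ) : ℕ :=
  sInf {k | L * (d * bandwidth d b n k / 2) ^ β ≤ noiseLevel d b n k / 2}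

/-- Along the grid the bias falls and the noise level rises, so domination persists. The index `k₀`
only witnesses that the infimum is over a nonempty set. -/
lemma bias_le_of_idealIdx_le (hn : 0 < n) {β L : ℝ} (hβ : 0 < β) (hL : 0 < L) {k₀ : ℕ}
    (hk₀ : L * (d * bandwidth d b n k₀ / 2) ^ β ≤ noiseLevel d b n k₀ / 2) {k : ℕ}
    (hk : idealIdx d b n β L ≤ k) :
    L * (d * bandwidth d b n k / 2) ^ β ≤ noiseLevel d b n k / 2 := by
  have hmem : idealIdx d b n β L ∈ {k | L * (d * bandwidth d b n k / 2) ^ β ≤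
    noiseLevel d b n k / 2} := Nat.sInf_mem ⟨k₀, hk₀⟩
  have h1 := bandwidth_anti (d := d) (b := b) hn hk
  have h2 := noiseLevel_mono (d := d) (b := b) hn hk
  have h3 := bandwidth_pos (d := d) (b := b) hn k
  calc L * (d * bandwidth d b n k / 2) ^ β
      ≤ L * (d * bandwidth d b n (idealIdx d b n β L) / 2) ^ β := by gcongr
    _ ≤ noiseLevel d b n (idealIdx d b n β L) / 2 := hmem
    _ ≤ _ := by linarith

/-- Halving the bandwidth multiplies the square by at most `2 ^ d` from the volume and `2` from the
weight; the square root of this factor is not taken. -/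
lemma noiseLevel_succ_le (hn : 0 < n) (j : ℕ) :
    noiseLevel d b n (j + 1) ≤ 2 ^ (d + 1) * noiseLevel d b n j := by
  refine abs_le_of_sq_le_sq' ?_ (mul_nonneg (by positivity) (noiseLevel_nonneg j)) |>.2
  have h1 := one_le_wt j
  have hlog2 : Real.log 2 ≤ 1 := by linarith [Real.log_two_lt_d9]
  have e1 : Real.exp (d * (wt (j + 1) - 1)) = 2 ^ d * Real.exp (d * (wt j - 1)) := by
    have : (d : ℝ) * (wt (j + 1) - 1) = d * Real.log 2 + d * (wt j - 1) := by rw [wt_succ]; ring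
    rw [this, Real.exp_add, Real.exp_nat_mul, Real.exp_log two_pos]
  have e2 : wt (j + 1) ≤ 2 * wt j := by rw [wt_succ]; linarith
  rw [mul_pow, noiseLevel_sq_eq hn (j + 1), noiseLevel_sq_eq hn j, e1]
  set S := noiseLevel d b n 0 ^ 2 with hS
  have hS0 : 0 ≤ S := sq_nonneg _
  have h2 : (1 : ℝ) ≤ 2 ^ (d + 1) := one_le_pow₀ one_le_two
  calc wt (j + 1) * (2 ^ d * Real.exp (d * (wt j - 1))) * S
      ≤ (2 * wt j) * (2 ^ d * Real.exp (d * (wt j - 1))) * S := by gcongr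
    _ = 2 ^ (d + 1) * (wt j * Real.exp (d * (wt j - 1)) * S) := by rw [pow_succ]; ring
    _ ≤ (2 ^ (d + 1)) ^ 2 * (wt j * Real.exp (d * (wt j - 1)) * S) := by
        gcongr
        nlinarith

/-- The noise level at the ideal index is of the order of the adaptive rate. -/
lemma noiseLevel_idealIdx_le (hd : 1 ≤ d) {β L : ℝ} (hβ : 0 < β) (hβb : β ≤ b) (hL : 0 < L) :
    ∃ A : ℝ, 0 < A ∧ ∀ n : ℕ, 0 < n → 0 ≤ Real.log n →
      noiseLevel d b n (idealIdx d b n β L) ≤ A * adaptiveRate d b n β := by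
  have hd' : (0 : ℝ) < d := by exact_mod_cast hd
  have hL0 : 0 ≤ L := hL.le
  set B := max 1 (2 * (L * (d / 2) ^ β)) with hB
  have hB1 : 1 ≤ B := le_max_left _ _
  have hlB := Real.log_nonneg hB1
  set A₀ := ((1 + 2 * Real.log B) * B ^ (d / β)) ^ (β / (2 * β + d)) with hA₀
  have hA₀pos : 0 < A₀ := by positivity
  refine ⟨1 + 2 ^ (d + 1) * A₀, by positivity, fun n hn hl => ?_⟩
  have hφ := adaptiveRate_pos hd hβ hβb hn hl
  rcases Nat.eq_zero_or_eq_succ_pred (idealIdx d b n β L) with h0 | h0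
  · rw [h0]
    refine (noiseLevel_zero_le_adaptiveRate hd hβ hβb hn hl).trans ?_
    exact le_mul_of_one_le_left hφ.le (by linarith [mul_pos (pow_pos two_pos (d + 1)) hA₀pos])
  · set j := (idealIdx d b n β L).pred with hj
    -- By minimality the bias still dominates one step before the ideal index; index `0` has no
    -- predecessor and was treated apart.
    have hnot : ¬ (L * (d * bandwidth d b n j / 2) ^ β ≤ noiseLevel d b n j / 2) := by
      intro hmem
      have : idealIdx d b n β L ≤ j := Nat.sInf_le hmem
      omega
    rw [not_le] at hnot
    have hh := bandwidth_pos (d := d) (b := b) hn j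
    have hSj : noiseLevel d b n j ≤ B * bandwidth d b n j ^ β := by
      have e : (d : ℝ) * bandwidth d b n j / 2 = d / 2 * bandwidth d b n j := by ring
      rw [e, Real.mul_rpow (by positivity) hh.le] at hnot
      calc noiseLevel d b n j ≤ (2 * (L * (d / 2) ^ β)) * bandwidth d b n j ^ β := by linarith
        _ ≤ _ := by gcongr; exact le_max_right _ _
    have h1 := noiseLevel_le_of_le_bias hd hβ hβb hn hl hB1 hSj
    rw [h0]
    calc noiseLevel d b n (j + 1) ≤ 2 ^ (d + 1) * noiseLevel d b n j := noiseLevel_succ_le hn j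
      _ ≤ 2 ^ (d + 1) * (A₀ * adaptiveRate d b n β) := by gcongr
      _ ≤ _ := by nlinarith

/-- Summability of the contributions of the failures at the intermediate bandwidths. -/
lemma sum_noiseLevel_rpow_mul_exp_le (hd : 1 ≤ d) {r : ℝ} (hr : 1 ≤ r) :
    ∃ A : ℝ, 0 < A ∧ ∀ n : ℕ, 0 < n → ∀ k m : ℕ,
      ∑ j ∈ Finset.Ico k m, noiseLevel d b n (j + 1) ^ r *
        Real.exp (-(9 / 16 * (r * d) * wt j)) ≤ A * noiseLevel d b n 0 ^ r := by
  have hd' : (1 : ℝ) ≤ d := by exact_mod_cast hd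
  have hlog2 : Real.log 2 ≤ 1 := by linarith [Real.log_two_lt_d9]
  have hlog2' : 0 < Real.log 2 := Real.log_pos one_lt_two
  set ρ := Real.exp (-(Real.log 2 / 32)) with hρ
  have hρ1 : ρ < 1 := by rw [hρ, Real.exp_lt_one_iff]; linarith
  set A₀ := (16 : ℝ) ^ (r / 2) * Real.exp (r * d) with hA₀
  have hA₀pos : 0 < A₀ := by positivity
  refine ⟨A₀ * (1 - ρ)⁻¹, mul_pos hA₀pos (inv_pos.2 (by linarith)), fun n hn k m => ?_⟩
  have hS0 := noiseLevel_nonneg (d := d) (b := b) (n := n) 0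
  have hterm : ∀ j, noiseLevel d b n (j + 1) ^ r * Real.exp (-(9 / 16 * (r * d) * wt j)) ≤
      A₀ * noiseLevel d b n 0 ^ r * ρ ^ j := by
    intro j
    have hw := one_le_wt (j + 1)
    have hwj := one_le_wt j
    have e1 : ∀ l, noiseLevel d b n l ^ r = (noiseLevel d b n l ^ 2) ^ (r / 2) := fun l => by
      rw [← Real.rpow_natCast _ 2, ← Real.rpow_mul (noiseLevel_nonneg _)]
      congr 1; push_cast; ring
    have e2 : wt (j + 1) ≤ 16 * Real.exp (wt (j + 1) / 16) := by
      have := Real.add_one_le_exp (wt (j + 1) / 16)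
      linarith
    have e3 : noiseLevel d b n (j + 1) ^ r ≤ (16 : ℝ) ^ (r / 2) *
        Real.exp ((wt (j + 1) / 16 + d * (wt (j + 1) - 1)) * (r / 2)) * noiseLevel d b n 0 ^ r := by
      have e5 : Real.exp ((wt (j + 1) / 16 + d * (wt (j + 1) - 1)) * (r / 2)) =
          (Real.exp (wt (j + 1) / 16) * Real.exp (d * (wt (j + 1) - 1))) ^ (r / 2) := by
        rw [← Real.exp_add, ← Real.exp_mul]
      rw [e1, e1 0, noiseLevel_sq_eq hn (j + 1), e5,
        ← Real.mul_rpow (by positivity) (by positivity),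
        ← Real.mul_rpow (by positivity) (by positivity), ← mul_assoc]
      gcongr
    -- In units of `r d wt`, the growth of the noise level uses `1/2` of the available `9/16`, the
    -- polynomial factor `wt ^ (r/2)` uses `1/32`, and the remaining `1/32` gives the geometric
    -- decay.
    have e4 : (wt (j + 1) / 16 + d * (wt (j + 1) - 1)) * (r / 2) - 9 / 16 * (r * d) * wt j ≤
        r * d - Real.log 2 / 32 * j := by
      have hj : wt j = 1 + j * Real.log 2 := rfl
      rw [wt_succ]
      have hrd : 1 ≤ r * d := by nlinarith
      have hrr : r ≤ r * d := le_mul_of_one_le_right (by linarith) hd'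
      have f1 : (wt j + Real.log 2) / 16 * (r / 2) ≤ (wt j + 1) / 32 * (r * d) := by
        nlinarith
      have f2 : d * (wt j + Real.log 2 - 1) * (r / 2) ≤ r * d * wt j / 2 := by
        nlinarith
      have f3 : Real.log 2 / 32 * j ≤ (wt j) / 32 * (r * d) := by
        nlinarith
      nlinarith
    calc noiseLevel d b n (j + 1) ^ r * Real.exp (-(9 / 16 * (r * d) * wt j))
        ≤ (16 : ℝ) ^ (r / 2) *
        Real.exp ((wt (j + 1) / 16 + d * (wt (j + 1) - 1)) * (r / 2)) * noiseLevel d b n 0 ^ r *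
          Real.exp (-(9 / 16 * (r * d) * wt j)) := by gcongr
      _ = (16 : ℝ) ^ (r / 2) * noiseLevel d b n 0 ^ r *
          Real.exp ((wt (j + 1) / 16 + d * (wt (j + 1) - 1)) * (r / 2) -
            9 / 16 * (r * d) * wt j) := by
          rw [sub_eq_add_neg _ (9 / 16 * (r * (d : ℝ)) * wt j), Real.exp_add]; ring
      _ ≤ (16 : ℝ) ^ (r / 2) * noiseLevel d b n 0 ^ r *
          Real.exp (r * d - Real.log 2 / 32 * j) := by gcongr
      _ = _ := by
          rw [sub_eq_add_neg, Real.exp_add, hA₀, hρ, ← Real.exp_nat_mul]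
          rw [show -(Real.log 2 / 32 * (j : ℝ)) = j * -(Real.log 2 / 32) by ring]
          ring
  calc ∑ j ∈ Finset.Ico k m, noiseLevel d b n (j + 1) ^ r *
        Real.exp (-(9 / 16 * (r * d) * wt j))
      ≤ ∑ j ∈ Finset.Ico k m, A₀ * noiseLevel d b n 0 ^ r * ρ ^ j :=
        Finset.sum_le_sum fun j _ => hterm j
    _ = A₀ * noiseLevel d b n 0 ^ r * ∑ j ∈ Finset.Ico k m, ρ ^ j := by rw [Finset.mul_sum]
    _ ≤ A₀ * noiseLevel d b n 0 ^ r * (1 - ρ)⁻¹ := by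
        gcongr
        have hρ0 : 0 ≤ ρ := (Real.exp_pos _).le
        rw [← tsum_geometric_of_lt_one hρ0 hρ1]
        exact (summable_geometric_of_lt_one hρ0 hρ1).sum_le_tsum _ fun _ _ => by positivity
    _ = _ := by ring

end

noncomputable section

/-! ### Lepski's selection rule -/

section Lepski

variable {d b n : ℕ} {θ : (n : ℕ) → ℝ → Sample d n → Coef d b}

/-- If all estimators from `J` on are accurate, the selected one is as accurate as the `J`-th. -/
lemma abs_lepskiEst_sub_le {C : ℝ} (hC : 0 ≤ C) (hn : 0 < n) {Z : Sample d n} {a : ℝ} {J : ℕ}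
    (hJ : J ≤ lastIdx d b n) (hall : ∀ l, J ≤ l → l ≤ lastIdx d b n →
      |lpa θ l Z - a| ≤ C / 2 * noiseLevel d b n l) :
    |lepskiEst C θ n Z - a| ≤ 3 / 2 * C * noiseLevel d b n J := by
  have hSJ := noiseLevel_nonneg (d := d) (b := b) (n := n) J
  -- Two errors of at most `C/2` noise levels add up to the allowed `C`, so `J` passes every
  -- comparison and the selected index is at most `J`.
  have hJmem : J ∈ {k : ℕ | k ≤ lastIdx d b n ∧ ∀ l, k + 1 ≤ l → l ≤ lastIdx d b n →
      |lpa θ k Z - lpa θ l Z| ≤ C * noiseLevel d b n l} := by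
    refine ⟨hJ, fun l hl hl' => ?_⟩
    have h1 := hall J le_rfl hJ
    have h2 := hall l (by omega) hl'
    have h3 := noiseLevel_mono (d := d) (b := b) hn (by omega : J ≤ l)
    have h4 : C / 2 * noiseLevel d b n J ≤ C / 2 * noiseLevel d b n l := by gcongr
    have h5 := abs_sub_le (lpa θ J Z) a (lpa θ l Z)
    rw [abs_sub_comm a] at h5
    linarith
  have hmem := Nat.sInf_mem ⟨J, hJmem⟩
  have hle := Nat.sInf_le hJmem
  have h1 := hall J le_rfl hJ
  change |lpa θ (selIdx C θ Z) Z - a| ≤ _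
  rcases hle.lt_or_eq with hlt | heq
  · have h2 : |lpa θ (selIdx C θ Z) Z - lpa θ J Z| ≤ C * noiseLevel d b n J :=
      hmem.2 J hlt hJ
    have h3 := abs_sub_le (lpa θ (selIdx C θ Z) Z) (lpa θ J Z) a
    linarith
  · have : selIdx C θ Z = J := heq
    rw [this]
    have : 0 ≤ C * noiseLevel d b n J := by positivity
    linarith

/-- Risk decomposition along the last bandwidth whose estimator is inaccurate. -/
lemma lintegral_lepskiEst_le {C : ℝ} (hC : 0 ≤ C) (hn : 0 < n) {μ : Measure (Sample d n)}
    (hμ : μ univ ≤ 1) (hθ : ∀ k, Measurable (lpa θ k : Sample d n → ℝ)) {a M r : ℝ} (hr : 0 ≤ r)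
    (hM : ∀ Z : Sample d n, |lepskiEst C θ n Z - a| ≤ 2 * M) {k : ℕ} (hk : k ≤ lastIdx d b n)
    {D A : ℝ} (hD : 0 ≤ D)
    (htail : ∀ l, k ≤ l → l ≤ lastIdx d b n →
      μ {Z | C / 2 * noiseLevel d b n l < |lpa θ l Z - a|} ≤
        ENNReal.ofReal (D * Real.exp (-(A * wt l)))) :
    ∫⁻ Z, ENNReal.ofReal (|lepskiEst C θ n Z - a| ^ r) ∂μ ≤
      ENNReal.ofReal ((3 / 2 * C * noiseLevel d b n k) ^ r +
        D * (3 / 2 * C) ^ r * ∑ j ∈ Finset.Ico k (lastIdx d b n),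
          noiseLevel d b n (j + 1) ^ r * Real.exp (-(A * wt j)) +
        D * (2 * M) ^ r * Real.exp (-(A * wt (lastIdx d b n)))) := by
  set N := lastIdx d b n with hN
  have hS := fun l => noiseLevel_nonneg (d := d) (b := b) (n := n) l
  set E : ℕ → Set (Sample d n) := fun l =>
    {Z | C / 2 * noiseLevel d b n l < |lpa θ l Z - a|} with hE
  have hEm : ∀ l, MeasurableSet (E l) := fun l =>
    measurableSet_lt measurable_const (continuous_abs.measurable.comp ((hθ l).sub_const a))
  set Y : ℕ → ENNReal := fun j => ENNReal.ofReal ((3 / 2 * C * noiseLevel d b n (j + 1)) ^ r)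
  set X : ENNReal := ENNReal.ofReal ((3 / 2 * C * noiseLevel d b n k) ^ r) with hX
  set W : ENNReal := ENNReal.ofReal ((2 * M) ^ r) with hW
  have hpt : ∀ Z : Sample d n, ENNReal.ofReal (|lepskiEst C θ n Z - a| ^ r) ≤
      X + ∑ j ∈ Finset.Ico k N, (E j).indicator (fun _ => Y j) Z +
        (E N).indicator (fun _ => W) Z := by
    intro Z
    by_cases hall : ∀ l, k ≤ l → l ≤ N → Z ∉ E l
    · refine le_trans ?_ (le_add_right (le_add_right le_rfl))
      refine ENNReal.ofReal_le_ofReal (Real.rpow_le_rpow (abs_nonneg _) ?_ hr)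
      exact abs_lepskiEst_sub_le hC hn hk fun l h1 h2 => not_lt.1 (hall l h1 h2)
    · push Not at hall
      obtain ⟨l₀, h1, h2, h3⟩ := hall
      classical
      -- Beyond the last inaccurate index `j` everything is accurate, so the selected estimator is
      -- as good as the one at `j + 1`. If `j = N` there is no successor, and the trivial bound
      -- takes over.
      have hne : ((Finset.Icc k N).filter fun l => Z ∈ E l).Nonempty :=
        ⟨l₀, Finset.mem_filter.2 ⟨Finset.mem_Icc.2 ⟨h1, h2⟩, h3⟩⟩
      set j := Finset.max' _ hne with hj
      have hjm := Finset.max'_mem _ hne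
      rw [← hj, Finset.mem_filter, Finset.mem_Icc] at hjm
      obtain ⟨⟨hkj, hjN⟩, hjE⟩ := hjm
      rcases hjN.lt_or_eq with hlt | heq
      · have hlast : |lepskiEst C θ n Z - a| ≤ 3 / 2 * C * noiseLevel d b n (j + 1) := by
          refine abs_lepskiEst_sub_le hC hn (by omega) fun l h4 h5 => not_lt.1 fun h6 => ?_
          have : l ≤ j := Finset.le_max' _ _
            (Finset.mem_filter.2 ⟨Finset.mem_Icc.2 ⟨by omega, h5⟩, h6⟩)
          omega
        refine le_trans ?_ (le_add_right (le_add_left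
          (Finset.single_le_sum (f := fun j => (E j).indicator (fun _ => Y j) Z)
            (fun _ _ => zero_le) (Finset.mem_Ico.2 ⟨hkj, hlt⟩))))
        simp only [indicator_of_mem hjE]
        exact ENNReal.ofReal_le_ofReal (Real.rpow_le_rpow (abs_nonneg _) hlast hr)
      · rw [heq] at hjE
        refine le_trans ?_ (le_add_left le_rfl)
        rw [indicator_of_mem hjE]
        exact ENNReal.ofReal_le_ofReal (Real.rpow_le_rpow (abs_nonneg _) (hM Z) hr)
  have hM0 : 0 ≤ 2 * M := (abs_nonneg _).trans (hM fun _ => 0)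
  calc ∫⁻ Z, ENNReal.ofReal (|lepskiEst C θ n Z - a| ^ r) ∂μ
      ≤ ∫⁻ Z, (X + ∑ j ∈ Finset.Ico k N, (E j).indicator (fun _ => Y j) Z +
        (E N).indicator (fun _ => W) Z) ∂μ := lintegral_mono hpt
    _ = X * μ univ + ∑ j ∈ Finset.Ico k N, Y j * μ (E j) + W * μ (E N) := by
        rw [lintegral_add_right _ (measurable_const.indicator (hEm N)),
          lintegral_add_left measurable_const, lintegral_const,
          lintegral_finsetSum _ fun j _ => measurable_const.indicator (hEm j),
          lintegral_indicator_const (hEm N)]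
        congr 2
        exact Finset.sum_congr rfl fun j _ => lintegral_indicator_const (hEm j) _
    _ ≤ X * 1 + ∑ j ∈ Finset.Ico k N, Y j * ENNReal.ofReal (D * Real.exp (-(A * wt j))) +
          W * ENNReal.ofReal (D * Real.exp (-(A * wt N))) := by
        refine add_le_add (add_le_add (by gcongr) (Finset.sum_le_sum fun j hj => ?_)) ?_
        · rw [Finset.mem_Ico] at hj
          gcongr; exact htail j hj.1 hj.2.le
        · gcongr; exact htail N hk le_rfl
    _ = _ := by
        have e : ∀ j, Y j * ENNReal.ofReal (D * Real.exp (-(A * wt j))) =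
            ENNReal.ofReal (D * (3 / 2 * C) ^ r *
              (noiseLevel d b n (j + 1) ^ r * Real.exp (-(A * wt j)))) := fun j => by
          rw [← ENNReal.ofReal_mul (by have := hS (j + 1); positivity),
            Real.mul_rpow (by positivity) (hS _)]
          congr 1; ring
        have e2 : W * ENNReal.ofReal (D * Real.exp (-(A * wt N))) =
            ENNReal.ofReal (D * (2 * M) ^ r * Real.exp (-(A * wt N))) := by
          rw [← ENNReal.ofReal_mul (by positivity)]
          congr 1; ring
        have hterm : ∀ j, 0 ≤ D * (3 / 2 * C) ^ r *
              (noiseLevel d b n (j + 1) ^ r * Real.exp (-(A * wt j))) := fun j => by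
          have := hS (j + 1); positivity
        have hSk := hS k
        rw [mul_one, Finset.sum_congr rfl fun j _ => e j, e2,
          ← ENNReal.ofReal_sum_of_nonneg fun j _ => hterm j, ← Finset.mul_sum,
          ← ENNReal.ofReal_add (by positivity)
            (by rw [Finset.mul_sum]; exact Finset.sum_nonneg fun j _ => hterm j),
          ← ENNReal.ofReal_add
            (add_nonneg (by positivity)
              (by rw [Finset.mul_sum]; exact Finset.sum_nonneg fun j _ => hterm j))
            (by positivity)]

end Lepski

/-! ### Uniform risk bound -/

/-- Convexity of the cube passes the support condition from `h₀` to every smaller bandwidth. -/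
lemma add_smul_mem_cube {d : ℕ} {x₀ z : Fin d → ℝ} (hx₀ : x₀ ∈ cube d) {h₀ h : ℝ}
    (h0 : 0 < h₀) (hh : 0 ≤ h) (hle : h ≤ h₀) (hz : x₀ + h₀ • z ∈ cube d) :
    x₀ + h • z ∈ cube d := by
  have hconv : Convex ℝ (cube d) := convex_Icc _ _
  have := hconv.add_smul_sub_mem hx₀ hz
    (⟨div_nonneg hh h0.le, (div_le_one h0).2 hle⟩ : h / h₀ ∈ Icc (0 : ℝ) 1)
  rwa [add_sub_cancel_left, smul_smul, div_mul_cancel₀ _ h0.ne'] at this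

lemma one_le_numIdx (d b : ℕ) : 1 ≤ numIdx d b :=
  Finset.card_pos.2 ⟨0, zero_mem_multiIdx d b⟩

lemma abs_apply_zero_le {d b : ℕ} {M : ℝ} {t : Coef d b} (ht : t ∈ paramSet d b M) :
    |t ⟨0, zero_mem_multiIdx d b⟩| ≤ M :=
  (Finset.single_le_sum (f := fun p => |t p|) (fun _ _ => abs_nonneg _) (Finset.mem_univ _)).trans
    ht

section Risk

variable {d b : ℕ} {M : ℝ} {K : (Fin d → ℝ) → ℝ} {x₀ : Fin d → ℝ} {g : ℝ → ℝ} {σmin γ₀ : ℝ}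
  {σ : ℕ → ℝ} {θ : (n : ℕ) → ℝ → Sample d n → Coef d b}

lemma threshold_pos (hK : IsKernel K) (hc : 0 < huberConst g σmin γ₀) {r : ℝ} :
    0 < threshold d b K g σmin γ₀ r := by
  have h1 := minEig_pos (d := d) (b := b) hK
  have h2 : 0 < ∫ z in (0 : ℝ)..(γ₀ * σmin), g z := by
    unfold huberConst at hc; linarith
  have h3 : (0 : ℝ) < numIdx d b := by exact_mod_cast one_le_numIdx d b
  have h4 := zero_lt_one.trans_le hK.one_le_kerSup
  unfold threshold
  positivity

/-- Uniform exponential bound for the estimators at all bandwidths beyond the ideal one. -/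
lemma eventually_tail_le (hd : 1 ≤ d) (hb : 1 ≤ b) (hM : 0 < M) (hK : IsKernel K)
    (hx₀ : x₀ ∈ cube d)
    (hKx₀ : ∃ h₀ : ℝ, 0 < h₀ ∧ ∀ z, K z ≠ 0 → x₀ + h₀ • z ∈ cube d) (hg : IsSymmDensity g)
    (hσ : ∀ i, 0 < σ i) (hγ₀ : 0 < γ₀) (hc : 0 < huberConst g σmin γ₀)
    (hG : scaledDensity g σ ∈ densityClass (huber γ₀) (huberConst g σmin γ₀))
    (hθ : IsMinimizer (huber γ₀) K x₀ M θ) {β L r : ℝ} (hβ : 0 < β) (hβb : β ≤ b) (hL : 0 < L)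
    (hr : 1 ≤ r) :
    ∀ᶠ n : ℕ in atTop, ∀ f ∈ holderClass d β L M,
      (∀ i : Fin n, AEMeasurable (obsMap (σ i) f) (designNoise d g)) →
      ∀ l, idealIdx d b n β L ≤ l → l ≤ lastIdx d b n →
        obsLaw g σ f n {Z | threshold d b K g σmin γ₀ r / 2 * noiseLevel d b n l <
          |lpa θ l Z - f x₀|} ≤
        ENNReal.ofReal ((2 * numIdx d b + 2 * (numIdx d b : ℝ) ^ 2) *
          Real.exp (-(9 / 16 * (r * d) * wt l))) := by
  obtain ⟨h₀, h0, hKh₀⟩ := hKx₀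
  have hd' : (0 : ℝ) < d := by exact_mod_cast hd
  have hr0 : 0 < r := by linarith
  have hrd : 0 < √(r * d) := by positivity
  set C := threshold d b K g σmin γ₀ r with hC
  have hCpos : 0 < C := threshold_pos hK hc
  set c := huberConst g σmin γ₀ with hcdef
  have hlampos := minEig_pos (d := d) (b := b) hK
  set lam := minEig d b K with hlam
  have hNb : (1 : ℝ) ≤ numIdx d b := by exact_mod_cast one_le_numIdx d b
  set Nb : ℝ := (numIdx d b : ℝ) with hNbdef
  have hK1 := hK.one_le_kerSup
  set Ks := kerSup K with hKs
  have hq1 : 1 ≤ max 1 γ₀ := le_max_left _ _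
  have hqγ : γ₀ ≤ max 1 γ₀ := le_max_right _ _
  set q := max 1 γ₀ with hq
  set X := 3 / 2 * Ks * q * √(r * d) with hX
  have hXpos : 0 < X := by positivity
  set η := min 1 (c * lam / (8 * Nb ^ 2)) with hη
  have hηpos : 0 < η := lt_min one_pos (by positivity)
  -- The calibration of the threshold: half of it tolerates a score deviation of `X` noise levels
  -- together with a bias below `3/4` of a noise level.
  have hCeq : 3 / 8 * (c * lam) * (C / 2) = Nb * (3 / 4 + X) := by
    have hI : 0 < ∫ z in (0 : ℝ)..(γ₀ * σmin), g z := by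
      have : 0 < 2 * ∫ z in (0 : ℝ)..(γ₀ * σmin), g z := hc
      linarith
    have hc2 : c = 2 * ∫ z in (0 : ℝ)..(γ₀ * σmin), g z := rfl
    rw [hC, threshold, ← hlam, ← hKs, ← hq, ← hNbdef, hc2, hX]
    field_simp
    ring
  -- The three bounds secure, in this order, a bias of at most `γ₀ / 16`, a score deviation in the
  -- Gaussian regime, and a localisation radius within the range of the quadratic bound.
  set s₀ := min (γ₀ / 8) (min (γ₀ / X) (γ₀ / (8 * (Nb * C)))) with hs₀
  have hs₀pos : 0 < s₀ := lt_min (by positivity) (lt_min (by positivity) (by positivity))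
  -- Chosen so that the curvature tail also has exponent at least `(9/16) r d wt`.
  set κ := η ^ 2 / (4 * Ks) / (9 / 16 * (r * d)) with hκ
  have hκpos : 0 < κ := by positivity
  filter_upwards [eventually_noiseLevel_le hd hb hs₀pos hκpos, eventually_hMax_le hd h0,
    eventually_bias_le hd hb hβ hL, eventually_gt_atTop 0] with n hnoise hmax hbias hn
    f hf hfm l hkl hl
  have hS := noiseLevel_pos (d := d) (b := b) hn l
  obtain ⟨hSs, hwκ⟩ := hnoise l hl
  have hmem := bandwidth_mem (d := d) (b := b) hn l
  have hh := hmem.1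
  set h := bandwidth d b n l with hhdef
  set S := noiseLevel d b n l with hSdef
  have hKh : ∀ z, K z ≠ 0 → x₀ + h • z ∈ cube d := fun z hz =>
    add_smul_mem_cube hx₀ h0 hh.le ((bandwidth_le_hMax hn l).trans hmax) (hKh₀ z hz)
  obtain ⟨t, htM, ht0, htB⟩ := exists_locPoly_approx hβ hβb hL hM.le hx₀ hf hh hmem.2
  have hBS : L * (d * h / 2) ^ β ≤ S / 2 := bias_le_of_idealIdx_le hn hβ hL hbias hkl
  have hS1 : S ≤ γ₀ / 8 := hSs.trans (min_le_left _ _)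
  have hS2 : X * S ≤ γ₀ := by
    have : S ≤ γ₀ / X := hSs.trans ((min_le_right _ _).trans (min_le_left _ _))
    rwa [le_div_iff₀ hXpos, mul_comm] at this
  have hS3 : Nb * (C / 2 * S) ≤ γ₀ / 16 := by
    have : S ≤ γ₀ / (8 * (Nb * C)) := hSs.trans ((min_le_right _ _).trans (min_le_right _ _))
    rw [le_div_iff₀ (by positivity)] at this
    linarith
  have hηc : Nb ^ 2 * η ≤ c * lam / 8 := by
    have : η ≤ c * lam / (8 * Nb ^ 2) := min_le_right _ _
    rw [le_div_iff₀ (by positivity)] at this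
    linarith
  have hbal : Nb * (X * S + L * (d * h / 2) ^ β) < 3 / 8 * (c * lam) * (C / 2 * S) := by
    have e : 3 / 8 * (c * lam) * (C / 2 * S) = Nb * (3 / 4 * S + X * S) := by
      rw [← mul_assoc, hCeq]; ring
    rw [e]
    gcongr Nb * ?_
    linarith
  have hmain := measure_local_error_le hK hh hKh hg hσ hfm hn hγ₀ hc.le
    (fun i => le_mass_of_mem_densityClass hg hσ hγ₀ hG i) htB (by linarith)
    (θ := θ n h) (fun Z => ((hθ n h hmem).2 Z).2 t htM) (x := X * S) (δ := C / 2 * S) (η := η)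
    (by positivity) hS2 (by positivity) hS3 hηpos.le (min_le_left _ _) hηc hbal
    ⟨0, zero_mem_multiIdx d b⟩
  rw [ht0] at hmain
  refine hmain.trans ?_
  have hw : n * h ^ d * S ^ 2 = wt l := mul_noiseLevel_sq hn l
  have hwt := one_le_wt l
  -- The origin of `9/16`: `X² / (4 γ₀² K_∞) ≥ (9/16) r d`, because `max 1 γ₀ ≥ γ₀` and `K_∞ ≥ 1`.
  have e1 : 9 / 16 * (r * d) * wt l ≤ n * h ^ d * (X * S) ^ 2 / (4 * (γ₀ ^ 2 * Ks)) := by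
    have : n * h ^ d * (X * S) ^ 2 = X ^ 2 * wt l := by rw [← hw]; ring
    rw [this, le_div_iff₀ (by positivity), hX, mul_pow, Real.sq_sqrt (by positivity)]
    have h1 : γ₀ ^ 2 ≤ q ^ 2 := by gcongr
    have h2 : Ks ≤ Ks ^ 2 := le_self_pow₀ hK1 two_ne_zero
    calc 9 / 16 * (r * d) * wt l * (4 * (γ₀ ^ 2 * Ks))
        = 9 / 4 * (r * d) * wt l * (γ₀ ^ 2 * Ks) := by ring
      _ ≤ 9 / 4 * (r * d) * wt l * (q ^ 2 * Ks ^ 2) := by gcongr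
      _ = _ := by ring
  have e2 : 9 / 16 * (r * d) * wt l ≤ n * h ^ d * η ^ 2 / (4 * Ks) := by
    calc 9 / 16 * (r * d) * wt l ≤ 9 / 16 * (r * d) * (κ * (n * h ^ d)) := by gcongr
      _ = _ := by rw [hκ]; field_simp
  have hcast : (numIdx d b : ENNReal) = ENNReal.ofReal Nb := by
    rw [hNbdef, ENNReal.ofReal_natCast]
  rw [hcast, ← ENNReal.ofReal_pow (by positivity), ← ENNReal.ofReal_mul (by positivity),
    ← ENNReal.ofReal_mul (by positivity), ← ENNReal.ofReal_add (by positivity) (by positivity)]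
  refine ENNReal.ofReal_le_ofReal ?_
  have f1 := Real.exp_le_exp.2 (neg_le_neg e1)
  have f2 := Real.exp_le_exp.2 (neg_le_neg e2)
  calc Nb * (2 * Real.exp (-(n * h ^ d * (X * S) ^ 2 / (4 * (γ₀ ^ 2 * Ks))))) +
        Nb ^ 2 * (2 * Real.exp (-(n * h ^ d * η ^ 2 / (4 * Ks))))
      ≤ Nb * (2 * Real.exp (-(9 / 16 * (r * d) * wt l))) +
        Nb ^ 2 * (2 * Real.exp (-(9 / 16 * (r * d) * wt l))) := by gcongr
    _ = _ := by ring

/-- The maximal risk is of the order of the adaptive rate. -/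
theorem exists_maxRisk_le (hd : 1 ≤ d) (hb : 1 ≤ b) (hM : 0 < M) (hK : IsKernel K)
    (hx₀ : x₀ ∈ cube d)
    (hKx₀ : ∃ h₀ : ℝ, 0 < h₀ ∧ ∀ z, K z ≠ 0 → x₀ + h₀ • z ∈ cube d) (hg : IsSymmDensity g)
    (hσ : ∀ i, 0 < σ i) (hγ₀ : 0 < γ₀) (hc : 0 < huberConst g σmin γ₀)
    (hG : scaledDensity g σ ∈ densityClass (huber γ₀) (huberConst g σmin γ₀))
    (hθ : IsMinimizer (huber γ₀) K x₀ M θ) {β L r : ℝ} (hβ : 0 < β) (hβb : β ≤ b) (hL : 0 < L)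
    (hr : 1 ≤ r) :
    ∃ R : ℝ, ∀ᶠ n : ℕ in atTop,
      maxRisk g σ x₀ r n (lepskiEst (threshold d b K g σmin γ₀ r) θ n) (holderClass d β L M) ≤
        ENNReal.ofReal (R * adaptiveRate d b n β ^ r) := by
  obtain ⟨A₁, hA₁, hideal⟩ := noiseLevel_idealIdx_le hd hβ hβb hL
  obtain ⟨A₂, hA₂, hsum⟩ := sum_noiseLevel_rpow_mul_exp_le (b := b) hd hr
  set C := threshold d b K g σmin γ₀ r with hC
  have hCpos : 0 < C := threshold_pos hK hc
  set D := 2 * (numIdx d b : ℝ) + 2 * (numIdx d b : ℝ) ^ 2 with hD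
  have hD0 : 0 ≤ D := by positivity
  refine ⟨(3 / 2 * C * A₁) ^ r + D * (3 / 2 * C) ^ r * A₂ + D * (2 * M) ^ r, ?_⟩
  filter_upwards [eventually_tail_le hd hb hM hK hx₀ hKx₀ hg hσ hγ₀ hc hG hθ hβ hβb hL hr,
    eventually_bias_le hd hb hβ hL, eventually_exp_wt_lastIdx_le hd hb hr, eventually_le_log 0,
    eventually_gt_atTop 0] with n htail hbias hexp hl hn
  have hφ := adaptiveRate_pos hd hβ hβb hn hl
  have hS0φ := noiseLevel_zero_le_adaptiveRate hd hβ hβb hn hl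
  have hS0 := noiseLevel_nonneg (d := d) (b := b) (n := n) 0
  have hk : idealIdx d b n β L ≤ lastIdx d b n := Nat.sInf_le hbias
  refine iSup₂_le fun f hf => ?_
  -- Measurability is not derived from the Hölder conditions: if an observation map failed to be
  -- a.e. measurable, its pushforward, hence the product law and the risk, would be zero.
  by_cases hfm : ∀ i : Fin n, AEMeasurable (obsMap (σ i) f) (designNoise d g)
  swap
  · push Not at hfm
    obtain ⟨i, hi⟩ := hfm
    rw [obsLaw_eq_zero hg hi]; simp
  have hP : ∀ i : Fin n, IsProbabilityMeasure (obsLawOne g (σ i) f) := fun i =>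
    isProbabilityMeasure_obsLawOne hg (hfm i)
  have hμ : obsLaw g σ f n univ ≤ 1 := by
    unfold obsLaw
    exact prob_le_one
  -- Bandwidth `1` serves only to obtain `|f x₀| ≤ M`, whence the trivial error bound `2 * M`.
  obtain ⟨t, htM, ht0, -⟩ := exists_locPoly_approx (b := b) hβ hβb hL hM.le hx₀ hf one_pos le_rfl
  have hbound : ∀ Z : Sample d n, |lepskiEst C θ n Z - f x₀| ≤ 2 * M := fun Z => by
    have h1 := abs_apply_zero_le ((hθ n _ (bandwidth_mem (d := d) (b := b) hn (selIdx C θ Z))).2 Z).1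
    have h2 := abs_apply_zero_le htM
    rw [ht0] at h2
    have h3 := abs_sub (lepskiEst C θ n Z) (f x₀)
    have h4 : |lepskiEst C θ n Z| ≤ M := h1
    linarith
  have hmeas : ∀ k, Measurable (lpa θ k : Sample d n → ℝ) := fun k =>
    (measurable_pi_apply _).comp (hθ n _ (bandwidth_mem hn k)).1
  refine (lintegral_lepskiEst_le hCpos.le hn hμ hmeas (by linarith) hbound hk hD0
    (htail f hf hfm)).trans (ENNReal.ofReal_le_ofReal ?_)
  have hSr : noiseLevel d b n 0 ^ r ≤ adaptiveRate d b n β ^ r := by gcongr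
  have h1 : (3 / 2 * C * noiseLevel d b n (idealIdx d b n β L)) ^ r ≤
      (3 / 2 * C * A₁) ^ r * adaptiveRate d b n β ^ r := by
    rw [← Real.mul_rpow (by positivity) hφ.le]
    have := noiseLevel_nonneg (d := d) (b := b) (n := n) (idealIdx d b n β L)
    refine Real.rpow_le_rpow (by positivity) ?_ (by linarith)
    rw [mul_assoc (3 / 2 * C)]
    gcongr
    exact hideal n hn hl
  have h2 : ∑ j ∈ Finset.Ico (idealIdx d b n β L) (lastIdx d b n),
      noiseLevel d b n (j + 1) ^ r * Real.exp (-(9 / 16 * (r * d) * wt j)) ≤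
      A₂ * adaptiveRate d b n β ^ r :=
    (hsum n hn _ _).trans (by gcongr)
  have h3 := hexp.trans hSr
  calc _ ≤ (3 / 2 * C * A₁) ^ r * adaptiveRate d b n β ^ r +
        D * (3 / 2 * C) ^ r * (A₂ * adaptiveRate d b n β ^ r) +
        D * (2 * M) ^ r * adaptiveRate d b n β ^ r := by gcongr
    _ = _ := by ring

end Risk

end

end HuberLepski

open HuberLepski
theorem corollary1
    (d b : ℕ) (hd : 1 ≤ d) (hb : 1 ≤ b) (M : ℝ) (hM : 0 < M)
    (K : (Fin d → ℝ) → ℝ) (hK : IsKernel K)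
    (x₀ : Fin d → ℝ) (hx₀ : x₀ ∈ cube d)
    (hKx₀ : ∃ h₀ : ℝ, 0 < h₀ ∧ ∀ z, K z ≠ 0 → x₀ + h₀ • z ∈ cube d)
    (g : ℝ → ℝ) (hg : IsSymmDensity g)
    (σmin : ℝ) (hσmin : 0 < σmin) (σ : ℕ → ℝ) (hσ : ∀ i, σmin ≤ σ i)
    (γ₀ : ℝ) (hγ₀ : 0 < γ₀) (hc : 0 < huberConst g σmin γ₀)
    (hG : scaledDensity g σ ∈ densityClass (huber γ₀) (huberConst g σmin γ₀))
    (θ : (n : ℕ) → ℝ → Sample d n → Coef d b) (hθ : IsMinimizer (huber γ₀) K x₀ M θ) :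
    ∀ β ∈ Ioc (0 : ℝ) b, ∀ L : ℝ, 0 < L → ∀ r : ℝ, 1 ≤ r →
      limsup (fun n : ℕ =>
        ENNReal.ofReal (adaptiveRate d b n β ^ (-r)) *
          maxRisk g σ x₀ r n (lepskiEst (threshold d b K g σmin γ₀ r) θ n)
            (holderClass d β L M)) atTop < ⊤ := by
  intro β hβ L hL r hr
  obtain ⟨R, hR⟩ := exists_maxRisk_le hd hb hM hK hx₀ hKx₀ hg (fun i => hσmin.trans_le (hσ i))
    hγ₀ hc hG hθ hβ.1 hβ.2 hL hr
  refine lt_of_le_of_lt (limsup_le_of_le (a := ENNReal.ofReal R) (h := ?_)) ENNReal.ofReal_lt_top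
  filter_upwards [hR, eventually_le_log 0, eventually_gt_atTop 0] with n hn hl h0
  have hφ := adaptiveRate_pos hd hβ.1 hβ.2 h0 hl
  calc _ ≤ ENNReal.ofReal (adaptiveRate d b n β ^ (-r)) *
        ENNReal.ofReal (R * adaptiveRate d b n β ^ r) := by gcongr
    _ = ENNReal.ofReal R := by
        rw [← ENNReal.ofReal_mul (by positivity), Real.rpow_neg hφ.le]
        congr 1
        field_simp
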